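/- Let $A\subset\mathbb R^2$ be a bounded open set with Lipschitz boundary, and let $\Gamma\subseteq\partial A$ be $\mathcal H^1$-measurable with nonempty relative interior in $\partial A$. Let $$K(\Gamma,A)=\inf\Big\{\int_A|\nabla v|^2\,dx\,dy:\ v\in H^1(A),\ \int_\Gamma v^2\,d\mathcal H^1=1,\ v=0\text{ on }\partial A\setminus\Gamma\Big\},$$ where boundary values are understood in the sense of traces ($\mathcal H^1$-a.e.). A real number $\lambda$ is called an eigenvalue of the problem $$\Delta u=0\ \text{ in }A,\qquad \frac{\partial u}{\partial\nu}=\lambda u\ \text{ on }\Gamma,\qquad u=0\ \text{ on }\partial A\setminus\Gamma \tag{1}$$ if there is a function $u\in H^1(A)$, not identically zero (an eigenfunction), which is harmonic in $A$, has zero trace on $\partial A\setminus\Gamma$, and satisfies the condition on the normal derivative in the sense of Green's formula, i.e. $\int_A\nabla u\cdot\nabla\varphi\,dx\,dy=\lambda\int_\Gamma u\varphi\,d\mathcal H^1$ for all $\varphi\in H^1(A)$ with $\varphi=0$ on $\partial A\setminus\Gamma$. Then the infimum is taken over a nonempty set, and $K(\Gamma,A)$ is the first (smallest) eigenvalue of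 (1). Moreover, if $A$ is connected, then $K(\Gamma,A)$ is the unique eigenvalue of (1) that has an eigenfunction $u$ with $u>0$ everywhere in $A$; in particular it does have such an eigenfunction. -/

import Mathlib

open MeasureTheory Filter Topology
open scoped ContDiff

noncomputable section

namespace Steklov

/-- The Euclidean plane. -/
abbrev Plane : Type := EuclideanSpace ℝ (Fin 2)

/-- `A` has Lipschitz boundary: near each boundary point, in suitable orthonormal coordinates,
`A` is the set of points lying strictly on one side of the graph of a Lipschitz function. -/
def HasLipschitzBoundary (A : Set Plane) : Prop :=
  ∀ x ∈ frontier A, ∃ (e : Plane ≃ₗᵢ[ℝ] Plane) (f : ℝ → ℝ) (L : NNReal),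
    LipschitzWith L f ∧ ∀ᶠ y in 𝓝 x, (y ∈ A ↔ f (e y 0) < e y 1)

/-- One-dimensional Hausdorff measure on the boundary of `A`. -/
def bdryMeasure (A : Set Plane) : Measure Plane :=
  (Measure.hausdorffMeasure 1).restrict (frontier A)

/-- `u` belongs to the Sobolev space `H¹(A)` and `g` is its weak gradient. -/
structure MemH1 (A : Set Plane) (u : Plane → ℝ) (g : Plane → Plane) : Prop where
  memLp : MemLp u 2 (volume.restrict A)
  memLp_grad : MemLp g 2 (volume.restrict A)
  weak_grad : ∀ φ : Plane → ℝ, ContDiff ℝ ∞ φ → HasCompactSupport φ → tsupport φ ⊆ A →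
    ∫ x in A, u x • gradient φ x = -∫ x in A, φ x • g x

/-- `t ∈ L²(∂A)` is the trace on `∂A` of the function `u ∈ H¹(A)` with weak gradient `g`:
it is the `L²(∂A)`-limit of the boundary values of functions, smooth up to the boundary,
that converge to `u` in `H¹(A)`. -/
structure IsTrace (A : Set Plane) (u : Plane → ℝ) (g : Plane → Plane) (t : Plane → ℝ) :
    Prop where
  memLp : MemLp t 2 (bdryMeasure A)
  approx : ∃ φ : ℕ → Plane → ℝ, (∀ n, ContDiff ℝ ∞ (φ n)) ∧
    Tendsto (fun n => eLpNorm (fun x => φ n x - u x) 2 (volume.restrict A)) atTop (𝓝 0) ∧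
    Tendsto (fun n => eLpNorm (fun x => gradient (φ n) x - g x) 2 (volume.restrict A))
      atTop (𝓝 0) ∧
    Tendsto (fun n => eLpNorm (fun x => φ n x - t x) 2 (bdryMeasure A)) atTop (𝓝 0)

/-- `u ∈ H¹(A)`, with weak gradient `g` and trace `t`, and `u = 0` on `∂A ∖ Γ` (that is, the
trace vanishes almost everywhere there with respect to one-dimensional Hausdorff measure). -/
structure MemH1Vanishing (A Γ : Set Plane) (u : Plane → ℝ) (g : Plane → Plane)
    (t : Plane → ℝ) : Prop where
  memH1 : MemH1 A u g
  isTrace : IsTrace A u g t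
  vanish : ∀ᵐ x ∂(bdryMeasure A), x ∉ Γ → t x = 0

/-- The Dirichlet energies of the competitors in the problem that defines `K(Γ, A)`. -/
def energies (Γ A : Set Plane) : Set ℝ :=
  {c | ∃ (v : Plane → ℝ) (g : Plane → Plane) (t : Plane → ℝ), MemH1Vanishing A Γ v g t ∧
    ∫ x in Γ, t x ^ 2 ∂(Measure.hausdorffMeasure 1) = 1 ∧ c = ∫ x in A, ‖g x‖ ^ 2}

/-- The constant `K(Γ, A)`. -/
def K (Γ A : Set Plane) : ℝ := sInf (energies Γ A)

/-- A harmonic function in `H¹(A)` with weak gradient `g` has normal derivative `h` on `Γ`,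
in the sense of Green's formula tested with the `H¹(A)` functions that vanish on `∂A ∖ Γ`. -/
def HasNormalDeriv (A Γ : Set Plane) (g : Plane → Plane) (h : Plane → ℝ) : Prop :=
  ∀ (v : Plane → ℝ) (gv : Plane → Plane) (tv : Plane → ℝ), MemH1Vanishing A Γ v gv tv →
    ∫ x in A, inner ℝ (g x) (gv x) = ∫ x in Γ, h x * tv x ∂(Measure.hausdorffMeasure 1)

/-- `u` is a (nontrivial) eigenfunction with eigenvalue `lam` of the problem
`Δu = 0` in `A`, `∂u/∂ν = lam u` on `Γ`, `u = 0` on `∂A ∖ Γ`. -/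
def IsEigenfunction (A Γ : Set Plane) (lam : ℝ) (u : Plane → ℝ) : Prop :=
  (∃ x ∈ A, u x ≠ 0) ∧ InnerProductSpace.HarmonicOnNhd u A ∧
    ∃ (g : Plane → Plane) (t : Plane → ℝ), MemH1Vanishing A Γ u g t ∧
      HasNormalDeriv A Γ g (fun x => lam * t x)

/-- `lam` is an eigenvalue of that problem. -/
def IsEigenvalue (A Γ : Set Plane) (lam : ℝ) : Prop := ∃ u, IsEigenfunction A Γ lam u

end Steklov

end

/-! The proof is the direct method applied to the quotient of the Dirichlet energy by the squared
`L²` norm of the trace. The space `H1 A` is the closure, in a product of three `L²` spaces, of the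
triples (function, gradient, boundary values) of smooth functions. Any estimate proved for smooth
functions by integration along segments therefore passes to it by density.

Two such estimates carry the existence part. `friedrichs` bounds the `L²` norm of a function by its
gradient and its trace. `isCompactOperator_traceL` says that the trace is compact: near the boundary
a function differs in `L²` from its means over small squares by little compared with the energy, so
the trace is a norm limit of finite-rank operators. Along a minimizing sequence compactness makes
the traces converge, the parallelogram law then makes the gradients Cauchy, and `friedrichs` makes
the functions Cauchy. The minimizer satisfies the weak equation (`euler_lagrange`), and Weyl's lemma
(`weyl`) gives it a harmonic representative. Testing the equation of any eigenfunction with itself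
shows that its eigenvalue is a value of the quotient, so no eigenvalue lies below `K`.

If `w` is a minimizer, so is its absolute value, because passing to it does not raise the energy
(`exists_abs_mem_V`). A nonnegative solution on a connected set is positive by the strong minimum
principle, which comes out of the mollification in `weyl`.

For uniqueness (`IsWeakSolution.eq_of_pos`), positive solutions for distinct eigenvalues have
orthogonal traces. These traces are only known to be nonnegative, so orthogonality is not yet
absurd. It does imply that `|w₂ - w₁|` has the same trace as `w₁ + w₂`, and that `w₂ - w₁` and `w₁ +
w₂` have equal energy. Since `w₁ + w₂` has least energy for its trace, uniquely so, `|w₂ - w₁| = w₁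
+ w₂`, which is impossible for positive functions. -/

open MeasureTheory Filter Topology
open scoped ContDiff NNReal ENNReal
noncomputable section
namespace Steklov
-- Orthonormal frames of the plane.
/-- The point with coordinates `(x, y)` in the orthonormal frame given by `e`. -/
def pt (e : Plane ≃ₗᵢ[ℝ] Plane) (x y : ℝ) : Plane := e.symm !₂[x, y]

@[simp] lemma apply_pt_zero (e : Plane ≃ₗᵢ[ℝ] Plane) (x y : ℝ) : e (pt e x y) 0 = x := by
  simp [pt]

@[simp] lemma apply_pt_one (e : Plane ≃ₗᵢ[ℝ] Plane) (x y : ℝ) : e (pt e x y) 1 = y := by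
  simp [pt]

lemma pt_apply (e : Plane ≃ₗᵢ[ℝ] Plane) (p : Plane) : pt e (e p 0) (e p 1) = p := by
  rw [pt, LinearIsometryEquiv.symm_apply_eq]
  ext i; fin_cases i <;> simp

/-- Unit vectors along the axes of the frame. -/
def axis (e : Plane ≃ₗᵢ[ℝ] Plane) (i : Fin 2) : Plane := e.symm (EuclideanSpace.single i 1)

lemma norm_axis (e : Plane ≃ₗᵢ[ℝ] Plane) (i : Fin 2) : ‖axis e i‖ = 1 := by
  simp [axis]

lemma pt_eq (e : Plane ≃ₗᵢ[ℝ] Plane) (x y : ℝ) : pt e x y = x • axis e 0 + y • axis e 1 := by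
  rw [pt, axis, axis, LinearIsometryEquiv.symm_apply_eq]
  simp only [map_add, map_smul, LinearIsometryEquiv.apply_symm_apply]
  ext i; fin_cases i <;> simp

lemma dist_pt_le (e : Plane ≃ₗᵢ[ℝ] Plane) (x y x' y' : ℝ) :
    dist (pt e x y) (pt e x' y') ≤ |x - x'| + |y - y'| := by
  have h : pt e x y - pt e x' y' = (x - x') • axis e 0 + (y - y') • axis e 1 := by
    simp only [pt_eq]; module
  rw [dist_eq_norm, h]
  refine (norm_add_le _ _).trans ?_
  simp [norm_smul, norm_axis]

lemma continuous_pt (e : Plane ≃ₗᵢ[ℝ] Plane) : Continuous fun q : ℝ × ℝ => pt e q.1 q.2 := by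
  simp only [pt_eq]; fun_prop

lemma abs_sub_le_dist (e : Plane ≃ₗᵢ[ℝ] Plane) (i : Fin 2) (p q : Plane) :
    |e p i - e q i| ≤ dist p q := by
  rw [← e.dist_map p q, dist_eq_norm]
  have := PiLp.norm_apply_le (e p - e q) i
  simpa using this

lemma continuous_coord (e : Plane ≃ₗᵢ[ℝ] Plane) (i : Fin 2) : Continuous fun p => e p i := by
  fun_prop

/-- The frame coordinates as a measurable equivalence. -/
def ptEquiv (e : Plane ≃ₗᵢ[ℝ] Plane) : (ℝ × ℝ) ≃ᵐ Plane where
  toFun q := pt e q.1 q.2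
  invFun p := (e p 0, e p 1)
  left_inv q := by simp
  right_inv p := by simp [pt_apply]
  measurable_toFun := (continuous_pt e).measurable
  measurable_invFun := by
    have h : Continuous fun p => (e p 0, e p 1) :=
      (continuous_coord e 0).prodMk (continuous_coord e 1)
    exact h.measurable

lemma measurePreserving_pt (e : Plane ≃ₗᵢ[ℝ] Plane) :
    MeasurePreserving (ptEquiv e) (volume : Measure (ℝ × ℝ)) volume := by
  have h1 := (volume_preserving_finTwoArrow ℝ).symm
  have h2 := PiLp.volume_preserving_toLp (Fin 2)
  have h3 := e.symm.measurePreserving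
  have h := h3.comp (h2.comp h1)
  exact h

lemma lintegral_pt (e : Plane ≃ₗᵢ[ℝ] Plane) (F : Plane → ℝ≥0∞) (hF : Measurable F) :
    ∫⁻ p, F p = ∫⁻ x, ∫⁻ y, F (pt e x y) := by
  rw [← (measurePreserving_pt e).lintegral_comp_emb (ptEquiv e).measurableEmbedding,
    Measure.volume_eq_prod, lintegral_prod]
  · rfl
  · exact (hF.comp (ptEquiv e).measurable).aemeasurable

/-! ### Charts in which the boundary is a Lipschitz graph. -/

/-- A rectangle, in suitable orthonormal coordinates and relative to the graph of a Lipschitz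
function `f`, in which `A` is the part above the graph. -/
structure GraphChart (A : Set Plane) where
  e : Plane ≃ₗᵢ[ℝ] Plane
  f : ℝ → ℝ
  L : ℝ≥0
  a : ℝ
  ρ : ℝ
  H : ℝ
  ρ_pos : 0 < ρ
  H_pos : 0 < H
  lip : LipschitzWith L f
  mem_iff : ∀ x s, |x - a| < ρ → |s| < H → (pt e x (f x + s) ∈ A ↔ 0 < s)

namespace GraphChart

variable {A : Set Plane} (c : GraphChart A)

/-- The domain of a chart. -/
def nbhd : Set Plane := {p | |c.e p 0 - c.a| < c.ρ ∧ |c.e p 1 - c.f (c.e p 0)| < c.H}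

lemma continuous_height : Continuous fun p => c.e p 1 - c.f (c.e p 0) :=
  (continuous_coord _ _).sub (c.lip.continuous.comp (continuous_coord _ _))

lemma isOpen_nbhd : IsOpen c.nbhd :=
  (isOpen_lt ((continuous_coord c.e 0).sub continuous_const).abs continuous_const).inter
    (isOpen_lt c.continuous_height.abs continuous_const)

lemma mem_A_iff {p : Plane} (hp : p ∈ c.nbhd) : p ∈ A ↔ c.f (c.e p 0) < c.e p 1 := by
  have := c.mem_iff (c.e p 0) (c.e p 1 - c.f (c.e p 0)) hp.1 hp.2
  rw [add_sub_cancel, pt_apply] at this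
  rw [this, sub_pos]

/-- The boundary point over `x`. -/
def graphPt (x : ℝ) : Plane := pt c.e x (c.f x)

lemma continuous_graphPt : Continuous c.graphPt :=
  (continuous_pt c.e).comp (continuous_id.prodMk c.lip.continuous)

lemma mem_frontier_iff (hA : IsOpen A) {p : Plane} (hp : p ∈ c.nbhd) :
    p ∈ frontier A ↔ c.e p 1 = c.f (c.e p 0) := by
  rw [hA.frontier_eq]
  constructor
  · rintro ⟨h1, h2⟩
    rw [c.mem_A_iff hp, not_lt] at h2
    refine le_antisymm h2 ?_
    by_contra! h3
    have ho : IsOpen (c.nbhd ∩ {q | c.e q 1 < c.f (c.e q 0)}) :=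
      c.isOpen_nbhd.inter (isOpen_lt (continuous_coord _ _)
        (c.lip.continuous.comp (continuous_coord _ _)))
    obtain ⟨q, hq, hqA⟩ := mem_closure_iff.1 h1 _ ho ⟨hp, h3⟩
    exact lt_asymm hq.2 ((c.mem_A_iff hq.1).1 hqA)
  · intro h
    refine ⟨?_, fun h2 => ((c.mem_A_iff hp).1 h2).ne' h⟩
    have hl : Tendsto (fun s : ℝ => pt c.e (c.e p 0) (c.e p 1 + s)) (𝓝[>] 0) (𝓝 p) := by
      have : Continuous fun s : ℝ => pt c.e (c.e p 0) (c.e p 1 + s) :=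
        (continuous_pt c.e).comp (by fun_prop : Continuous fun s : ℝ => (c.e p 0, c.e p 1 + s))
      have h0 := this.tendsto 0
      rw [add_zero, pt_apply] at h0
      exact h0.mono_left nhdsWithin_le_nhds
    refine mem_closure_of_tendsto hl ?_
    filter_upwards [Ioo_mem_nhdsGT c.H_pos] with s hs
    rw [h]
    exact (c.mem_iff _ s hp.1 (by rw [abs_of_pos hs.1]; exact hs.2)).2 hs.1

lemma graphPt_mem_nbhd {x : ℝ} (hx : |x - c.a| < c.ρ) : c.graphPt x ∈ c.nbhd := by
  simp [nbhd, graphPt, hx, c.H_pos]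

lemma graphPt_mem_frontier (hA : IsOpen A) {x : ℝ} (hx : |x - c.a| < c.ρ) :
    c.graphPt x ∈ frontier A :=
  (c.mem_frontier_iff hA (c.graphPt_mem_nbhd hx)).2 (by simp [graphPt])

lemma nbhd_inter_frontier (hA : IsOpen A) :
    c.nbhd ∩ frontier A = c.graphPt '' {x | |x - c.a| < c.ρ} := by
  ext p
  constructor
  · rintro ⟨h1, h2⟩
    refine ⟨c.e p 0, h1.1, ?_⟩
    rw [graphPt, ← (c.mem_frontier_iff hA h1).1 h2, pt_apply]
  · rintro ⟨x, hx, rfl⟩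
    exact ⟨c.graphPt_mem_nbhd hx, c.graphPt_mem_frontier hA hx⟩

lemma lipschitzWith_graphPt : LipschitzWith (1 + c.L) c.graphPt := by
  refine LipschitzWith.of_dist_le_mul fun x y => ?_
  refine (dist_pt_le _ _ _ _ _).trans ?_
  have := c.lip.dist_le_mul x y
  rw [Real.dist_eq, Real.dist_eq] at this
  push_cast
  rw [Real.dist_eq]
  linarith

end GraphChart

lemma exists_graphChart {A : Set Plane} (hA : IsOpen A) (hlip : HasLipschitzBoundary A)
    {x₀ : Plane} (hx₀ : x₀ ∈ frontier A) : ∃ c : GraphChart A, x₀ ∈ c.nbhd ∧ c.e x₀ 0 = c.a := by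
  obtain ⟨e, f, L, hf, hev⟩ := hlip x₀ hx₀
  obtain ⟨r, hr, hball⟩ := Metric.eventually_nhds_iff.1 hev
  rw [hA.frontier_eq] at hx₀
  have hgraph : e x₀ 1 = f (e x₀ 0) := by
    refine le_antisymm (not_lt.1 fun h => hx₀.2 ((hball (by simpa using hr)).2 h))
      (not_lt.1 fun h => ?_)
    have ho : IsOpen (Metric.ball x₀ r ∩ {q | e q 1 < f (e q 0)}) :=
      Metric.isOpen_ball.inter (isOpen_lt (continuous_coord _ _)
        (hf.continuous.comp (continuous_coord _ _)))
    obtain ⟨q, hq, hqA⟩ := mem_closure_iff.1 hx₀.1 _ ho ⟨Metric.mem_ball_self hr, h⟩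
    exact lt_asymm hq.2 ((hball hq.1).1 hqA)
  have hL : (0 : ℝ) < 1 + L := by positivity
  -- A point of the rectangle is at distance at most `(1 + L) * |x - a| + |s| < r / 4 + r / 4` from
  -- `x₀`, hence inside the ball where the graph description holds.
  refine ⟨⟨e, f, L, e x₀ 0, r / 4 / (1 + L), r / 4, by positivity, by positivity, hf, ?_⟩, ?_⟩
  · intro x s hx hs
    have hd : dist (pt e x (f x + s)) x₀ < r := by
      conv_lhs => rw [← pt_apply e x₀]
      refine (dist_pt_le _ _ _ _ _).trans_lt ?_
      rw [hgraph]
      have h1 := hf.dist_le_mul x (e x₀ 0)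
      rw [Real.dist_eq, Real.dist_eq] at h1
      have h2 : |f x + s - f (e x₀ 0)| ≤ |f x - f (e x₀ 0)| + |s| := by
        rw [show f x + s - f (e x₀ 0) = (f x - f (e x₀ 0)) + s by ring]; exact abs_add_le _ _
      rw [lt_div_iff₀ hL] at hx
      linarith
    rw [hball hd]; simp
  · simp only [GraphChart.nbhd, hgraph, Set.mem_ofPred_eq, sub_self, abs_zero, and_true]
    constructor <;> positivity

/-! ### Hausdorff measure on the boundary against Lebesgue measure on the base of a chart. -/

namespace GraphChart

variable {A : Set Plane} (c : GraphChart A)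

/-- The base interval of a chart. -/
def base : Set ℝ := {x | |x - c.a| < c.ρ}

lemma base_eq : c.base = Set.Ioo (c.a - c.ρ) (c.a + c.ρ) := by
  ext x; simp [base, abs_lt]; constructor <;> rintro ⟨h1, h2⟩ <;> constructor <;> linarith

lemma measurableSet_base : MeasurableSet c.base := by
  rw [base_eq]; exact measurableSet_Ioo

lemma measurableSet_nbhd : MeasurableSet c.nbhd := c.isOpen_nbhd.measurableSet

lemma measurable_graphPt : Measurable c.graphPt := c.continuous_graphPt.measurable

/-- The graph parametrization is `(1 + L)`-Lipschitz, and a Lipschitz map enlarges one-dimensional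
Hausdorff measure by at most its constant. -/
lemma bdryMeasure_restrict_le (hA : IsOpen A) :
    (bdryMeasure A).restrict c.nbhd ≤
      ((1 + c.L : ℝ≥0) : ℝ≥0∞) • Measure.map c.graphPt (volume.restrict c.base) := by
  rw [Measure.le_iff]
  intro s hs
  rw [bdryMeasure, Measure.restrict_restrict c.measurableSet_nbhd, c.nbhd_inter_frontier hA,
    Measure.restrict_apply hs, Measure.smul_apply, Measure.map_apply c.measurable_graphPt hs,
    Measure.restrict_apply (c.measurable_graphPt hs)]
  have : s ∩ c.graphPt '' {x | |x - c.a| < c.ρ} = c.graphPt '' (c.graphPt ⁻¹' s ∩ c.base) := by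
    ext p; constructor
    · rintro ⟨hp, x, hx, rfl⟩; exact ⟨x, ⟨hp, hx⟩, rfl⟩
    · rintro ⟨x, ⟨hx1, hx2⟩, rfl⟩; exact ⟨hx1, x, hx2, rfl⟩
  rw [this]
  have h := c.lipschitzWith_graphPt.hausdorffMeasure_image_le zero_le_one
    (c.graphPt ⁻¹' s ∩ c.base)
  rwa [ENNReal.rpow_one, hausdorffMeasure_real] at h

/-- The inverse of the parametrization is the projection to the first coordinate, which is
1-Lipschitz. -/
lemma map_graphPt_le (hA : IsOpen A) :
    Measure.map c.graphPt (volume.restrict c.base) ≤ (bdryMeasure A).restrict c.nbhd := by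
  rw [Measure.le_iff]
  intro s hs
  rw [bdryMeasure, Measure.restrict_restrict c.measurableSet_nbhd, Measure.restrict_apply hs,
    Measure.map_apply c.measurable_graphPt hs, Measure.restrict_apply (c.measurable_graphPt hs)]
  have hproj : LipschitzWith 1 fun p : Plane => c.e p 0 :=
    LipschitzWith.of_dist_le_mul fun p q => by
      simpa [Real.dist_eq] using abs_sub_le_dist c.e 0 p q
  have h := hproj.hausdorffMeasure_image_le zero_le_one (s ∩ (c.nbhd ∩ frontier A))
  rw [hausdorffMeasure_real] at h
  simp only [ENNReal.coe_one, ENNReal.rpow_one, one_mul] at h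
  refine (measure_mono ?_).trans h
  rintro x ⟨hx1, hx2⟩
  exact ⟨c.graphPt x, ⟨hx1, c.graphPt_mem_nbhd hx2, c.graphPt_mem_frontier hA hx2⟩,
    by simp [graphPt]⟩

end GraphChart

lemma isFiniteMeasure_bdryMeasure {A : Set Plane} (hA : IsOpen A)
    (hb : Bornology.IsBounded A) (hlip : HasLipschitzBoundary A) :
    IsFiniteMeasure (bdryMeasure A) := by
  have hc : IsCompact (frontier A) :=
    hb.isCompact_closure.of_isClosed_subset isClosed_frontier frontier_subset_closure
  have h : bdryMeasure A (frontier A) < ⊤ := by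
    refine hc.measure_lt_top_of_nhdsWithin fun x hx => ?_
    obtain ⟨c, hxc, -⟩ := exists_graphChart hA hlip hx
    refine ⟨c.nbhd, mem_nhdsWithin_of_mem_nhds (c.isOpen_nbhd.mem_nhds hxc), ?_⟩
    have h1 := c.bdryMeasure_restrict_le hA Set.univ
    rw [Measure.restrict_apply_univ, Measure.smul_apply,
      Measure.map_apply c.measurable_graphPt MeasurableSet.univ, Set.preimage_univ,
      Measure.restrict_apply_univ, c.base_eq, Real.volume_Ioo] at h1
    exact h1.trans_lt (ENNReal.mul_lt_top ENNReal.coe_lt_top ENNReal.ofReal_lt_top)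
  refine ⟨?_⟩
  rw [bdryMeasure, Measure.restrict_apply_self] at h
  rwa [bdryMeasure, Measure.restrict_apply_univ]

lemma bdryMeasure_pos {A : Set Plane} (hA : IsOpen A) (hlip : HasLipschitzBoundary A)
    {U : Set Plane} (hU : IsOpen U) (hne : (U ∩ frontier A).Nonempty) : 0 < bdryMeasure A U := by
  obtain ⟨x, hxU, hx⟩ := hne
  obtain ⟨c, hxc, -⟩ := exists_graphChart hA hlip hx
  have h1 := c.map_graphPt_le hA U
  rw [Measure.map_apply c.measurable_graphPt hU.measurableSet,
    Measure.restrict_apply (c.measurable_graphPt hU.measurableSet)] at h1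
  refine lt_of_lt_of_le ?_ (h1.trans (Measure.restrict_apply_le _ _))
  have ho : IsOpen (c.graphPt ⁻¹' U ∩ c.base) := by
    refine (hU.preimage c.continuous_graphPt).inter ?_
    rw [c.base_eq]; exact isOpen_Ioo
  refine ho.measure_pos _ ⟨c.e x 0, ?_, hxc.1⟩
  have : c.graphPt (c.e x 0) = x := by
    rw [GraphChart.graphPt, ← (c.mem_frontier_iff hA hxc).1 hx, pt_apply]
  simpa [this] using hxU

/-! ### Squared increments of a smooth function along segments. -/

lemma _root_.ENNReal.add_sq_le_two_mul (a b : ℝ≥0∞) : (a + b) ^ 2 ≤ 2 * (a ^ 2 + b ^ 2) := by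
  by_cases ha : a = ⊤
  · simp [ha]
  by_cases hb : b = ⊤
  · simp [hb]
  lift a to ℝ≥0 using ha
  lift b to ℝ≥0 using hb
  exact_mod_cast add_sq_le (a := a) (b := b)

lemma enorm_add_sq_le {E : Type*} [NormedAddCommGroup E] (a b : E) :
    ‖a + b‖ₑ ^ 2 ≤ 2 * (‖a‖ₑ ^ 2 + ‖b‖ₑ ^ 2) :=
  (pow_le_pow_left' (enorm_add_le a b) 2).trans (ENNReal.add_sq_le_two_mul _ _)

lemma sq_lintegral_le {α : Type*} [MeasurableSpace α] (μ : Measure α) {f : α → ℝ≥0∞}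
    (hf : AEMeasurable f μ) : (∫⁻ x, f x ∂μ) ^ 2 ≤ μ Set.univ * ∫⁻ x, f x ^ 2 ∂μ := by
  have h := ENNReal.lintegral_mul_le_Lp_mul_Lq μ Real.HolderConjugate.two_two
    (f := fun _ => 1) (g := f) aemeasurable_const hf
  simp only [Pi.mul_apply, one_mul, ENNReal.rpow_two] at h
  refine (pow_le_pow_left' h 2).trans_eq ?_
  have h2 (b : ℝ≥0∞) : (b ^ (1 / 2 : ℝ)) ^ 2 = b := by
    rw [← ENNReal.rpow_natCast, ← ENNReal.rpow_mul]; norm_num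
  rw [mul_pow, h2, h2]
  simp

lemma inner_gradient (φ : Plane → ℝ) (x v : Plane) :
    inner ℝ (gradient φ x) v = fderiv ℝ φ x v := by
  simp [gradient]

lemma continuous_gradient {φ : Plane → ℝ} (hφ : ContDiff ℝ ∞ φ) : Continuous (gradient φ) :=
  (InnerProductSpace.toDual ℝ Plane).symm.continuous.comp
    (hφ.continuous_fderiv (by simp))

/-- Fundamental theorem of calculus and Cauchy–Schwarz. The right side involves the whole interval
`[a, b]`, so the bound is uniform in `s` and `t` and can be integrated over either. -/
lemma enorm_sub_sq_le_segment {φ : Plane → ℝ} (hφ : ContDiff ℝ ∞ φ) (p v : Plane) {a b s t : ℝ}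
    (hs : s ∈ Set.Icc a b) (ht : t ∈ Set.Icc a b) :
    ‖φ (p + t • v) - φ (p + s • v)‖ₑ ^ 2 ≤
      ENNReal.ofReal (b - a) * (‖v‖ₑ ^ 2 * ∫⁻ τ in Set.Icc a b, ‖gradient φ (p + τ • v)‖ₑ ^ 2) := by
  wlog hst : s ≤ t generalizing s t
  · rw [← enorm_neg, neg_sub]
    exact this ht hs (le_of_not_ge hst)
  have hline : ∀ τ : ℝ, HasDerivAt (fun τ : ℝ => φ (p + τ • v)) (fderiv ℝ φ (p + τ • v) v) τ := by
    intro τ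
    have h1 : HasDerivAt (fun τ : ℝ => p + τ • v) v τ := by
      simpa using ((hasDerivAt_id τ).smul_const v).const_add p
    exact ((hφ.differentiable (by simp)) _).hasFDerivAt.comp_hasDerivAt τ h1
  have hcont : Continuous fun τ : ℝ => fderiv ℝ φ (p + τ • v) v :=
    ((hφ.continuous_fderiv (by simp)).comp (by fun_prop)).clm_apply continuous_const
  have hcg : Continuous fun τ : ℝ => gradient φ (p + τ • v) :=
    (continuous_gradient hφ).comp (by fun_prop)
  rw [← intervalIntegral.integral_eq_sub_of_hasDerivAt (fun τ _ => hline τ)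
    (hcont.intervalIntegrable _ _), intervalIntegral.integral_of_le hst]
  have h1 : ‖∫ τ in Set.Ioc s t, fderiv ℝ φ (p + τ • v) v‖ₑ ≤
      ∫⁻ τ in Set.Icc a b, ‖v‖ₑ * ‖gradient φ (p + τ • v)‖ₑ := by
    refine (enorm_integral_le_lintegral_enorm _).trans ?_
    have hss : Set.Ioc s t ⊆ Set.Icc a b := fun τ hτ => ⟨hs.1.trans hτ.1.le, hτ.2.trans ht.2⟩
    refine (lintegral_mono_set hss).trans ?_
    refine lintegral_mono fun τ => ?_
    rw [← inner_gradient, mul_comm, ← enorm_norm (gradient φ _), ← enorm_norm v, ← enorm_mul]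
    exact enorm_le_iff_norm_le.2 <| by
      simpa [abs_mul] using abs_real_inner_le_norm (gradient φ (p + τ • v)) v
  refine (pow_le_pow_left' h1 2).trans ?_
  refine (sq_lintegral_le _ (hcg.enorm.measurable.const_mul _).aemeasurable).trans ?_
  rw [Measure.restrict_apply_univ, Real.volume_Icc]
  simp_rw [mul_pow]
  rw [lintegral_const_mul _ (hcg.enorm.measurable.pow_const _)]

/-- The segment bound is integrated over `E`. After Fubini, each inner integral is moved into `A` by
translation invariance. -/
lemma lintegral_enorm_translate_sub_sq_le {φ : Plane → ℝ} (hφ : ContDiff ℝ ∞ φ) {A E : Set Plane}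
    (v : Plane) (hEA : ∀ x ∈ E, ∀ t ∈ Set.Icc (0 : ℝ) 1, x + t • v ∈ A) :
    ∫⁻ x in E, ‖φ (x + v) - φ x‖ₑ ^ 2 ≤ ‖v‖ₑ ^ 2 * ∫⁻ x in A, ‖gradient φ x‖ₑ ^ 2 := by
  have hg := (continuous_gradient hφ)
  have hm : Measurable fun q : Plane × ℝ => ‖gradient φ (q.1 + q.2 • v)‖ₑ ^ 2 :=
    ((hg.comp (by fun_prop : Continuous fun q : Plane × ℝ => q.1 + q.2 • v)).enorm.measurable.pow_const
      2)
  calc ∫⁻ x in E, ‖φ (x + v) - φ x‖ₑ ^ 2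
      ≤ ∫⁻ x in E, ‖v‖ₑ ^ 2 * ∫⁻ τ in Set.Icc (0 : ℝ) 1, ‖gradient φ (x + τ • v)‖ₑ ^ 2 := by
        refine lintegral_mono fun x => ?_
        simpa using enorm_sub_sq_le_segment hφ x v (a := 0) (b := 1) (s := 0) (t := 1)
          (by simp) (by simp)
    _ = ‖v‖ₑ ^ 2 * ∫⁻ τ in Set.Icc (0 : ℝ) 1, ∫⁻ x in E, ‖gradient φ (x + τ • v)‖ₑ ^ 2 := by
        rw [lintegral_const_mul _ (hm.lintegral_prod_right'), lintegral_lintegral_swap]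
        exact hm.aemeasurable
    _ ≤ ‖v‖ₑ ^ 2 * ∫⁻ τ in Set.Icc (0 : ℝ) 1, ∫⁻ x in A, ‖gradient φ x‖ₑ ^ 2 := by
        gcongr ‖v‖ₑ ^ 2 * ?_
        refine setLIntegral_mono' measurableSet_Icc fun τ hτ => ?_
        have hmp := (measurePreserving_add_right (volume : Measure Plane) (τ • v))
        have h1 := hmp.setLIntegral_comp_emb (measurableEmbedding_addRight (τ • v))
          (fun x => ‖gradient φ x‖ₑ ^ 2) E
        rw [h1]
        refine lintegral_mono_set ?_
        rintro _ ⟨x, hx, rfl⟩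
        exact hEA x hx τ hτ
    _ = ‖v‖ₑ ^ 2 * ∫⁻ x in A, ‖gradient φ x‖ₑ ^ 2 := by simp

/-! ### Friedrichs' inequality. -/

namespace GraphChart

variable {A : Set Plane} (c : GraphChart A)

/-- Flattening the boundary is a shear, so Fubini and translation of the inner variable by `c.f x`
suffice. No change of variables for a Lipschitz map is involved. -/
lemma lintegral_inter_nbhd (hA : IsOpen A) {F : Plane → ℝ≥0∞} (hF : Measurable F) :
    ∫⁻ p in A ∩ c.nbhd, F p =
      ∫⁻ x in c.base, ∫⁻ s in Set.Ioo 0 c.H, F (pt c.e x (c.f x + s)) := by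
  have hm : MeasurableSet (A ∩ c.nbhd) := hA.measurableSet.inter c.measurableSet_nbhd
  rw [← lintegral_indicator hm, lintegral_pt c.e _ (hF.indicator hm),
    ← lintegral_indicator c.measurableSet_base]
  congr 1 with x
  rw [← lintegral_add_left_eq_self _ (c.f x)]
  by_cases hx : x ∈ c.base
  · rw [Set.indicator_of_mem hx, ← lintegral_indicator measurableSet_Ioo]
    congr 1 with s
    by_cases hs : s ∈ Set.Ioo 0 c.H
    · have h1 : |s| < c.H := by rw [abs_of_pos hs.1]; exact hs.2
      rw [Set.indicator_of_mem hs, Set.indicator_of_mem]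
      exact ⟨(c.mem_iff x s hx h1).2 hs.1, by simpa [nbhd] using ⟨hx, h1⟩⟩
    · rw [Set.indicator_of_notMem hs, Set.indicator_of_notMem]
      rintro ⟨h1, h2⟩
      have h3 : |s| < c.H := by simpa using h2.2
      exact hs ⟨(c.mem_iff x s hx h3).1 h1, lt_of_abs_lt h3⟩
  · rw [Set.indicator_of_notMem hx]
    refine lintegral_eq_zero_of_ae_eq_zero (ae_of_all _ fun s => ?_)
    refine Set.indicator_of_notMem (fun h => hx ?_) _
    simpa [base] using h.2.1

lemma lintegral_base_graphPt_le (hA : IsOpen A) {F : Plane → ℝ≥0∞} (hF : Measurable F) :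
    ∫⁻ x in c.base, F (c.graphPt x) ≤ ∫⁻ p, F p ∂bdryMeasure A := by
  rw [← lintegral_map hF c.measurable_graphPt]
  exact lintegral_mono' ((c.map_graphPt_le hA).trans Measure.restrict_le_self) le_rfl

/-- On each vertical segment a value of `φ` is the boundary value below it plus an increment bounded
by the energy on that segment. -/
lemma friedrichs (hA : IsOpen A) {φ : Plane → ℝ} (hφ : ContDiff ℝ ∞ φ) :
    ∫⁻ p in A ∩ c.nbhd, ‖φ p‖ₑ ^ 2 ≤ ENNReal.ofReal c.H * (2 * ((∫⁻ p, ‖φ p‖ₑ ^ 2 ∂bdryMeasure A) +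
      ENNReal.ofReal c.H * ∫⁻ p in A, ‖gradient φ p‖ₑ ^ 2)) := by
  have hmφ : Measurable fun p => ‖φ p‖ₑ ^ 2 := hφ.continuous.enorm.measurable.pow_const 2
  have hmg : Measurable fun p => ‖gradient φ p‖ₑ ^ 2 :=
    (continuous_gradient hφ).enorm.measurable.pow_const 2
  have hmc : Measurable fun q : ℝ × ℝ => pt c.e q.1 (c.f q.1 + q.2) :=
    ((continuous_pt c.e).comp (continuous_fst.prodMk
      ((c.lip.continuous.comp continuous_fst).add continuous_snd))).measurable
  calc ∫⁻ p in A ∩ c.nbhd, ‖φ p‖ₑ ^ 2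
      = ∫⁻ x in c.base, ∫⁻ s in Set.Ioo 0 c.H, ‖φ (pt c.e x (c.f x + s))‖ₑ ^ 2 :=
        c.lintegral_inter_nbhd hA hmφ
    _ ≤ ∫⁻ x in c.base, ENNReal.ofReal c.H * (2 * (‖φ (c.graphPt x)‖ₑ ^ 2 + ENNReal.ofReal c.H *
          ∫⁻ s in Set.Ioo 0 c.H, ‖gradient φ (pt c.e x (c.f x + s))‖ₑ ^ 2)) := by
        refine lintegral_mono fun x => ?_
        have hpt : ∀ s, pt c.e x (c.f x + s) = c.graphPt x + s • axis c.e 1 := by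
          intro s; rw [graphPt, pt_eq, pt_eq]; module
        calc _ ≤ ∫⁻ s in Set.Ioo 0 c.H, 2 * (‖φ (c.graphPt x)‖ₑ ^ 2 + ENNReal.ofReal c.H *
              ∫⁻ s in Set.Ioo 0 c.H, ‖gradient φ (pt c.e x (c.f x + s))‖ₑ ^ 2) := by
              refine setLIntegral_mono' measurableSet_Ioo fun s hs => ?_
              have h1 := enorm_sub_sq_le_segment hφ (c.graphPt x) (axis c.e 1) (a := 0)
                (b := c.H) (s := 0) (t := s) ⟨le_rfl, c.H_pos.le⟩ ⟨hs.1.le, hs.2.le⟩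
              rw [zero_smul, add_zero, sub_zero, setLIntegral_congr Ioo_ae_eq_Icc.symm,
                ← enorm_norm (axis _ _), norm_axis, enorm_one, one_pow, one_mul] at h1
              simp only [hpt]
              have h2 := enorm_add_sq_le (φ (c.graphPt x))
                (φ (c.graphPt x + s • axis c.e 1) - φ (c.graphPt x))
              rw [add_sub_cancel] at h2
              refine h2.trans ?_
              gcongr
          _ = _ := by simp [mul_comm]
    _ = ENNReal.ofReal c.H * (2 * ((∫⁻ x in c.base, ‖φ (c.graphPt x)‖ₑ ^ 2) + ENNReal.ofReal c.H *
          ∫⁻ p in A ∩ c.nbhd, ‖gradient φ p‖ₑ ^ 2)) := by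
        have hm1 : Measurable fun x => ‖φ (c.graphPt x)‖ₑ ^ 2 := hmφ.comp c.measurable_graphPt
        have hm2 : Measurable fun x =>
            ∫⁻ s in Set.Ioo 0 c.H, ‖gradient φ (pt c.e x (c.f x + s))‖ₑ ^ 2 :=
          (hmg.comp hmc).lintegral_prod_right'
        rw [c.lintegral_inter_nbhd hA hmg, lintegral_const_mul' _ _
          ENNReal.ofReal_ne_top, lintegral_const_mul' _ _ ENNReal.ofNat_ne_top, lintegral_add_left hm1, lintegral_const_mul _ hm2]
    _ ≤ _ := by
        gcongr
        · exact c.lintegral_base_graphPt_le hA hmφ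
        · exact Set.inter_subset_left

end GraphChart

/-- The Dirichlet integral of `φ` over `A` plus the integral of `φ²` over the boundary. -/
def bdryEnergy (A : Set Plane) (φ : Plane → ℝ) : ℝ≥0∞ :=
  (∫⁻ p in A, ‖gradient φ p‖ₑ ^ 2) + ∫⁻ p, ‖φ p‖ₑ ^ 2 ∂bdryMeasure A

/-- The integral of `φ²` over `A ∩ s` is controlled by the energy and the boundary values. -/
def Controlled (A s : Set Plane) : Prop :=
  ∃ C : ℝ≥0, ∀ φ : Plane → ℝ, ContDiff ℝ ∞ φ →
    ∫⁻ p in A ∩ s, ‖φ p‖ₑ ^ 2 ≤ C * bdryEnergy A φ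

lemma Controlled.mono {A s t : Set Plane} (h : s ⊆ t) (ht : Controlled A t) : Controlled A s := by
  obtain ⟨C, hC⟩ := ht
  exact ⟨C, fun φ hφ =>
    (lintegral_mono_set (Set.inter_subset_inter_right _ h)).trans (hC φ hφ)⟩

lemma Controlled.union {A s t : Set Plane} (hs : Controlled A s) (ht : Controlled A t) :
    Controlled A (s ∪ t) := by
  obtain ⟨C, hC⟩ := hs
  obtain ⟨D, hD⟩ := ht
  refine ⟨C + D, fun φ hφ => ?_⟩
  rw [Set.inter_union_distrib_left, ENNReal.coe_add, add_mul]
  exact (lintegral_union_le _ _ _).trans (add_le_add (hC φ hφ) (hD φ hφ))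

lemma GraphChart.controlled {A : Set Plane} (hA : IsOpen A) (c : GraphChart A) :
    Controlled A c.nbhd := by
  refine ⟨2 * c.H.toNNReal * (1 + c.H.toNNReal), fun φ hφ => ?_⟩
  refine (c.friedrichs hA hφ).trans ?_
  rw [bdryEnergy, ENNReal.ofReal]
  push_cast
  generalize (c.H.toNNReal : ℝ≥0∞) = h
  generalize (∫⁻ p, ‖φ p‖ₑ ^ 2 ∂bdryMeasure A) = a
  generalize (∫⁻ p in A, ‖gradient φ p‖ₑ ^ 2) = b
  calc h * (2 * (a + h * b)) = 2 * h * (1 * a + h * b) := by ring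
    _ ≤ 2 * h * ((1 + h) * a + (1 + h) * b) := by
      gcongr
      · exact le_self_add
      · exact le_add_self
    _ = _ := by ring

/-- Translation by `y - x` carries one ball to the other along segments that stay in `A`, so the two
integrals differ by at most a multiple of the energy. -/
lemma controlled_ball_of_controlled_ball {A : Set Plane} {x y : Plane} {r ρ : ℝ}
    (hball : Metric.ball x (2 * r) ⊆ A) (hy : y ∈ Metric.ball x r) (hρ : ρ ≤ r)
    (h : Controlled A (Metric.ball y ρ)) : Controlled A (Metric.ball x ρ) := by
  obtain ⟨C, hC⟩ := h
  refine ⟨2 * (C + ‖y - x‖₊ ^ 2), fun φ hφ => ?_⟩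
  rw [Metric.mem_ball, dist_eq_norm] at hy
  have hsub : Metric.ball y ρ ⊆ A := fun z hz => hball <| by
    rw [Metric.mem_ball, dist_eq_norm] at hz ⊢
    have := norm_add_le (z - y) (y - x)
    rw [sub_add_sub_cancel] at this
    linarith
  have hseg : ∀ z ∈ Metric.ball x ρ, ∀ t ∈ Set.Icc (0 : ℝ) 1, z + t • (y - x) ∈ A := by
    intro z hz t ht
    apply hball
    rw [Metric.mem_ball, dist_eq_norm] at hz ⊢
    have h1 := norm_add_le (z - x) (t • (y - x))
    rw [norm_smul, Real.norm_of_nonneg ht.1] at h1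
    have h2 : t * ‖y - x‖ ≤ ‖y - x‖ := mul_le_of_le_one_left (norm_nonneg _) ht.2
    rw [add_sub_right_comm]
    linarith
  have h1 := lintegral_enorm_translate_sub_sq_le hφ (y - x) hseg
  have hmφ : Measurable fun p => ‖φ p‖ₑ ^ 2 := hφ.continuous.enorm.measurable.pow_const 2
  have h2 : ∫⁻ z in Metric.ball x ρ, ‖φ (z + (y - x))‖ₑ ^ 2 ≤ C * bdryEnergy A φ := by
    refine le_trans ?_ (hC φ hφ)
    have hmp := (measurePreserving_add_right (volume : Measure Plane) (y - x))
    rw [hmp.setLIntegral_comp_emb (measurableEmbedding_addRight (y - x))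
      (fun x => ‖φ x‖ₑ ^ 2) (Metric.ball x ρ)]
    refine lintegral_mono_set ?_
    rintro _ ⟨z, hz, rfl⟩
    have : z + (y - x) ∈ Metric.ball y ρ := by
      rw [Metric.mem_ball, dist_eq_norm] at hz ⊢
      rwa [show z + (y - x) - y = z - x by abel]
    exact ⟨hsub this, this⟩
  calc ∫⁻ z in A ∩ Metric.ball x ρ, ‖φ z‖ₑ ^ 2
      ≤ ∫⁻ z in Metric.ball x ρ, ‖φ z‖ₑ ^ 2 := lintegral_mono_set Set.inter_subset_right
    _ ≤ ∫⁻ z in Metric.ball x ρ, 2 * (‖φ (z + (y - x))‖ₑ ^ 2 + ‖φ (z + (y - x)) - φ z‖ₑ ^ 2) := by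
        refine lintegral_mono fun z => ?_
        have := enorm_add_sq_le (φ (z + (y - x))) (-(φ (z + (y - x)) - φ z))
        rwa [enorm_neg, ← sub_eq_add_neg, sub_sub_cancel] at this
    _ = 2 * ((∫⁻ z in Metric.ball x ρ, ‖φ (z + (y - x))‖ₑ ^ 2) +
          ∫⁻ z in Metric.ball x ρ, ‖φ (z + (y - x)) - φ z‖ₑ ^ 2) := by
        rw [lintegral_const_mul' _ _ ENNReal.ofNat_ne_top, lintegral_add_left]
        exact hmφ.comp (measurable_add_const _)
    _ ≤ 2 * (C * bdryEnergy A φ + ‖y - x‖ₑ ^ 2 * bdryEnergy A φ) := by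
        gcongr
        refine h1.trans ?_
        gcongr
        exact le_self_add
    _ = _ := by
        push_cast
        rw [enorm_eq_nnnorm]
        ring

/-- Friedrichs' inequality with boundary term. -/
lemma friedrichs {A : Set Plane} (hA : IsOpen A) (hb : Bornology.IsBounded A)
    (hlip : HasLipschitzBoundary A) :
    ∃ C : ℝ≥0, ∀ φ : Plane → ℝ, ContDiff ℝ ∞ φ → ∫⁻ p in A, ‖φ p‖ₑ ^ 2 ≤ C * bdryEnergy A φ := by
  -- Control is propagated from the boundary inwards by connectedness of the whole plane: `Sᶜ` will
  -- be clopen and contained in the bounded set `A`, hence empty. This makes connectedness of `A`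
  -- irrelevant.
  let S : Set Plane := {x | ∃ r > 0, Controlled A (Metric.ball x r)}
  have hSopen : IsOpen S := by
    rw [Metric.isOpen_iff]
    rintro x ⟨r, hr, hx⟩
    refine ⟨r, hr, fun y hy => ⟨r - dist y x, by simpa using hy, hx.mono ?_⟩⟩
    exact Metric.ball_subset_ball' (by linarith)
  have hSA : Sᶜ ⊆ A := by
    intro x hx
    by_contra hxA
    apply hx
    by_cases hxc : x ∈ closure A
    · have hxf : x ∈ frontier A := by rw [hA.frontier_eq]; exact ⟨hxc, hxA⟩
      obtain ⟨c, hc, -⟩ := exists_graphChart hA hlip hxf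
      obtain ⟨r, hr, hrc⟩ := Metric.isOpen_iff.1 c.isOpen_nbhd x hc
      exact ⟨r, hr, (c.controlled hA).mono hrc⟩
    · obtain ⟨r, hr, hrc⟩ := Metric.isOpen_iff.1 isClosed_closure.isOpen_compl x hxc
      refine ⟨r, hr, 0, fun φ _ => ?_⟩
      have : A ∩ Metric.ball x r = ∅ := by
        rw [← Set.disjoint_iff_inter_eq_empty]
        exact Set.disjoint_left.2 fun y hy hy' => hrc hy' (subset_closure hy)
      simp [this]
  -- Were a point `y` near `x` in `S`, a ball around `x` would inherit control from a ball around
  -- `y`.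
  have hSc_open : IsOpen Sᶜ := by
    rw [Metric.isOpen_iff]
    intro x hx
    obtain ⟨r, hr, hrA⟩ := Metric.isOpen_iff.1 hA x (hSA hx)
    refine ⟨r / 2, half_pos hr, fun y hy hyS => hx ?_⟩
    obtain ⟨ρ, hρ, hC⟩ := hyS
    refine ⟨min ρ (r / 2), lt_min hρ (half_pos hr), ?_⟩
    exact controlled_ball_of_controlled_ball (by rwa [mul_div_cancel₀ _ two_ne_zero]) hy
      (min_le_right _ _) (hC.mono (Metric.ball_subset_ball (min_le_left _ _)))
  have hclopen : IsClopen Sᶜ := ⟨hSopen.isClosed_compl, hSc_open⟩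
  have hS : Sᶜ = ∅ := by
    refine (isClopen_iff.1 hclopen).resolve_right fun hu => ?_
    have hbu : Bornology.IsBounded (Set.univ : Set Plane) := hu ▸ hb.subset hSA
    exact noncompact_univ Plane (Metric.isCompact_of_isClosed_isBounded isClosed_univ hbu)
  have hcl : Controlled A (closure A) := by
    refine hb.isCompact_closure.induction_on (p := Controlled A) ⟨0, by simp⟩
      (fun s t hst ht => ht.mono hst) (fun s t hs ht => hs.union ht) fun x _ => ?_
    have hx : x ∈ S := by
      by_contra h
      exact (Set.eq_empty_iff_forall_notMem.1 hS) x h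
    obtain ⟨r, hr, hC⟩ := hx
    exact ⟨_, mem_nhdsWithin_of_mem_nhds (Metric.ball_mem_nhds x hr), hC⟩
  obtain ⟨C, hC⟩ := hcl
  refine ⟨C, fun φ hφ => ?_⟩
  simpa [Set.inter_eq_left.2 (subset_closure (s := A))] using hC φ hφ

/-! ### Boundary values against means over small squares. -/

lemma enorm_sub_average_sq_le {α : Type*} [MeasurableSpace α] {μ : Measure α} [IsFiniteMeasure μ]
    (hμ : μ ≠ 0) {f : α → ℝ} (hf : Integrable f μ) (b : ℝ) :
    ‖b - ⨍ x, f x ∂μ‖ₑ ^ 2 ≤ (μ Set.univ)⁻¹ * ∫⁻ x, ‖b - f x‖ₑ ^ 2 ∂μ := by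
  have : NeZero μ := ⟨hμ⟩
  have hf' : Integrable f ((μ Set.univ)⁻¹ • μ) := hf.to_average
  have h1 : b - ⨍ x, f x ∂μ = ∫ x, (b - f x) ∂((μ Set.univ)⁻¹ • μ) := by
    rw [integral_sub (integrable_const _) hf', integral_const]
    simp [average]
  rw [h1]
  refine (pow_le_pow_left' (enorm_integral_le_lintegral_enorm _) 2).trans ?_
  refine (sq_lintegral_le _ (aestronglyMeasurable_const.sub hf'.aestronglyMeasurable).enorm).trans ?_
  rw [measure_univ, one_mul, lintegral_smul_measure, smul_eq_mul]
  exact le_rfl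

namespace GraphChart

variable {A : Set Plane} (c : GraphChart A)

/-- A square of side `h` over `[j, j + h)`, just above the graph. -/
def square (j h : ℝ) : Set Plane :=
  {p | c.e p 0 ∈ Set.Ico j (j + h) ∧ c.e p 1 ∈ Set.Ioo (c.f j + c.L * h) (c.f j + c.L * h + h)}

lemma measurableSet_square (j h : ℝ) : MeasurableSet (c.square j h) :=
  ((continuous_coord c.e 0).measurable measurableSet_Ico).inter
    ((continuous_coord c.e 1).measurable measurableSet_Ioo)

lemma lintegral_square (j h : ℝ) {F : Plane → ℝ≥0∞} (hF : Measurable F) :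
    ∫⁻ p in c.square j h, F p = ∫⁻ x in Set.Ico j (j + h),
      ∫⁻ y in Set.Ioo (c.f j + c.L * h) (c.f j + c.L * h + h), F (pt c.e x y) := by
  rw [← lintegral_indicator (c.measurableSet_square j h),
    lintegral_pt c.e _ (hF.indicator (c.measurableSet_square j h)),
    ← lintegral_indicator measurableSet_Ico]
  congr 1 with x
  by_cases hx : x ∈ Set.Ico j (j + h)
  · rw [Set.indicator_of_mem hx, ← lintegral_indicator measurableSet_Ioo]
    congr 1 with y
    simp only [Set.indicator, square, Set.mem_ofPred_eq, apply_pt_zero, apply_pt_one, hx, true_and]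
  · rw [Set.indicator_of_notMem hx]
    refine lintegral_eq_zero_of_ae_eq_zero (ae_of_all _ fun s => ?_)
    exact Set.indicator_of_notMem (fun h => hx (by simpa using h.1)) _

lemma volume_square (j : ℝ) (h : ℝ) :
    volume (c.square j h) = ENNReal.ofReal h ^ 2 := by
  have := c.lintegral_square j h (F := fun _ => 1) measurable_const
  simpa [sq] using this

variable {c} {j h : ℝ}

lemma abs_sub_height_le {x : ℝ} (hx : x ∈ Set.Ico j (j + h)) : |c.f x - c.f j| ≤ c.L * h := by
  have h1 := c.lip.dist_le_mul x j
  rw [Real.dist_eq, Real.dist_eq, abs_of_nonneg (sub_nonneg.2 hx.1)] at h1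
  have h2 : x - j ≤ h := by linarith [hx.2]
  exact h1.trans (mul_le_mul_of_nonneg_left h2 c.L.coe_nonneg)

/-- Over an interval of length `h` the graph moves by at most `L * h`. The offset `L * h` of the
square thus clears the graph, and its top is at most `(2 * L + 1) * h` above it. -/
lemma height_mem_Ioo {x y : ℝ} (hx : x ∈ Set.Ico j (j + h))
    (hy : y ∈ Set.Ioo (c.f j + c.L * h) (c.f j + c.L * h + h)) :
    y - c.f x ∈ Set.Ioo 0 ((2 * c.L + 1) * h) := by
  obtain ⟨h1, h2⟩ := abs_le.1 (abs_sub_height_le hx)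
  exact ⟨by linarith [hy.1], by linarith [hy.2]⟩

lemma square_subset (hbase : Set.Ico j (j + h) ⊆ c.base) (hH : (2 * c.L + 1) * h ≤ c.H) :
    c.square j h ⊆ A := by
  intro p hp
  have h1 := height_mem_Ioo hp.1 hp.2
  rw [c.mem_A_iff ⟨hbase hp.1, ?_⟩]
  · linarith [h1.1]
  · rw [abs_of_pos h1.1]; exact h1.2.trans_le hH

lemma isBounded_square : Bornology.IsBounded (c.square j h) := by
  refine (Metric.isBounded_ball (x := pt c.e j (c.f j + c.L * h)) (r := h + h)).subset ?_
  intro p hp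
  rw [Metric.mem_ball, ← pt_apply c.e p]
  refine (dist_pt_le _ _ _ _ _).trans_lt (add_lt_add ?_ ?_)
  · rw [abs_of_nonneg (by linarith [hp.1.1])]; linarith [hp.1.2]
  · rw [abs_of_nonneg (by linarith [hp.2.1])]; linarith [hp.2.2]

lemma integrableOn_square {φ : Plane → ℝ} (hφ : Continuous φ) :
    IntegrableOn φ (c.square j h) :=
  (hφ.continuousOn.integrableOn_compact
    (isBounded_square (c := c) (j := j) (h := h)).isCompact_closure).mono_set subset_closure

/-- The Dirichlet integral of `φ` along the vertical segment of a chart over `x`. -/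
def fiberEnergy (c : GraphChart A) (φ : Plane → ℝ) (x : ℝ) : ℝ≥0∞ :=
  ∫⁻ s in Set.Ioo 0 c.H, ‖gradient φ (pt c.e x (c.f x + s))‖ₑ ^ 2

lemma measurable_fiberEnergy {φ : Plane → ℝ} (hφ : ContDiff ℝ ∞ φ) :
    Measurable (c.fiberEnergy φ) := by
  have hmg : Measurable fun p => ‖gradient φ p‖ₑ ^ 2 :=
    (continuous_gradient hφ).enorm.measurable.pow_const 2
  have hmc : Measurable fun q : ℝ × ℝ => pt c.e q.1 (c.f q.1 + q.2) :=
    ((continuous_pt c.e).comp (continuous_fst.prodMk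
      ((c.lip.continuous.comp continuous_fst).add continuous_snd))).measurable
  exact (hmg.comp hmc).lintegral_prod_right'

lemma lintegral_square_gradient_le (hH : (2 * c.L + 1) * h ≤ c.H) {φ : Plane → ℝ}
    (hφ : ContDiff ℝ ∞ φ) :
    ∫⁻ p in c.square j h, ‖gradient φ p‖ₑ ^ 2 ≤ ∫⁻ x in Set.Ico j (j + h), c.fiberEnergy φ x := by
  have hmg : Measurable fun p => ‖gradient φ p‖ₑ ^ 2 :=
    (continuous_gradient hφ).enorm.measurable.pow_const 2
  rw [c.lintegral_square j h hmg]
  refine setLIntegral_mono' measurableSet_Ico fun x hx => ?_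
  rw [fiberEnergy, ← lintegral_indicator measurableSet_Ioo, ← lintegral_indicator measurableSet_Ioo,
    ← lintegral_add_left_eq_self _ (c.f x)]
  refine lintegral_mono fun s => ?_
  by_cases hs : c.f x + s ∈ Set.Ioo (c.f j + c.L * h) (c.f j + c.L * h + h)
  · have h1 := height_mem_Ioo hx hs
    rw [add_sub_cancel_left] at h1
    have h2 : s ∈ Set.Ioo 0 c.H := ⟨h1.1, h1.2.trans_le hH⟩
    rw [Set.indicator_of_mem hs, Set.indicator_of_mem h2]
  · rw [Set.indicator_of_notMem hs]
    exact zero_le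

/-- The boundary point is joined to a point of the square by an L-shaped path. The vertical leg
costs the energy of the fiber over `x`, and the horizontal legs, integrated over the heights, cost
the energy of the square. -/
lemma lintegral_square_sub_le (hh : 0 < h) (hH : (2 * c.L + 1) * h ≤ c.H) {φ : Plane → ℝ}
    (hφ : ContDiff ℝ ∞ φ) {x : ℝ} (hx : x ∈ Set.Ico j (j + h)) :
    ∫⁻ p in c.square j h, ‖φ (c.graphPt x) - φ p‖ₑ ^ 2 ≤
      ENNReal.ofReal h ^ 2 * (2 * (ENNReal.ofReal ((2 * c.L + 1) * h) * c.fiberEnergy φ x +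
        ∫⁻ x in Set.Ico j (j + h), c.fiberEnergy φ x)) := by
  have hmg : Measurable fun p => ‖gradient φ p‖ₑ ^ 2 :=
    (continuous_gradient hφ).enorm.measurable.pow_const 2
  have hK : 0 ≤ (2 * c.L + 1) * h := by positivity
  set Y := Set.Ioo (c.f j + c.L * h) (c.f j + c.L * h + h) with hY
  have hvolY : volume Y = ENNReal.ofReal h := by simp [hY]
  have hvolJ : volume (Set.Ico j (j + h)) = ENNReal.ofReal h := by simp
  let W : ℝ → ℝ≥0∞ := fun y => ∫⁻ ξ in Set.Ico j (j + h), ‖gradient φ (pt c.e ξ y)‖ₑ ^ 2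
  have hmW2 : Measurable fun q : ℝ × ℝ => ‖gradient φ (pt c.e q.1 q.2)‖ₑ ^ 2 :=
    hmg.comp (continuous_pt c.e).measurable
  have hmW : Measurable W := hmW2.lintegral_prod_left'
  have hvert : ∀ y ∈ Y, ‖φ (c.graphPt x) - φ (pt c.e x y)‖ₑ ^ 2 ≤
      ENNReal.ofReal ((2 * c.L + 1) * h) * c.fiberEnergy φ x := by
    intro y hy
    have h0 := height_mem_Ioo hx hy
    have h1 := enorm_sub_sq_le_segment hφ (c.graphPt x) (axis c.e 1) (a := 0)
      (b := (2 * c.L + 1) * h) (s := y - c.f x) (t := 0) ⟨h0.1.le, h0.2.le⟩ ⟨le_rfl, hK⟩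
    have hpt : ∀ s, c.graphPt x + s • axis c.e 1 = pt c.e x (c.f x + s) := by
      intro s; rw [graphPt, pt_eq, pt_eq]; module
    simp only [hpt] at h1
    rw [add_zero, sub_zero, setLIntegral_congr Ioo_ae_eq_Icc.symm, add_sub_cancel,
      ← enorm_norm (axis _ _), norm_axis, enorm_one, one_pow, one_mul] at h1
    refine h1.trans ?_
    gcongr
    exact lintegral_mono_set (Set.Ioo_subset_Ioo_right hH)
  have hhor : ∀ x' ∈ Set.Ico j (j + h), ∀ y, ‖φ (pt c.e x y) - φ (pt c.e x' y)‖ₑ ^ 2 ≤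
      ENNReal.ofReal h * W y := by
    intro x' hx' y
    have h1 := enorm_sub_sq_le_segment hφ (pt c.e 0 y) (axis c.e 0) (a := j)
      (b := j + h) (s := x') (t := x) ⟨hx'.1, hx'.2.le⟩ ⟨hx.1, hx.2.le⟩
    have hpt : ∀ s, pt c.e 0 y + s • axis c.e 0 = pt c.e s y := by
      intro s; rw [pt_eq, pt_eq]; module
    simp only [hpt] at h1
    rwa [add_sub_cancel_left, setLIntegral_congr Ico_ae_eq_Icc.symm,
      ← enorm_norm (axis _ _), norm_axis, enorm_one, one_pow, one_mul] at h1
  have hWint : ∫⁻ y in Y, W y ≤ ∫⁻ x in Set.Ico j (j + h), c.fiberEnergy φ x := by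
    refine le_trans (le_of_eq ?_) (lintegral_square_gradient_le hH hφ)
    rw [c.lintegral_square j h hmg, lintegral_lintegral_swap]
    exact (hmg.comp ((continuous_pt c.e).comp continuous_swap).measurable).aemeasurable
  have hmsub : Measurable fun p => ‖φ (c.graphPt x) - φ p‖ₑ ^ 2 :=
    (continuous_const.sub hφ.continuous).enorm.measurable.pow_const 2
  rw [c.lintegral_square j h hmsub]
  calc _ ≤ ∫⁻ x' in Set.Ico j (j + h), ∫⁻ y in Y,
          2 * (ENNReal.ofReal ((2 * c.L + 1) * h) * c.fiberEnergy φ x + ENNReal.ofReal h * W y) := by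
        refine setLIntegral_mono' measurableSet_Ico fun x' hx' =>
          setLIntegral_mono' measurableSet_Ioo fun y hy => ?_
        have h2 := enorm_add_sq_le (φ (c.graphPt x) - φ (pt c.e x y))
          (φ (pt c.e x y) - φ (pt c.e x' y))
        rw [sub_add_sub_cancel] at h2
        refine h2.trans ?_
        gcongr
        · exact hvert y hy
        · exact hhor x' hx' y
    _ = ENNReal.ofReal h * (2 * ((ENNReal.ofReal ((2 * c.L + 1) * h) * c.fiberEnergy φ x) *
          ENNReal.ofReal h + ENNReal.ofReal h * ∫⁻ y in Y, W y)) := by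
        rw [lintegral_const, Measure.restrict_apply_univ, hvolJ,
          lintegral_const_mul' _ _ ENNReal.ofNat_ne_top, lintegral_add_left measurable_const,
          lintegral_const, Measure.restrict_apply_univ, hvolY, lintegral_const_mul _ hmW, mul_comm]
    _ ≤ ENNReal.ofReal h * (2 * ((ENNReal.ofReal ((2 * c.L + 1) * h) * c.fiberEnergy φ x) *
          ENNReal.ofReal h + ENNReal.ofReal h * ∫⁻ x in Set.Ico j (j + h), c.fiberEnergy φ x)) := by
        gcongr
    _ = _ := by ring

/-- The factor `h` on the right is the gain behind compactness of the trace. Its coefficient is `2 *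
((2 * L + 1) + 1)`. -/
lemma lintegral_graph_sub_average_le (hh : 0 < h) (hH : (2 * c.L + 1) * h ≤ c.H) {φ : Plane → ℝ}
    (hφ : ContDiff ℝ ∞ φ) :
    ∫⁻ x in Set.Ico j (j + h), ‖φ (c.graphPt x) - ⨍ p in c.square j h, φ p‖ₑ ^ 2 ≤
      ENNReal.ofReal (4 * (c.L + 1) * h) * ∫⁻ x in Set.Ico j (j + h), c.fiberEnergy φ x := by
  have hv0 : ENNReal.ofReal h ^ 2 ≠ 0 := pow_ne_zero _ (by simpa using hh)
  have hvt : ENNReal.ofReal h ^ 2 ≠ ⊤ := ENNReal.pow_ne_top ENNReal.ofReal_ne_top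
  have hfin : IsFiniteMeasure (volume.restrict (c.square j h)) :=
    ⟨by rw [Measure.restrict_apply_univ, volume_square]; exact hvt.lt_top⟩
  have hne : volume.restrict (c.square j h) ≠ 0 := by
    intro h0
    have := congrArg (fun m => m Set.univ) h0
    simp only [Measure.restrict_apply_univ, volume_square] at this
    exact hv0 (by simpa using this)
  have hmV := measurable_fiberEnergy (c := c) hφ
  calc _ ≤ ∫⁻ x in Set.Ico j (j + h), 2 * (ENNReal.ofReal ((2 * c.L + 1) * h) * c.fiberEnergy φ x +
        ∫⁻ x in Set.Ico j (j + h), c.fiberEnergy φ x) := by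
        refine setLIntegral_mono' measurableSet_Ico fun x hx => ?_
        refine (enorm_sub_average_sq_le hne (integrableOn_square hφ.continuous) _).trans ?_
        rw [Measure.restrict_apply_univ, volume_square]
        refine (mul_le_mul_right (lintegral_square_sub_le hh hH hφ hx) _).trans ?_
        rw [← mul_assoc, ENNReal.inv_mul_cancel hv0 hvt, one_mul]
    _ = 2 * (ENNReal.ofReal ((2 * c.L + 1) * h) + ENNReal.ofReal h) *
          ∫⁻ x in Set.Ico j (j + h), c.fiberEnergy φ x := by
        rw [lintegral_const_mul' _ _ ENNReal.ofNat_ne_top, lintegral_add_right _ measurable_const,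
          lintegral_const_mul _ hmV, lintegral_const, Measure.restrict_apply_univ, Real.volume_Ico,
          add_sub_cancel_left]
        ring
    _ = _ := by
        congr 1
        rw [← ENNReal.ofReal_add (by positivity) hh.le, ← ENNReal.ofReal_ofNat,
          ← ENNReal.ofReal_mul (by norm_num)]
        congr 1
        ring

end GraphChart

lemma pairwise_disjoint_Ico_add_mul (α : ℝ) {h : ℝ} (hh : 0 < h) :
    Pairwise fun k l : ℕ => Disjoint (Set.Ico (α + k * h) (α + k * h + h))
      (Set.Ico (α + l * h) (α + l * h + h)) := by
  have key : ∀ k l : ℕ, k < l → Disjoint (Set.Ico (α + k * h) (α + k * h + h))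
      (Set.Ico (α + l * h) (α + l * h + h)) := by
    intro k l hkl
    refine Set.disjoint_left.2 fun x hx hy => ?_
    have h1 : ((k : ℝ) + 1) * h ≤ l * h :=
      mul_le_mul_of_nonneg_right (by exact_mod_cast hkl) hh.le
    linarith [hx.2, hy.1]
  intro k l hkl
  rcases lt_or_gt_of_ne hkl with h1 | h1
  · exact key k l h1
  · exact (key l k h1).symm

lemma biUnion_Ico_add_mul (α : ℝ) {h : ℝ} (hh : 0 < h) (n : ℕ) :
    ⋃ k ∈ Finset.range n, Set.Ico (α + k * h) (α + k * h + h) = Set.Ico α (α + n * h) := by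
  induction n with
  | zero => simp
  | succ n ih =>
    rw [Finset.range_add_one, Finset.set_biUnion_insert, ih, Set.union_comm,
      Set.Ico_union_Ico_eq_Ico]
    · push_cast; congr 1; ring
    · have : 0 ≤ n * h := by positivity
      linarith
    · linarith

namespace GraphChart

variable {A : Set Plane} (c : GraphChart A)

/-- The part of the domain of a chart that lies over `J`. -/
def part (J : Set ℝ) : Set Plane := c.nbhd ∩ {p | c.e p 0 ∈ J}

lemma measurableSet_part {J : Set ℝ} (hJ : MeasurableSet J) : MeasurableSet (c.part J) :=
  c.measurableSet_nbhd.inter ((continuous_coord c.e 0).measurable hJ)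

lemma lintegral_part_le (hA : IsOpen A) {J : Set ℝ} (hJ : MeasurableSet J) (hJb : J ⊆ c.base)
    {G : Plane → ℝ≥0∞} (hG : Measurable G) :
    ∫⁻ p in c.part J, G p ∂bdryMeasure A ≤
      ((1 + c.L : ℝ≥0) : ℝ≥0∞) * ∫⁻ x in J, G (c.graphPt x) := by
  have hm : MeasurableSet {p | c.e p 0 ∈ J} := (continuous_coord c.e 0).measurable hJ
  rw [part, Set.inter_comm, ← Measure.restrict_restrict hm, ← lintegral_indicator hm]
  refine (lintegral_mono' (c.bdryMeasure_restrict_le hA) le_rfl).trans ?_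
  rw [lintegral_smul_measure, lintegral_map (hG.indicator hm) c.measurable_graphPt, smul_eq_mul]
  refine mul_le_mul_right ?_ _
  have : (fun x => Set.indicator {p | c.e p 0 ∈ J} G (c.graphPt x)) =
      J.indicator fun x => G (c.graphPt x) := by
    ext x
    by_cases hx : x ∈ J
    · rw [Set.indicator_of_mem hx, Set.indicator_of_mem (by simpa [graphPt] using hx)]
    · rw [Set.indicator_of_notMem hx, Set.indicator_of_notMem (by simpa [graphPt] using hx)]
  rw [this, lintegral_indicator hJ, Measure.restrict_restrict hJ, Set.inter_eq_left.2 hJb]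

/-- The part of the domain of a chart over the middle half of its base. -/
def core : Set Plane := c.part (Set.Ico (c.a - c.ρ / 2) (c.a - c.ρ / 2 + c.ρ))

lemma measurableSet_core : MeasurableSet c.core := c.measurableSet_part measurableSet_Ico

lemma core_mem_nhds {x : Plane} (hx : x ∈ c.nbhd) (hxa : c.e x 0 = c.a) : c.core ∈ 𝓝 x := by
  refine inter_mem (c.isOpen_nbhd.mem_nhds hx) ?_
  refine (continuous_coord c.e 0).continuousAt.preimage_mem_nhds ?_
  rw [hxa]
  have := c.ρ_pos
  exact Ico_mem_nhds (by linarith) (by linarith)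

/-- The trace on a piece of the boundary is approximated by a step function whose values are
means over squares. -/
lemma exists_step_approx (hA : IsOpen A) {ε : ℝ≥0} (hε : 0 < ε) :
    ∃ (n : ℕ) (P Q : ℕ → Set Plane), (∀ k, MeasurableSet (P k)) ∧
      (Pairwise fun k l => Disjoint (P k) (P l)) ∧ (⋃ k ∈ Finset.range n, P k = c.core) ∧
      (∀ k ∈ Finset.range n, MeasurableSet (Q k) ∧ Bornology.IsBounded (Q k) ∧ Q k ⊆ A) ∧
      ∀ φ : Plane → ℝ, ContDiff ℝ ∞ φ →
        ∑ k ∈ Finset.range n, ∫⁻ p in P k, ‖φ p - ⨍ q in Q k, φ q‖ₑ ^ 2 ∂bdryMeasure A ≤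
          ε * ∫⁻ p in A, ‖gradient φ p‖ₑ ^ 2 := by
  -- The first condition makes the squares fit into the chart. The second combines the constant of
  -- `lintegral_graph_sub_average_le` with the factor `1 + L` between boundary measure and base
  -- measure.
  obtain ⟨n, hn0, hnH, hnε⟩ : ∃ n : ℕ, 0 < n ∧ (2 * c.L + 1) * (c.ρ / n) ≤ c.H ∧
      (1 + c.L) * (4 * (c.L + 1) * (c.ρ / n)) ≤ ε := by
    have ht : Tendsto (fun n : ℕ => c.ρ / (n : ℝ)) atTop (𝓝 0) :=
      tendsto_const_div_atTop_nhds_zero_nat c.ρ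
    have h1 : ∀ᶠ n : ℕ in atTop, (2 * c.L + 1) * (c.ρ / n) ≤ c.H :=
      (ht.const_mul (2 * (c.L : ℝ) + 1)).eventually_le_const (by simpa using c.H_pos)
    have h2 : ∀ᶠ n : ℕ in atTop, (1 + c.L) * (4 * (c.L + 1) * (c.ρ / n)) ≤ (ε : ℝ) :=
      ((ht.const_mul (4 * ((c.L : ℝ) + 1))).const_mul (1 + (c.L : ℝ))).eventually_le_const
        (by simpa using hε)
    obtain ⟨n, hn⟩ := ((eventually_gt_atTop 0).and (h1.and h2)).exists
    exact ⟨n, hn.1, hn.2.1, hn.2.2⟩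
  set h := c.ρ / n with hh_def
  have hn' : (0 : ℝ) < n := by exact_mod_cast hn0
  have hh : 0 < h := div_pos c.ρ_pos hn'
  have hnh : n * h = c.ρ := mul_div_cancel₀ _ hn'.ne'
  set α := c.a - c.ρ / 2 with hα
  let j : ℕ → ℝ := fun k => α + k * h
  let J : ℕ → Set ℝ := fun k => Set.Ico (j k) (j k + h)
  have hJd : Pairwise fun k l => Disjoint (J k) (J l) := pairwise_disjoint_Ico_add_mul α hh
  have hJu : ⋃ k ∈ Finset.range n, J k = Set.Ico α (α + c.ρ) := by
    rw [← hnh]; exact biUnion_Ico_add_mul α hh n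
  have hcb : Set.Ico α (α + c.ρ) ⊆ c.base := by
    rw [c.base_eq]
    intro x hx
    have := c.ρ_pos
    exact ⟨by linarith [hx.1, hα], by linarith [hx.2, hα]⟩
  have hJb : ∀ k ∈ Finset.range n, J k ⊆ c.base := fun k hk =>
    (Set.subset_biUnion_of_mem (u := J) hk).trans (hJu.trans_subset hcb)
  refine ⟨n, fun k => c.part (J k), fun k => c.square (j k) h,
    fun k => c.measurableSet_part measurableSet_Ico, ?_, ?_, ?_, ?_⟩
  · intro k l hkl
    refine Set.disjoint_left.2 fun p hp hp' => ?_
    exact Set.disjoint_left.1 (hJd hkl) hp.2 hp'.2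
  · rw [core, ← hJu]
    ext p
    simp [part]
  · exact fun k hk => ⟨c.measurableSet_square _ _, isBounded_square, square_subset (hJb k hk) hnH⟩
  · intro φ hφ
    have hmg : Measurable fun p => ‖gradient φ p‖ₑ ^ 2 :=
      (continuous_gradient hφ).enorm.measurable.pow_const 2
    calc _ ≤ ∑ k ∈ Finset.range n, (ε : ℝ≥0∞) * ∫⁻ x in J k, c.fiberEnergy φ x := by
          refine Finset.sum_le_sum fun k hk => ?_
          have hm : Measurable fun p => ‖φ p - ⨍ q in c.square (j k) h, φ q‖ₑ ^ 2 :=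
            (hφ.continuous.sub continuous_const).enorm.measurable.pow_const 2
          refine (c.lintegral_part_le hA measurableSet_Ico (hJb k hk) hm).trans ?_
          refine (mul_le_mul_right (lintegral_graph_sub_average_le hh hnH hφ) _).trans ?_
          rw [← mul_assoc]
          refine mul_le_mul_left ?_ _
          rw [← ENNReal.ofReal_coe_nnreal, ← ENNReal.ofReal_mul (by positivity),
            ← ENNReal.ofReal_coe_nnreal]
          exact ENNReal.ofReal_le_ofReal (by push_cast; exact hnε)
      _ = ε * ∫⁻ x in Set.Ico α (α + c.ρ), c.fiberEnergy φ x := by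
          rw [← Finset.mul_sum, ← hJu, lintegral_biUnion_finset (fun k _ l _ hkl => hJd hkl)
            (fun k _ => measurableSet_Ico)]
      _ ≤ ε * ∫⁻ p in A, ‖gradient φ p‖ₑ ^ 2 := by
          gcongr
          refine (lintegral_mono_set hcb).trans ?_
          rw [show ∫⁻ x in c.base, c.fiberEnergy φ x = _ from (c.lintegral_inter_nbhd hA hmg).symm]
          exact lintegral_mono_set Set.inter_subset_left

end GraphChart

/-! ### The space of functions with gradient and trace. -/

/-- The ambient space of triples (function, gradient, boundary values). -/
abbrev Triple (A : Set Plane) : Type :=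
  Lp ℝ 2 (volume.restrict A) × Lp Plane 2 (volume.restrict A) × Lp ℝ 2 (bdryMeasure A)

lemma gradient_add {φ ψ : Plane → ℝ} (hφ : ContDiff ℝ ∞ φ) (hψ : ContDiff ℝ ∞ ψ) (x : Plane) :
    gradient (fun y => φ y + ψ y) x = gradient φ x + gradient ψ x := by
  have h1 : DifferentiableAt ℝ φ x := hφ.differentiable (by simp) x
  have h2 : DifferentiableAt ℝ ψ x := hψ.differentiable (by simp) x
  rw [gradient, fderiv_fun_add h1 h2, map_add]
  rfl

lemma gradient_const_mul {φ : Plane → ℝ} (hφ : ContDiff ℝ ∞ φ) (r : ℝ) (x : Plane) :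
    gradient (fun y => r * φ y) x = r • gradient φ x := by
  have h1 : DifferentiableAt ℝ φ x := hφ.differentiable (by simp) x
  rw [gradient, fderiv_const_mul h1]
  simp [gradient]

/-- The triples of functions that are smooth up to the boundary. -/
def smoothTriples (A : Set Plane) : Submodule ℝ (Triple A) where
  carrier := {w | ∃ φ : Plane → ℝ, ContDiff ℝ ∞ φ ∧ w.1 =ᵐ[volume.restrict A] φ ∧
    w.2.1 =ᵐ[volume.restrict A] gradient φ ∧ w.2.2 =ᵐ[bdryMeasure A] φ}
  add_mem' := by
    rintro w z ⟨φ, hφ, h1, h2, h3⟩ ⟨ψ, hψ, k1, k2, k3⟩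
    refine ⟨fun x => φ x + ψ x, hφ.add hψ, ?_, ?_, ?_⟩
    · filter_upwards [Lp.coeFn_add w.1 z.1, h1, k1] with x hx hx1 hx2
      rw [Prod.fst_add, hx, Pi.add_apply, hx1, hx2]
    · filter_upwards [Lp.coeFn_add w.2.1 z.2.1, h2, k2] with x hx hx1 hx2
      rw [gradient_add hφ hψ, Prod.snd_add, Prod.fst_add, hx, Pi.add_apply, hx1, hx2]
    · filter_upwards [Lp.coeFn_add w.2.2 z.2.2, h3, k3] with x hx hx1 hx2
      rw [Prod.snd_add, Prod.snd_add, hx, Pi.add_apply, hx1, hx2]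
  zero_mem' := by
    refine ⟨fun _ => 0, contDiff_const, ?_, ?_, ?_⟩
    · filter_upwards [Lp.coeFn_zero ℝ 2 (volume.restrict A)] with x hx
      rw [Prod.fst_zero, hx, Pi.zero_apply]
    · filter_upwards [Lp.coeFn_zero Plane 2 (volume.restrict A)] with x hx
      rw [gradient_fun_const, Prod.snd_zero, Prod.fst_zero, hx, Pi.zero_apply]
    · filter_upwards [Lp.coeFn_zero ℝ 2 (bdryMeasure A)] with x hx
      rw [Prod.snd_zero, Prod.snd_zero, hx, Pi.zero_apply]
  smul_mem' := by
    rintro r w ⟨φ, hφ, h1, h2, h3⟩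
    refine ⟨fun x => r * φ x, contDiff_const.mul hφ, ?_, ?_, ?_⟩
    · filter_upwards [Lp.coeFn_smul r w.1, h1] with x hx hx1
      rw [Prod.smul_fst, hx, Pi.smul_apply, hx1, smul_eq_mul]
    · filter_upwards [Lp.coeFn_smul r w.2.1, h2] with x hx hx1
      rw [gradient_const_mul hφ, Prod.smul_snd, Prod.smul_fst, hx, Pi.smul_apply, hx1]
    · filter_upwards [Lp.coeFn_smul r w.2.2, h3] with x hx hx1
      rw [Prod.smul_snd, Prod.smul_snd, hx, Pi.smul_apply, hx1, smul_eq_mul]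

/-- The space `H¹(A)`, each function coming with its gradient and its trace. -/
def H1 (A : Set Plane) : Submodule ℝ (Triple A) := (smoothTriples A).topologicalClosure

/-- Density: this carries the estimates for smooth functions over to `H1 A`. -/
lemma H1_induction {A : Set Plane} {p : Triple A → Prop} (hp : IsClosed {w | p w})
    (h : ∀ w ∈ smoothTriples A, p w) {w : Triple A} (hw : w ∈ H1 A) : p w :=
  closure_minimal (s := (smoothTriples A : Set (Triple A))) h hp hw

lemma enorm_sq_eq_lintegral {α E : Type*} [MeasurableSpace α] [NormedAddCommGroup E] {μ : Measure α}
    (f : Lp E 2 μ) : ‖f‖ₑ ^ 2 = ∫⁻ x, ‖f x‖ₑ ^ 2 ∂μ := by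
  have := eLpNorm_nnreal_pow_eq_lintegral (f := f) (μ := μ) (p := 2) (by norm_num)
  rw [Lp.enorm_def]
  simpa using this

lemma norm_sq_le_of_enorm_sq_le {E F : Type*} [NormedAddCommGroup E] [NormedAddCommGroup F]
    {x : E} {y : F} {C : ℝ≥0} (h : ‖x‖ₑ ^ 2 ≤ C * ‖y‖ₑ ^ 2) : ‖x‖ ^ 2 ≤ C * ‖y‖ ^ 2 := by
  simp only [enorm_eq_nnnorm] at h
  exact_mod_cast h

lemma exists_friedrichs_const {A : Set Plane} (hA : IsOpen A) (hb : Bornology.IsBounded A)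
    (hlip : HasLipschitzBoundary A) :
    ∃ C : ℝ≥0, ∀ w ∈ H1 A, ‖w.1‖ ^ 2 ≤ C * (‖w.2.1‖ ^ 2 + ‖w.2.2‖ ^ 2) := by
  obtain ⟨C, hC⟩ := friedrichs hA hb hlip
  refine ⟨C, fun w hw => ?_⟩
  refine H1_induction (p := fun w => ‖w.1‖ ^ 2 ≤ C * (‖w.2.1‖ ^ 2 + ‖w.2.2‖ ^ 2)) ?_ ?_ hw
  · exact isClosed_le (by fun_prop) (by fun_prop)
  · rintro w ⟨φ, hφ, h1, h2, h3⟩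
    have h := hC φ hφ
    have e1 : ‖w.1‖ₑ ^ 2 = ∫⁻ p in A, ‖φ p‖ₑ ^ 2 := by
      rw [enorm_sq_eq_lintegral]
      exact lintegral_congr_ae (h1.fun_comp fun y => ‖y‖ₑ ^ 2)
    have e2 : ‖w.2.1‖ₑ ^ 2 = ∫⁻ p in A, ‖gradient φ p‖ₑ ^ 2 := by
      rw [enorm_sq_eq_lintegral]
      exact lintegral_congr_ae (h2.fun_comp fun y => ‖y‖ₑ ^ 2)
    have e3 : ‖w.2.2‖ₑ ^ 2 = ∫⁻ p, ‖φ p‖ₑ ^ 2 ∂bdryMeasure A := by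
      rw [enorm_sq_eq_lintegral]
      exact lintegral_congr_ae (h3.fun_comp fun y => ‖y‖ₑ ^ 2)
    rw [bdryEnergy, ← e1, ← e2, ← e3] at h
    simp only [enorm_eq_nnnorm] at h
    exact_mod_cast h

/-! ### Compactness and uniqueness of the trace. -/

/-- Multiplication by the indicator function of a measurable set. -/
def indicatorL {α : Type*} [MeasurableSpace α] (μ : Measure α) {s : Set α} (hs : MeasurableSet s) :
    Lp ℝ 2 μ →L[ℝ] Lp ℝ 2 μ :=
  LinearMap.mkContinuous
    { toFun := fun f => ((Lp.memLp f).indicator hs).toLp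
      map_add' := fun f g => by
        rw [← MemLp.toLp_add, MemLp.toLp_eq_toLp_iff]
        filter_upwards [Lp.coeFn_add f g] with x hx
        by_cases h : x ∈ s
        · simp only [Pi.add_apply, Set.indicator_of_mem h]
          exact hx
        · simp only [Pi.add_apply, Set.indicator_of_notMem h, add_zero]
      map_smul' := fun r f => by
        rw [RingHom.id_apply, ← MemLp.toLp_const_smul, MemLp.toLp_eq_toLp_iff]
        filter_upwards [Lp.coeFn_smul r f] with x hx
        by_cases h : x ∈ s
        · simp only [Pi.smul_apply, Set.indicator_of_mem h]
          exact hx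
        · simp only [Pi.smul_apply, Set.indicator_of_notMem h, smul_zero] } 1 fun f => by
    rw [one_mul]
    refine Lp.norm_le_norm_of_ae_le ?_
    filter_upwards [((Lp.memLp f).indicator hs).coeFn_toLp] with x hx
    simp only [LinearMap.coe_mk, AddHom.coe_mk]
    rw [hx]
    exact norm_indicator_le_norm_self _ _

lemma coeFn_indicatorL {α : Type*} [MeasurableSpace α] (μ : Measure α) {s : Set α}
    (hs : MeasurableSet s) (f : Lp ℝ 2 μ) : indicatorL μ hs f =ᵐ[μ] s.indicator f :=
  ((Lp.memLp f).indicator hs).coeFn_toLp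

/-- In this form compactness passes from two pieces of the boundary to their union, since a compact
operator followed by a bounded one is compact. -/
lemma indicatorL_union {α : Type*} [MeasurableSpace α] (μ : Measure α) {s t : Set α}
    (hs : MeasurableSet s) (ht : MeasurableSet t) :
    indicatorL μ (hs.union ht) =
      indicatorL μ hs + (indicatorL μ hs.compl).comp (indicatorL μ ht) := by
  ext1 f
  rw [Lp.ext_iff]
  rw [add_apply, ContinuousLinearMap.comp_apply]
  filter_upwards [coeFn_indicatorL μ (hs.union ht) f, coeFn_indicatorL μ hs f,
    coeFn_indicatorL μ hs.compl (indicatorL μ ht f), coeFn_indicatorL μ ht f,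
    Lp.coeFn_add (indicatorL μ hs f) (indicatorL μ hs.compl (indicatorL μ ht f))]
    with x h1 h2 h3 h4 h5
  rw [h1, h5, Pi.add_apply, h2, h3]
  by_cases hxs : x ∈ s <;> by_cases hxt : x ∈ t <;> simp [hxs, hxt, h4]

/-- The mean over a subset of `A`, as a functional on `L²(A)`. -/
lemma exists_averageL {A Q : Set Plane} (hQ : MeasurableSet Q) (hQb : Bornology.IsBounded Q)
    (hQA : Q ⊆ A) : ∃ l : Lp ℝ 2 (volume.restrict A) →L[ℝ] ℝ, ∀ f, l f = ⨍ x in Q, f x := by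
  have hfin : volume.restrict A Q ≠ ⊤ :=
    ((Measure.restrict_apply_le A Q).trans_lt hQb.measure_lt_top).ne
  refine ⟨(volume.real Q)⁻¹ • innerSL ℝ (indicatorConstLp 2 hQ hfin (1 : ℝ)), fun f => ?_⟩
  rw [smul_apply, innerSL_apply_apply, L2.inner_indicatorConstLp_one,
    Measure.restrict_restrict hQ, Set.inter_eq_left.2 hQA, setAverage_eq]

/-- The trace on the core of a chart is approximated by finite-rank operators. -/
lemma GraphChart.exists_compact_approx {A : Set Plane} (hA : IsOpen A)
    [IsFiniteMeasure (bdryMeasure A)] (c : GraphChart A) {ε : ℝ≥0} (hε : 0 < ε) :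
    ∃ F : Lp ℝ 2 (volume.restrict A) →L[ℝ] Lp ℝ 2 (bdryMeasure A), IsCompactOperator F ∧
      ∀ w ∈ H1 A, ‖indicatorL _ c.measurableSet_core w.2.2 - F w.1‖ ≤ ε * ‖w.2.1‖ := by
  -- The tolerance is squared because the step approximation bounds squared norms.
  obtain ⟨n, P, Q, hP, hPd, hPu, hQ, hest⟩ := c.exists_step_approx hA (ε := ε ^ 2) (by positivity)
  -- The functional is only determined for indices below `n`; it is taken to be zero for the others,
  -- so that `choose` can apply to all `k`.
  have hl : ∀ k, ∃ l : Lp ℝ 2 (volume.restrict A) →L[ℝ] ℝ, k ∈ Finset.range n →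
      ∀ f, l f = ⨍ x in Q k, f x := by
    intro k
    by_cases hk : k ∈ Finset.range n
    · obtain ⟨l, hl⟩ := exists_averageL (hQ k hk).1 (hQ k hk).2.1 (hQ k hk).2.2
      exact ⟨l, fun _ => hl⟩
    · exact ⟨0, fun h => absurd h hk⟩
  choose l hl using hl
  let v : ℕ → Lp ℝ 2 (bdryMeasure A) := fun k =>
    indicatorConstLp 2 (hP k) (measure_ne_top _ _) (1 : ℝ)
  let F : Lp ℝ 2 (volume.restrict A) →L[ℝ] Lp ℝ 2 (bdryMeasure A) :=
    ∑ k ∈ Finset.range n, (ContinuousLinearMap.toSpanSingleton ℝ (v k)).comp (l k)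
  have hFapply : ∀ f, F f = ∑ k ∈ Finset.range n, l k f • v k := by
    intro f; simp [F]
  refine ⟨F, ?_, fun w hw => ?_⟩
  · have : ∀ s : Finset ℕ, IsCompactOperator
        (∑ k ∈ s, (ContinuousLinearMap.toSpanSingleton ℝ (v k)).comp (l k) :
          Lp ℝ 2 (volume.restrict A) →L[ℝ] Lp ℝ 2 (bdryMeasure A)) := by
      intro s
      induction s using Finset.induction_on with
      | empty => simpa using isCompactOperator_zero
      | insert a s ha ih =>
        rw [Finset.sum_insert ha]
        refine IsCompactOperator.add ?_ ih
        exact (isCompactOperator_of_locallyCompactSpace_rng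
          (ContinuousLinearMap.toSpanSingleton ℝ (v a))).comp_clm (l a)
    exact this _
  refine H1_induction
    (p := fun w => ‖indicatorL _ c.measurableSet_core w.2.2 - F w.1‖ ≤ ε * ‖w.2.1‖) ?_ ?_ hw
  · exact isClosed_le (by fun_prop) (by fun_prop)
  rintro w ⟨φ, hφ, h1, h2, h3⟩
  have hφe := hest φ hφ
  have hval : ∀ k ∈ Finset.range n, l k w.1 = ⨍ x in Q k, φ x := by
    intro k hk
    rw [hl k hk]
    exact average_congr (ae_mono (Measure.restrict_mono (hQ k hk).2.2 le_rfl) h1)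
  have e2 : ‖w.2.1‖ₑ ^ 2 = ∫⁻ p in A, ‖gradient φ p‖ₑ ^ 2 := by
    rw [enorm_sq_eq_lintegral]
    exact lintegral_congr_ae (h2.fun_comp fun y => ‖y‖ₑ ^ 2)
  have hF : F w.1 =ᵐ[bdryMeasure A] fun x => ∑ k ∈ Finset.range n, (P k).indicator
      (fun _ => ⨍ x in Q k, φ x) x := by
    rw [hFapply]
    have h4 : ∀ᵐ x ∂bdryMeasure A, ∀ k, (l k w.1 • v k : Lp ℝ 2 (bdryMeasure A)) x =
        (P k).indicator (fun _ => l k w.1) x := by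
      rw [ae_all_iff]
      intro k
      filter_upwards [Lp.coeFn_smul (l k w.1) (v k), indicatorConstLp_coeFn (p := 2) (hs := hP k)
        (hμs := measure_ne_top (bdryMeasure A) _) (c := (1 : ℝ))] with x hx hx2
      rw [hx, Pi.smul_apply, hx2]
      by_cases hxP : x ∈ P k <;> simp [hxP]
    filter_upwards [Lp.coeFn_finsetSum (Finset.range n) fun k => l k w.1 • v k, h4] with x hx hx4
    rw [hx, Finset.sum_apply]
    refine Finset.sum_congr rfl fun k hk => ?_
    rw [hx4, hval k hk]
  have e1 : ‖indicatorL _ c.measurableSet_core w.2.2 - F w.1‖ₑ ^ 2 ≤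
      ∑ k ∈ Finset.range n, ∫⁻ p in P k, ‖φ p - ⨍ q in Q k, φ q‖ₑ ^ 2 ∂bdryMeasure A := by
    rw [enorm_sq_eq_lintegral]
    have h5 : ∀ᵐ x ∂bdryMeasure A,
        ‖(indicatorL _ c.measurableSet_core w.2.2 - F w.1 : Lp ℝ 2 (bdryMeasure A)) x‖ₑ ^ 2 ≤
        ∑ k ∈ Finset.range n, (P k).indicator (fun p => ‖φ p - ⨍ q in Q k, φ q‖ₑ ^ 2) x := by
      filter_upwards [Lp.coeFn_sub (indicatorL _ c.measurableSet_core w.2.2) (F w.1), hF,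
        coeFn_indicatorL _ c.measurableSet_core w.2.2, h3] with x hx1 hx2 hx3 hx4
      rw [hx1, Pi.sub_apply, hx2, hx3]
      by_cases hx : x ∈ c.core
      · have hx' := hx
        rw [← hPu, Set.mem_iUnion₂] at hx'
        obtain ⟨k, hk, hxk⟩ := hx'
        have hother : ∀ b ∈ Finset.range n, b ≠ k → x ∉ P b := fun b _ hbk hxb =>
          Set.disjoint_left.1 (hPd hbk) hxb hxk
        rw [Set.indicator_of_mem hx, hx4, Finset.sum_eq_single_of_mem k hk
          (fun b hb hbk => Set.indicator_of_notMem (hother b hb hbk) _),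
          Finset.sum_eq_single_of_mem k hk
          (fun b hb hbk => Set.indicator_of_notMem (hother b hb hbk) _),
          Set.indicator_of_mem hxk, Set.indicator_of_mem hxk]
      · have hnot : ∀ k ∈ Finset.range n, x ∉ P k := fun k hk hxk =>
          hx (hPu ▸ Set.mem_iUnion₂.2 ⟨k, hk, hxk⟩)
        rw [Set.indicator_of_notMem hx, Finset.sum_eq_zero
          (fun k hk => Set.indicator_of_notMem (hnot k hk) _)]
        simp
    refine (lintegral_mono_ae h5).trans ?_
    rw [lintegral_finsetSum]
    · exact Finset.sum_le_sum fun k _ => lintegral_indicator_le _ _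
    · intro k _
      exact ((hφ.continuous.sub continuous_const).enorm.measurable.pow_const 2).indicator (hP k)
  have h6 : ‖indicatorL _ c.measurableSet_core w.2.2 - F w.1‖ ^ 2 ≤ (ε ^ 2 : ℝ≥0) * ‖w.2.1‖ ^ 2 :=
    norm_sq_le_of_enorm_sq_le (e1.trans (hφe.trans_eq (by rw [e2])))
  refine le_of_sq_le_sq ?_ (by positivity)
  rw [mul_pow]
  exact_mod_cast h6

/-- The trace operator. -/
def traceL (A : Set Plane) : H1 A →L[ℝ] Lp ℝ 2 (bdryMeasure A) :=
  (ContinuousLinearMap.snd ℝ _ _).comp ((ContinuousLinearMap.snd ℝ _ _).comp (H1 A).subtypeL)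

/-- On `s`, the trace operator is compact and only depends on the function and its gradient. -/
def TraceCompactOn (A s : Set Plane) : Prop :=
  ∃ (M : Set Plane) (hM : MeasurableSet M), s ⊆ M ∧
    IsCompactOperator ((indicatorL (bdryMeasure A) hM).comp (traceL A)) ∧
    ∀ w ∈ H1 A, w.1 = 0 → w.2.1 = 0 → indicatorL (bdryMeasure A) hM w.2.2 = 0

lemma TraceCompactOn.union {A s t : Set Plane} (hs : TraceCompactOn A s)
    (ht : TraceCompactOn A t) : TraceCompactOn A (s ∪ t) := by
  obtain ⟨M, hM, hsM, hMc, hM0⟩ := hs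
  obtain ⟨N, hN, htN, hNc, hN0⟩ := ht
  refine ⟨M ∪ N, hM.union hN, Set.union_subset_union hsM htN, ?_, fun w hw h1 h2 => ?_⟩
  · rw [indicatorL_union _ hM hN, ContinuousLinearMap.add_comp, ContinuousLinearMap.comp_assoc]
    exact hMc.add (hNc.clm_comp (indicatorL (bdryMeasure A) hM.compl))
  · rw [indicatorL_union _ hM hN, add_apply, ContinuousLinearMap.comp_apply,
      hM0 w hw h1 h2, hN0 w hw h1 h2, map_zero, add_zero]

/-- The finite-rank approximants with `ε = 1 / (n + 1)` converge in operator norm. A single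
approximant, with `ε = 1`, already shows that the trace vanishes when the function and the gradient
do. -/
lemma GraphChart.traceCompactOn {A : Set Plane} (hA : IsOpen A)
    [IsFiniteMeasure (bdryMeasure A)] (c : GraphChart A) : TraceCompactOn A c.core := by
  refine ⟨c.core, c.measurableSet_core, le_rfl, ?_, fun w hw h1 h2 => ?_⟩
  · have h : ∀ n : ℕ, ∃ F : Lp ℝ 2 (volume.restrict A) →L[ℝ] Lp ℝ 2 (bdryMeasure A),
        IsCompactOperator F ∧ ∀ w ∈ H1 A, ‖indicatorL _ c.measurableSet_core w.2.2 - F w.1‖ ≤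
          (1 / ((n : ℝ) + 1)) * ‖w.2.1‖ := by
      intro n
      obtain ⟨F, hF, hF'⟩ := c.exists_compact_approx hA (ε := 1 / ((n : ℝ≥0) + 1)) (by positivity)
      exact ⟨F, hF, fun w hw => by simpa using hF' w hw⟩
    choose F hF hFw using h
    let G : ℕ → H1 A →L[ℝ] Lp ℝ 2 (bdryMeasure A) := fun n =>
      (F n).comp ((ContinuousLinearMap.fst ℝ _ _).comp (H1 A).subtypeL)
    refine isCompactOperator_of_tendsto (l := atTop) (F := G) ?_ (Eventually.of_forall fun n => ?_)
    · rw [tendsto_iff_norm_sub_tendsto_zero]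
      refine squeeze_zero (fun _ => norm_nonneg _) (fun n => ?_)
        (tendsto_one_div_add_atTop_nhds_zero_nat (𝕜 := ℝ))
      refine ContinuousLinearMap.opNorm_le_bound _ (by positivity) fun w => ?_
      rw [sub_apply, norm_sub_rev]
      refine (hFw n w w.2).trans ?_
      gcongr
      exact (norm_fst_le _).trans (norm_snd_le (w : Triple A))
    · exact (hF n).comp_clm ((ContinuousLinearMap.fst ℝ _ _).comp (H1 A).subtypeL)
  · obtain ⟨F, -, hF⟩ := c.exists_compact_approx hA (ε := 1) one_pos
    have := hF w hw
    rw [h1, h2, map_zero, sub_zero, norm_zero, mul_zero] at this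
    exact norm_le_zero_iff.1 this

lemma traceCompactOn_frontier {A : Set Plane} (hA : IsOpen A) (hb : Bornology.IsBounded A)
    (hlip : HasLipschitzBoundary A) : TraceCompactOn A (frontier A) := by
  have := isFiniteMeasure_bdryMeasure hA hb hlip
  have hc : IsCompact (frontier A) :=
    hb.isCompact_closure.of_isClosed_subset isClosed_frontier frontier_subset_closure
  refine hc.induction_on (p := TraceCompactOn A) ?_ ?_ (fun s t hs ht => hs.union ht) ?_
  · have h0 : indicatorL (bdryMeasure A) MeasurableSet.empty = 0 := by
      ext1 f
      rw [Lp.ext_iff]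
      filter_upwards [coeFn_indicatorL (bdryMeasure A) MeasurableSet.empty f,
        Lp.coeFn_zero ℝ 2 (bdryMeasure A)] with x h1 h2
      rw [h1, zero_apply, h2]
      simp
    refine ⟨∅, MeasurableSet.empty, le_rfl, ?_, ?_⟩
    · rw [h0, ContinuousLinearMap.zero_comp]
      exact isCompactOperator_zero
    · intro w _ _ _
      rw [h0, zero_apply]
  · rintro s t hst ⟨M, hM, htM, h⟩
    exact ⟨M, hM, hst.trans htM, h⟩
  · intro x hx
    obtain ⟨c, hc, hca⟩ := exists_graphChart hA hlip hx
    exact ⟨c.core, mem_nhdsWithin_of_mem_nhds (c.core_mem_nhds hc hca), c.traceCompactOn hA⟩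

lemma indicatorL_eq_self {A M : Set Plane} (hM : MeasurableSet M) (hAM : frontier A ⊆ M)
    (f : Lp ℝ 2 (bdryMeasure A)) : indicatorL (bdryMeasure A) hM f = f := by
  rw [Lp.ext_iff]
  have h : ∀ᵐ x ∂bdryMeasure A, x ∈ frontier A :=
    ae_restrict_mem isClosed_frontier.measurableSet
  filter_upwards [coeFn_indicatorL (bdryMeasure A) hM f, h] with x h1 h2
  rw [h1, Set.indicator_of_mem (hAM h2)]

lemma isCompactOperator_traceL {A : Set Plane} (hA : IsOpen A) (hb : Bornology.IsBounded A)
    (hlip : HasLipschitzBoundary A) : IsCompactOperator (traceL A) := by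
  obtain ⟨M, hM, hAM, hc, -⟩ := traceCompactOn_frontier hA hb hlip
  convert hc using 2
  ext1 w
  exact (indicatorL_eq_self hM hAM _).symm

/-- Consequently the third entry of a triple in `H1 A` is no independent datum. -/
lemma trace_eq_zero {A : Set Plane} (hA : IsOpen A) (hb : Bornology.IsBounded A)
    (hlip : HasLipschitzBoundary A) {w : Triple A} (hw : w ∈ H1 A) (h1 : w.1 = 0)
    (h2 : w.2.1 = 0) : w.2.2 = 0 := by
  obtain ⟨M, hM, hAM, -, h⟩ := traceCompactOn_frontier hA hb hlip
  rw [← indicatorL_eq_self hM hAM w.2.2]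
  exact h w hw h1 h2

/-! ### The variational problem. -/

/-- The elements of `H¹(A)` whose trace vanishes off `Γ`. -/
def V (A Γ : Set Plane) : Submodule ℝ (Triple A) where
  carrier := {w | w ∈ H1 A ∧ ∀ᵐ x ∂bdryMeasure A, x ∉ Γ → w.2.2 x = 0}
  add_mem' := by
    rintro w z ⟨hw, hw'⟩ ⟨hz, hz'⟩
    refine ⟨add_mem hw hz, ?_⟩
    filter_upwards [Lp.coeFn_add w.2.2 z.2.2, hw', hz'] with x hx h1 h2 hxΓ
    rw [Prod.snd_add, Prod.snd_add, hx, Pi.add_apply, h1 hxΓ, h2 hxΓ, add_zero]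
  zero_mem' := by
    refine ⟨zero_mem _, ?_⟩
    filter_upwards [Lp.coeFn_zero ℝ 2 (bdryMeasure A)] with x hx _
    rw [Prod.snd_zero, Prod.snd_zero, hx, Pi.zero_apply]
  smul_mem' := by
    rintro r w ⟨hw, hw'⟩
    refine ⟨Submodule.smul_mem _ r hw, ?_⟩
    filter_upwards [Lp.coeFn_smul r w.2.2, hw'] with x hx h1 hxΓ
    rw [Prod.smul_snd, Prod.smul_snd, hx, Pi.smul_apply, h1 hxΓ, smul_zero]

lemma isClosed_H1 (A : Set Plane) : IsClosed (H1 A : Set (Triple A)) :=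
  Submodule.isClosed_topologicalClosure _

/-- An `L²`-convergent sequence of traces has an almost everywhere convergent subsequence, so
vanishing off `Γ` survives in the limit. -/
lemma isClosed_V (A Γ : Set Plane) : IsClosed (V A Γ : Set (Triple A)) := by
  refine IsSeqClosed.isClosed fun w z hw hz => ⟨?_, ?_⟩
  · exact (isClosed_H1 A).mem_of_tendsto hz (Eventually.of_forall fun n => (hw n).1)
  · have ht : Tendsto (fun n => (w n).2.2) atTop (𝓝 z.2.2) :=
      (continuous_snd.comp continuous_snd).continuousAt.tendsto.comp hz
    obtain ⟨ns, -, hns⟩ := (tendstoInMeasure_of_tendsto_Lp ht).exists_seq_tendsto_ae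
    have h0 : ∀ᵐ x ∂bdryMeasure A, ∀ n, x ∉ Γ → (w n).2.2 x = 0 := ae_all_iff.2 fun n => (hw n).2
    filter_upwards [hns, h0] with x hx hx0 hxΓ
    refine tendsto_nhds_unique hx ?_
    simp only [fun n => hx0 (ns n) hxΓ]
    exact tendsto_const_nhds

lemma tendsto_zero_of_sq_tendsto_zero {ι : Type*} {l : Filter ι} {u : ι → ℝ} (hu : ∀ i, 0 ≤ u i)
    (h : Tendsto (fun i => u i ^ 2) l (𝓝 0)) : Tendsto u l (𝓝 0) := by
  have := h.sqrt
  simpa [Real.sqrt_sq (hu _)] using this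

lemma rayleigh {A Γ : Set Plane} {k : ℝ}
    (hk : ∀ w ∈ V A Γ, ‖w.2.2‖ = 1 → k ≤ ‖w.2.1‖ ^ 2) {w : Triple A} (hw : w ∈ V A Γ) :
    k * ‖w.2.2‖ ^ 2 ≤ ‖w.2.1‖ ^ 2 := by
  by_cases h0 : ‖w.2.2‖ = 0
  · rw [h0]; simp
  have h1 := hk (‖w.2.2‖⁻¹ • w) (Submodule.smul_mem _ _ hw)
    (by rw [Prod.smul_snd, Prod.smul_snd, norm_smul, norm_inv, norm_norm, inv_mul_cancel₀ h0])
  rw [Prod.smul_snd, Prod.smul_fst, norm_smul, norm_inv, norm_norm, mul_pow, inv_pow,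
    ← div_eq_inv_mul, le_div_iff₀ (by positivity)] at h1
  exact h1

/-- A subsequence converges in norm, so no weak compactness is called for: compactness settles the
traces, and the quadratic structure settles the rest. -/
lemma exists_minimizer {A Γ : Set Plane} (hA : IsOpen A) (hb : Bornology.IsBounded A)
    (hlip : HasLipschitzBoundary A) {k : ℝ}
    (hk : ∀ w ∈ V A Γ, ‖w.2.2‖ = 1 → k ≤ ‖w.2.1‖ ^ 2) {x : ℕ → Triple A} (hxV : ∀ n, x n ∈ V A Γ)
    (hx1 : ∀ n, ‖(x n).2.2‖ = 1) (hxk : Tendsto (fun n => ‖(x n).2.1‖ ^ 2) atTop (𝓝 k)) :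
    ∃ w ∈ V A Γ, ‖w.2.2‖ = 1 ∧ ‖w.2.1‖ ^ 2 = k := by
  obtain ⟨C, hC⟩ := exists_friedrichs_const hA hb hlip
  obtain ⟨B, hB⟩ := hxk.bddAbove_range
  have hB' : ∀ n, ‖(x n).2.1‖ ^ 2 ≤ B := fun n => hB ⟨n, rfl⟩
  have hbdd : Bornology.IsBounded (Set.range fun n => (⟨x n, (hxV n).1⟩ : H1 A)) := by
    refine isBounded_iff_forall_norm_le.2 ⟨max (√(C * (B + 1))) (max (√B) 1), ?_⟩
    rintro _ ⟨n, rfl⟩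
    refine max_le_max (Real.le_sqrt_of_sq_le ?_)
      (max_le_max (Real.le_sqrt_of_sq_le (hB' n)) (hx1 n).le)
    refine (hC _ (hxV n).1).trans ?_
    rw [hx1 n, one_pow]
    gcongr
    exact hB' n
  obtain ⟨S, hS, hSx⟩ := IsCompactOperator.image_subset_compact_of_bounded
    (f := (traceL A).toLinearMap) (isCompactOperator_traceL hA hb hlip) hbdd
  have hmem : ∀ n, (x n).2.2 ∈ S := fun n => hSx ⟨_, ⟨n, rfl⟩, rfl⟩
  obtain ⟨T, -, ns, hns, hT⟩ := hS.tendsto_subseq hmem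
  set y : ℕ → Triple A := x ∘ ns
  have hyV : ∀ n, y n ∈ V A Γ := fun n => hxV _
  have hy1 : ∀ n, ‖(y n).2.2‖ = 1 := fun n => hx1 _
  have hyk : Tendsto (fun n => ‖(y n).2.1‖ ^ 2) atTop (𝓝 k) := hxk.comp hns.tendsto_atTop
  have hT' : CauchySeq fun n => (y n).2.2 := hT.cauchySeq
  have hfst : Tendsto (Prod.fst : ℕ × ℕ → ℕ) atTop atTop := by
    rw [← prod_atTop_atTop_eq]; exact tendsto_fst
  have hsnd : Tendsto (Prod.snd : ℕ × ℕ → ℕ) atTop atTop := by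
    rw [← prod_atTop_atTop_eq]; exact tendsto_snd
  have dT : Tendsto (fun p : ℕ × ℕ => ‖(y p.1).2.2 - (y p.2).2.2‖ ^ 2) atTop (𝓝 0) := by
    have := (cauchySeq_iff_tendsto_dist_atTop_0.1 hT').pow 2
    simpa [dist_eq_norm] using this
  -- The sum of two members has energy at least `k * ‖T + T'‖ ^ 2 = k * (4 - ‖T - T'‖ ^ 2)`. The
  -- parallelogram law turns this lower bound into an upper bound for the energy of the difference.
  have dG : Tendsto (fun p : ℕ × ℕ => ‖(y p.1).2.1 - (y p.2).2.1‖ ^ 2) atTop (𝓝 0) := by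
    have hlim : Tendsto (fun p : ℕ × ℕ => 2 * (‖(y p.1).2.1‖ ^ 2 - k) + 2 * (‖(y p.2).2.1‖ ^ 2 - k)
        + k * ‖(y p.1).2.2 - (y p.2).2.2‖ ^ 2) atTop (𝓝 0) := by
      have h1 := ((hyk.comp hfst).sub_const k).const_mul 2
      have h2 := ((hyk.comp hsnd).sub_const k).const_mul 2
      have h3 := (h1.add h2).add (dT.const_mul k)
      simpa using h3
    refine squeeze_zero (fun _ => sq_nonneg _) (fun p => ?_) hlim
    have h1 := rayleigh hk (add_mem (hyV p.1) (hyV p.2))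
    rw [Prod.snd_add, Prod.snd_add, Prod.fst_add] at h1
    have h2 := parallelogram_law_with_norm ℝ (y p.1).2.1 (y p.2).2.1
    have h3 := parallelogram_law_with_norm ℝ (y p.1).2.2 (y p.2).2.2
    rw [hy1, hy1] at h3
    have h4 : ‖(y p.1).2.2 + (y p.2).2.2‖ ^ 2 = 4 - ‖(y p.1).2.2 - (y p.2).2.2‖ ^ 2 := by linarith
    rw [h4] at h1
    nlinarith
  have dU : Tendsto (fun p : ℕ × ℕ => ‖(y p.1).1 - (y p.2).1‖ ^ 2) atTop (𝓝 0) := by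
    have hlim := (dG.add dT).const_mul (C : ℝ)
    rw [add_zero, mul_zero] at hlim
    refine squeeze_zero (fun _ => sq_nonneg _) (fun p => ?_) hlim
    have hsub : y p.1 - y p.2 ∈ V A Γ := sub_mem (hyV p.1) (hyV p.2)
    simpa only [Prod.fst_sub, Prod.snd_sub] using hC _ hsub.1
  have hG' : CauchySeq fun n => (y n).2.1 := cauchySeq_iff_tendsto_dist_atTop_0.2 <| by
    simpa [dist_eq_norm] using tendsto_zero_of_sq_tendsto_zero (fun _ => norm_nonneg _) dG
  have hU' : CauchySeq fun n => (y n).1 := cauchySeq_iff_tendsto_dist_atTop_0.2 <| by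
    simpa [dist_eq_norm] using tendsto_zero_of_sq_tendsto_zero (fun _ => norm_nonneg _) dU
  obtain ⟨G, hG⟩ := cauchySeq_tendsto_of_complete hG'
  obtain ⟨U, hU⟩ := cauchySeq_tendsto_of_complete hU'
  have hy : Tendsto y atTop (𝓝 (U, G, T)) := hU.prodMk_nhds (hG.prodMk_nhds hT)
  refine ⟨(U, G, T), (isClosed_V A Γ).mem_of_tendsto hy (Eventually.of_forall hyV), ?_, ?_⟩
  · refine tendsto_nhds_unique hT.norm ?_
    have : (fun n => ‖((fun n => (x n).2.2) ∘ ns) n‖) = fun _ => 1 := funext hy1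
    rw [this]
    exact tendsto_const_nhds
  · exact tendsto_nhds_unique (hG.norm.pow 2) hyk

lemma eq_zero_of_forall_quadratic_nonneg {b c : ℝ} (h : ∀ s : ℝ, 0 ≤ 2 * s * b + s ^ 2 * c) :
    b = 0 := by
  have h1 : ∀ s : ℝ, 0 ≤ c * (s * s) + 2 * b * s + 0 := fun s => by
    have := h s; nlinarith
  have h2 := discrim_le_zero h1
  rw [discrim] at h2
  have : b ^ 2 ≤ 0 := by nlinarith
  exact pow_eq_zero_iff two_ne_zero |>.1 (le_antisymm this (sq_nonneg b))

/-- The quadratic form `‖w.2.1‖ ^ 2 - k * ‖w.2.2‖ ^ 2` is nonnegative on `V A Γ` and vanishes at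
`w`, hence so does its polar form against `w`: otherwise it would change sign along `w + s • z`. -/
lemma euler_lagrange {A Γ : Set Plane} {k : ℝ}
    (hk : ∀ w ∈ V A Γ, ‖w.2.2‖ = 1 → k ≤ ‖w.2.1‖ ^ 2) {w : Triple A} (hw : w ∈ V A Γ)
    (hmin : ‖w.2.1‖ ^ 2 = k * ‖w.2.2‖ ^ 2) {z : Triple A} (hz : z ∈ V A Γ) :
    inner ℝ w.2.1 z.2.1 = k * inner ℝ w.2.2 z.2.2 := by
  rw [← sub_eq_zero]
  refine eq_zero_of_forall_quadratic_nonneg (c := ‖z.2.1‖ ^ 2 - k * ‖z.2.2‖ ^ 2) fun s => ?_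
  have h := rayleigh hk (add_mem hw (Submodule.smul_mem _ s hz))
  simp only [Prod.snd_add, Prod.fst_add, Prod.smul_snd, Prod.smul_fst, norm_add_sq_real,
    real_inner_smul_right, norm_smul, mul_pow, Real.norm_eq_abs, sq_abs] at h
  nlinarith

/-! ### Translation between concrete functions and triples. -/

lemma memLp_of_continuous {E : Type*} [NormedAddCommGroup E] {A : Set Plane} (hA : IsOpen A)
    (hb : Bornology.IsBounded A) {f : Plane → E} (hf : Continuous f) :
    MemLp f 2 (volume.restrict A) := by
  have : IsFiniteMeasure (volume.restrict A) :=
    ⟨by rw [Measure.restrict_apply_univ]; exact hb.measure_lt_top⟩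
  obtain ⟨C, hC⟩ := hb.isCompact_closure.exists_bound_of_continuousOn hf.continuousOn
  refine MemLp.of_bound hf.aestronglyMeasurable C ?_
  filter_upwards [ae_restrict_mem hA.measurableSet] with x hx using hC x (subset_closure hx)

lemma memLp_bdry_of_continuous {A : Set Plane} (hA : IsOpen A) (hb : Bornology.IsBounded A)
    (hlip : HasLipschitzBoundary A) {f : Plane → ℝ} (hf : Continuous f) :
    MemLp f 2 (bdryMeasure A) := by
  have := isFiniteMeasure_bdryMeasure hA hb hlip
  obtain ⟨C, hC⟩ := hb.isCompact_closure.exists_bound_of_continuousOn hf.continuousOn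
  refine MemLp.of_bound hf.aestronglyMeasurable C ?_
  filter_upwards [ae_restrict_mem (s := frontier A) isClosed_frontier.measurableSet] with x hx
    using hC x (frontier_subset_closure hx)

lemma toLp_mem_smoothTriples {A : Set Plane} {φ : Plane → ℝ} (hφ : ContDiff ℝ ∞ φ)
    (h1 : MemLp φ 2 (volume.restrict A)) (h2 : MemLp (gradient φ) 2 (volume.restrict A))
    (h3 : MemLp φ 2 (bdryMeasure A)) : (h1.toLp, h2.toLp, h3.toLp) ∈ smoothTriples A :=
  ⟨φ, hφ, h1.coeFn_toLp, h2.coeFn_toLp, h3.coeFn_toLp⟩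

lemma IsTrace.toLp_mem_H1 {A : Set Plane} (hA : IsOpen A) (hb : Bornology.IsBounded A)
    (hlip : HasLipschitzBoundary A) {u : Plane → ℝ} {g : Plane → Plane} {t : Plane → ℝ}
    (h : IsTrace A u g t) (hu : MemLp u 2 (volume.restrict A))
    (hg : MemLp g 2 (volume.restrict A)) : (hu.toLp, hg.toLp, h.memLp.toLp) ∈ H1 A := by
  obtain ⟨φ, hφ, h1, h2, h3⟩ := h.approx
  have k1 := fun n => memLp_of_continuous hA hb (hφ n).continuous
  have k2 := fun n => memLp_of_continuous hA hb (continuous_gradient (hφ n))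
  have k3 := fun n => memLp_bdry_of_continuous hA hb hlip (hφ n).continuous
  have ht : Tendsto (fun n => ((k1 n).toLp, (k2 n).toLp, (k3 n).toLp)) atTop
      (𝓝 (hu.toLp, hg.toLp, h.memLp.toLp)) := by
    refine Tendsto.prodMk_nhds ?_ (Tendsto.prodMk_nhds ?_ ?_)
    · exact (Lp.tendsto_Lp_iff_tendsto_eLpNorm'' _ k1 _ hu).2 h1
    · exact (Lp.tendsto_Lp_iff_tendsto_eLpNorm'' _ k2 _ hg).2 h2
    · exact (Lp.tendsto_Lp_iff_tendsto_eLpNorm'' _ k3 _ h.memLp).2 h3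
  exact mem_closure_of_tendsto ht
    (Eventually.of_forall fun n => toLp_mem_smoothTriples (hφ n) (k1 n) (k2 n) (k3 n))

lemma MemH1Vanishing.exists_mem_V {A Γ : Set Plane} (hA : IsOpen A) (hb : Bornology.IsBounded A)
    (hlip : HasLipschitzBoundary A) {u : Plane → ℝ} {g : Plane → Plane} {t : Plane → ℝ}
    (h : MemH1Vanishing A Γ u g t) : ∃ w ∈ V A Γ, w.1 =ᵐ[volume.restrict A] u ∧
      w.2.1 =ᵐ[volume.restrict A] g ∧ w.2.2 =ᵐ[bdryMeasure A] t := by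
  refine ⟨(h.memH1.memLp.toLp, h.memH1.memLp_grad.toLp, h.isTrace.memLp.toLp),
    ⟨h.isTrace.toLp_mem_H1 hA hb hlip _ _, ?_⟩, h.memH1.memLp.coeFn_toLp,
    h.memH1.memLp_grad.coeFn_toLp, h.isTrace.memLp.coeFn_toLp⟩
  filter_upwards [h.vanish, h.isTrace.memLp.coeFn_toLp] with x h1 h2 hx
  rw [h2, h1 hx]

lemma isTrace_of_mem_H1 {A : Set Plane} {w : Triple A} (hw : w ∈ H1 A) {u : Plane → ℝ}
    (hu : w.1 =ᵐ[volume.restrict A] u) : IsTrace A u w.2.1 w.2.2 := by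
  refine ⟨Lp.memLp _, ?_⟩
  obtain ⟨z, hz, hzw⟩ := mem_closure_iff_seq_limit.1 hw
  choose φ hφ h1 h2 h3 using hz
  refine ⟨φ, hφ, ?_, ?_, ?_⟩
  · have ht : Tendsto (fun n => (z n).1) atTop (𝓝 w.1) :=
      (continuous_fst.tendsto _).comp hzw
    refine ((Lp.tendsto_Lp_iff_tendsto_eLpNorm' _ _).1 ht).congr fun n => eLpNorm_congr_ae ?_
    filter_upwards [h1 n, hu] with x e1 e2
    rw [Pi.sub_apply, e1, e2]
  · have ht : Tendsto (fun n => (z n).2.1) atTop (𝓝 w.2.1) :=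
      ((continuous_fst.comp continuous_snd).tendsto _).comp hzw
    refine ((Lp.tendsto_Lp_iff_tendsto_eLpNorm' _ _).1 ht).congr fun n => eLpNorm_congr_ae ?_
    filter_upwards [h2 n] with x e1
    rw [Pi.sub_apply, e1]
  · have ht : Tendsto (fun n => (z n).2.2) atTop (𝓝 w.2.2) :=
      ((continuous_snd.comp continuous_snd).tendsto _).comp hzw
    refine ((Lp.tendsto_Lp_iff_tendsto_eLpNorm' _ _).1 ht).congr fun n => eLpNorm_congr_ae ?_
    filter_upwards [h3 n] with x e1
    rw [Pi.sub_apply, e1]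

lemma integral_mul_fderiv_of_support {A : Set Plane} {φ ψ : Plane → ℝ} (hφ : ContDiff ℝ ∞ φ)
    (hψ : ContDiff ℝ ∞ ψ) (hψc : HasCompactSupport ψ) (hψA : tsupport ψ ⊆ A) (e : Plane) :
    ∫ x in A, φ x * fderiv ℝ ψ x e = -∫ x in A, ψ x * fderiv ℝ φ x e := by
  have hcφ : Continuous fun x => fderiv ℝ φ x e :=
    (hφ.continuous_fderiv (by simp)).clm_apply continuous_const
  have hcψ : Continuous fun x => fderiv ℝ ψ x e :=
    (hψ.continuous_fderiv (by simp)).clm_apply continuous_const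
  have hsupp : ∀ x, x ∉ A → ψ x = 0 := fun x hx => image_eq_zero_of_notMem_tsupport
    fun h => hx (hψA h)
  have hsupp' : ∀ x, x ∉ A → fderiv ℝ ψ x e = 0 := fun x hx => by
    have : x ∉ tsupport ψ := fun h => hx (hψA h)
    rw [image_eq_zero_of_notMem_tsupport fun h => this (tsupport_fderiv_subset ℝ h)]
    rfl
  have hcs : HasCompactSupport fun x => fderiv ℝ ψ x e := hψc.fderiv_apply ℝ e
  rw [setIntegral_eq_integral_of_forall_compl_eq_zero (fun x hx => by rw [hsupp' x hx, mul_zero]),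
    setIntegral_eq_integral_of_forall_compl_eq_zero (fun x hx => by rw [hsupp x hx, zero_mul]),
    integral_mul_fderiv_eq_neg_fderiv_mul_of_integrable]
  · simp only [mul_comm]
  · exact (hcφ.mul hψ.continuous).integrable_of_hasCompactSupport hψc.mul_left
  · exact (hφ.continuous.mul hcψ).integrable_of_hasCompactSupport hcs.mul_left
  · exact (hφ.continuous.mul hψ.continuous).integrable_of_hasCompactSupport hψc.mul_left
  · exact fun x _ => hφ.differentiable (by simp) x
  · exact fun x _ => hψ.differentiable (by simp) x

lemma integral_mul_fderiv_of_mem_H1 {A : Set Plane} (hA : IsOpen A) (hb : Bornology.IsBounded A)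
    {w : Triple A} (hw : w ∈ H1 A) {ψ : Plane → ℝ} (hψ : ContDiff ℝ ∞ ψ)
    (hψc : HasCompactSupport ψ) (hψA : tsupport ψ ⊆ A) (e : Plane) :
    ∫ x in A, w.1 x * fderiv ℝ ψ x e = -∫ x in A, ψ x * inner ℝ (w.2.1 x) e := by
  have hcψ : Continuous fun x => fderiv ℝ ψ x e :=
    (hψ.continuous_fderiv (by simp)).clm_apply continuous_const
  have m1 := memLp_of_continuous hA hb hcψ
  have m2 := memLp_of_continuous hA hb (f := fun x => ψ x • e)
    (hψ.continuous.smul continuous_const)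
  have e1 : ∀ f : Lp ℝ 2 (volume.restrict A),
      ∫ x in A, f x * fderiv ℝ ψ x e = inner ℝ f m1.toLp := by
    intro f
    rw [L2.inner_def]
    refine integral_congr_ae ?_
    filter_upwards [m1.coeFn_toLp] with x hx
    rw [hx]
    simp [mul_comm]
  have e2 : ∀ f : Lp Plane 2 (volume.restrict A),
      ∫ x in A, ψ x * inner ℝ (f x) e = inner ℝ f m2.toLp := by
    intro f
    rw [L2.inner_def]
    refine integral_congr_ae ?_
    filter_upwards [m2.coeFn_toLp] with x hx
    rw [hx, real_inner_smul_right]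
  rw [e1, e2]
  refine H1_induction (p := fun w => inner ℝ w.1 m1.toLp = -inner ℝ w.2.1 m2.toLp) ?_ ?_ hw
  · exact isClosed_eq (by fun_prop) (by fun_prop)
  · rintro w ⟨φ, hφ, h1, h2, -⟩
    rw [← e1, ← e2]
    have i1 : ∫ x in A, w.1 x * fderiv ℝ ψ x e = ∫ x in A, φ x * fderiv ℝ ψ x e :=
      integral_congr_ae (h1.mono fun x hx => by simp only [hx])
    have i2 : ∫ x in A, ψ x * inner ℝ (w.2.1 x) e = ∫ x in A, ψ x * fderiv ℝ φ x e :=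
      integral_congr_ae (h2.mono fun x hx => by simp only [hx, inner_gradient])
    rw [i1, i2, integral_mul_fderiv_of_support hφ hψ hψc hψA]

lemma memH1_of_mem_H1 {A : Set Plane} (hA : IsOpen A) (hb : Bornology.IsBounded A)
    {w : Triple A} (hw : w ∈ H1 A) {u : Plane → ℝ} (hu : w.1 =ᵐ[volume.restrict A] u) :
    MemH1 A u w.2.1 := by
  have hmu : MemLp u 2 (volume.restrict A) := (memLp_congr_ae hu).1 (Lp.memLp w.1)
  refine ⟨hmu, Lp.memLp _, fun ψ hψ hψc hψA => ?_⟩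
  have hg := memLp_of_continuous hA hb (continuous_gradient hψ)
  have hψ2 := memLp_of_continuous hA hb hψ.continuous
  have i1 : Integrable (fun x => u x • gradient ψ x) (volume.restrict A) :=
    memLp_one_iff_integrable.1 (hg.smul hmu)
  have i2 : Integrable (fun x => ψ x • w.2.1 x) (volume.restrict A) :=
    memLp_one_iff_integrable.1 ((Lp.memLp w.2.1).smul hψ2)
  refine ext_inner_left ℝ fun e => ?_
  rw [inner_neg_right, ← integral_inner i1, ← integral_inner i2]
  have e1 : ∫ x in A, inner ℝ e (u x • gradient ψ x) = ∫ x in A, w.1 x * fderiv ℝ ψ x e :=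
    integral_congr_ae (hu.mono fun x hx => by
      simp only [hx]; rw [real_inner_smul_right, real_inner_comm, inner_gradient])
  have e2 : ∫ x in A, inner ℝ e (ψ x • w.2.1 x) = ∫ x in A, ψ x * inner ℝ (w.2.1 x) e :=
    integral_congr_ae (ae_of_all _ fun x => by
      simp only; rw [real_inner_smul_right, real_inner_comm])
  rw [e1, e2]
  exact integral_mul_fderiv_of_mem_H1 hA hb hw hψ hψc hψA e

lemma memH1Vanishing_of_mem_V {A Γ : Set Plane} (hA : IsOpen A) (hb : Bornology.IsBounded A)
    {w : Triple A} (hw : w ∈ V A Γ) {u : Plane → ℝ} (hu : w.1 =ᵐ[volume.restrict A] u) :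
    MemH1Vanishing A Γ u w.2.1 w.2.2 :=
  ⟨memH1_of_mem_H1 hA hb hw.1 hu, isTrace_of_mem_H1 hw.1 hu, hw.2⟩

/-- This turns integrals over `Γ` into norms and inner products in `L²` of the whole boundary. -/
lemma setIntegral_hausdorff_eq {A Γ : Set Plane} (hΓ : Γ ⊆ frontier A)
    (hΓm : NullMeasurableSet Γ (Measure.hausdorffMeasure 1)) {F : Plane → ℝ}
    (hF : ∀ᵐ x ∂bdryMeasure A, x ∉ Γ → F x = 0) :
    ∫ x in Γ, F x ∂(Measure.hausdorffMeasure 1) = ∫ x, F x ∂bdryMeasure A := by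
  have h : Measure.restrict (Measure.hausdorffMeasure 1) Γ = (bdryMeasure A).restrict Γ := by
    rw [bdryMeasure, Measure.restrict_restrict₀
      (hΓm.mono_ac Measure.restrict_le_self.absolutelyContinuous), Set.inter_eq_left.2 hΓ]
  rw [h, setIntegral_eq_integral_of_ae_compl_eq_zero hF]

lemma norm_sq_eq_integral {α E : Type*} [MeasurableSpace α] [NormedAddCommGroup E]
    [InnerProductSpace ℝ E] {μ : Measure α} (f : Lp E 2 μ) : ‖f‖ ^ 2 = ∫ x, ‖f x‖ ^ 2 ∂μ := by
  rw [← real_inner_self_eq_norm_sq, L2.inner_def]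
  simp

lemma energies_eq {A Γ : Set Plane} (hA : IsOpen A) (hb : Bornology.IsBounded A)
    (hlip : HasLipschitzBoundary A) (hΓ : Γ ⊆ frontier A)
    (hΓm : NullMeasurableSet Γ (Measure.hausdorffMeasure 1)) :
    energies Γ A = {c | ∃ w ∈ V A Γ, ‖w.2.2‖ = 1 ∧ c = ‖w.2.1‖ ^ 2} := by
  ext c
  constructor
  · rintro ⟨v, g, t, h, ht, rfl⟩
    obtain ⟨w, hw, -, h2, h3⟩ := h.exists_mem_V hA hb hlip
    refine ⟨w, hw, ?_, ?_⟩
    · have : ‖w.2.2‖ ^ 2 = 1 := by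
        rw [norm_sq_eq_integral, ← ht, setIntegral_hausdorff_eq hΓ hΓm]
        · exact integral_congr_ae (h3.mono fun x hx => by simp [hx])
        · filter_upwards [h.vanish] with x hx hxΓ
          rw [hx hxΓ, zero_pow two_ne_zero]
      exact (pow_eq_one_iff_of_nonneg (norm_nonneg _) two_ne_zero).1 this
    · rw [norm_sq_eq_integral]
      exact integral_congr_ae (h2.mono fun x hx => by simp [hx])
  · rintro ⟨w, hw, h1, rfl⟩
    refine ⟨w.1, w.2.1, w.2.2, memH1Vanishing_of_mem_V hA hb hw (ae_eq_refl _), ?_,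
      norm_sq_eq_integral _⟩
    rw [setIntegral_hausdorff_eq hΓ hΓm]
    · have := norm_sq_eq_integral w.2.2
      rw [h1] at this
      simpa using this.symm
    · filter_upwards [hw.2] with x hx hxΓ
      rw [hx hxΓ, zero_pow two_ne_zero]

lemma isEigenfunction_iff {A Γ : Set Plane} (hA : IsOpen A) (hb : Bornology.IsBounded A)
    (hlip : HasLipschitzBoundary A) (hΓ : Γ ⊆ frontier A)
    (hΓm : NullMeasurableSet Γ (Measure.hausdorffMeasure 1)) {lam : ℝ} {u : Plane → ℝ} :
    IsEigenfunction A Γ lam u ↔ (∃ x ∈ A, u x ≠ 0) ∧ InnerProductSpace.HarmonicOnNhd u A ∧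
      ∃ w ∈ V A Γ, w.1 =ᵐ[volume.restrict A] u ∧
        ∀ z ∈ V A Γ, inner ℝ w.2.1 z.2.1 = lam * inner ℝ w.2.2 z.2.2 := by
  refine and_congr_right fun _ => and_congr_right fun _ => ⟨?_, ?_⟩
  · rintro ⟨g, t, h, hn⟩
    obtain ⟨w, hw, h1, h2, h3⟩ := h.exists_mem_V hA hb hlip
    refine ⟨w, hw, h1, fun z hz => ?_⟩
    have := hn _ _ _ (memH1Vanishing_of_mem_V hA hb hz (ae_eq_refl _))
    rw [setIntegral_hausdorff_eq hΓ hΓm] at this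
    · rw [L2.inner_def, L2.inner_def, ← integral_const_mul]
      convert this using 1
      · exact integral_congr_ae (h2.mono fun x hx => by simp [hx])
      · exact integral_congr_ae (h3.mono fun x hx => by simp [hx]; ring)
    · filter_upwards [hz.2] with x hx hxΓ
      rw [hx hxΓ, mul_zero]
  · rintro ⟨w, hw, h1, h⟩
    refine ⟨w.2.1, w.2.2, memH1Vanishing_of_mem_V hA hb hw h1, fun v gv tv hv => ?_⟩
    obtain ⟨z, hz, k1, k2, k3⟩ := hv.exists_mem_V hA hb hlip
    have := h z hz
    rw [L2.inner_def, L2.inner_def, ← integral_const_mul] at this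
    rw [setIntegral_hausdorff_eq hΓ hΓm]
    · convert this using 1
      · exact integral_congr_ae (k2.mono fun x hx => by simp [hx])
      · exact integral_congr_ae (k3.mono fun x hx => by simp [hx]; ring)
    · filter_upwards [hv.vanish] with x hx hxΓ
      rw [hx hxΓ, mul_zero]

/-! ### Chain rule and absolute value. -/

/-- Dominated convergence with majorant `4 * ‖G‖ ^ 2`. The bound `2` fits the intended `a n`, a
difference of two functions bounded by one. -/
lemma tendsto_eLpNorm_smul_zero {α : Type*} [MeasurableSpace α] {μ : Measure α} {a : ℕ → α → ℝ}
    {G : α → Plane} (hG : MemLp G 2 μ) (ha : ∀ n, AEStronglyMeasurable (a n) μ)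
    (hb : ∀ n x, |a n x| ≤ 2) (hl : ∀ᵐ x ∂μ, Tendsto (fun n => a n x) atTop (𝓝 0)) :
    Tendsto (fun n => eLpNorm (fun x => a n x • G x) 2 μ) atTop (𝓝 0) := by
  have hfin : ∫⁻ x, ‖G x‖ₑ ^ 2 ∂μ ≠ ⊤ := by
    have h := eLpNorm_nnreal_pow_eq_lintegral (f := G) (μ := μ) (p := 2) (by norm_num)
    have h2 : eLpNorm G 2 μ ^ (2 : ℝ) ≠ ⊤ := ENNReal.rpow_ne_top_of_nonneg (by norm_num) hG.2.ne
    simp only [NNReal.coe_ofNat, ENNReal.coe_ofNat, ENNReal.rpow_two] at h h2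
    rwa [← h]
  have h0 : Tendsto (fun n => ∫⁻ x, ‖a n x • G x‖ₑ ^ 2 ∂μ) atTop (𝓝 0) := by
    have := tendsto_lintegral_of_dominated_convergence' (μ := μ)
      (F := fun n x => ‖a n x • G x‖ₑ ^ 2) (f := fun _ => 0) (fun x => 4 * ‖G x‖ₑ ^ 2)
      (fun n => ((ha n).smul hG.1).enorm.pow_const 2) (fun n => ae_of_all _ fun x => ?_) ?_ ?_
    · simpa using this
    · change ‖a n x • G x‖ₑ ^ 2 ≤ 4 * ‖G x‖ₑ ^ 2
      rw [enorm_smul, mul_pow]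
      gcongr
      have h2 : ‖a n x‖ₑ ≤ 2 := by
        rw [← ofReal_norm, Real.norm_eq_abs, ← ENNReal.ofReal_ofNat]
        exact ENNReal.ofReal_le_ofReal (hb n x)
      exact (pow_le_pow_left' h2 2).trans_eq (by norm_num)
    · rw [lintegral_const_mul' _ _ ENNReal.ofNat_ne_top]
      exact ENNReal.mul_ne_top ENNReal.ofNat_ne_top hfin
    · filter_upwards [hl] with x hx
      have h1 : Tendsto (fun n => a n x • G x) atTop (𝓝 0) := by simpa using hx.smul_const (G x)
      have h2 := (ENNReal.continuous_pow 2).tendsto _ |>.comp h1.enorm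
      simpa [Function.comp_def] using h2
  have h1 := (ENNReal.continuous_rpow_const (y := 1 / 2)).tendsto 0 |>.comp h0
  rw [ENNReal.zero_rpow_of_pos (by norm_num)] at h1
  refine h1.congr fun n => ?_
  rw [eLpNorm_eq_lintegral_rpow_enorm_toReal (by norm_num) (by norm_num)]
  simp

lemma gradient_comp {F : ℝ → ℝ} (hF : ContDiff ℝ ∞ F) {φ : Plane → ℝ} (hφ : ContDiff ℝ ∞ φ)
    (x : Plane) : gradient (fun y => F (φ y)) x = deriv F (φ x) • gradient φ x := by
  have h1 : HasDerivAt F (deriv F (φ x)) (φ x) := (hF.differentiable (by simp) _).hasDerivAt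
  have h2 : HasFDerivAt φ (fderiv ℝ φ x) x := (hφ.differentiable (by simp) x).hasFDerivAt
  have h3 : HasFDerivAt (fun y => F (φ y)) (deriv F (φ x) • fderiv ℝ φ x) x :=
    h1.comp_hasFDerivAt x h2
  rw [gradient, h3.fderiv, map_smul]
  rfl

lemma tendsto_eLpNorm_comp_sub {α : Type*} [MeasurableSpace α] {μ : Measure α} {F : ℝ → ℝ}
    (hF : LipschitzWith 1 F) {φ : ℕ → α → ℝ} {u : α → ℝ}
    (h : Tendsto (fun n => eLpNorm (fun x => φ n x - u x) 2 μ) atTop (𝓝 0)) :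
    Tendsto (fun n => eLpNorm (fun x => F (φ n x) - F (u x)) 2 μ) atTop (𝓝 0) := by
  refine tendsto_of_tendsto_of_tendsto_of_le_of_le tendsto_const_nhds h (fun _ => zero_le)
    fun n => eLpNorm_mono fun x => ?_
  simpa [Real.dist_eq] using hF.dist_le_mul (φ n x) (u x)

/-- The chain rule in `H¹(A)`. -/
lemma exists_comp_mem_H1 {A : Set Plane} (hA : IsOpen A) (hb : Bornology.IsBounded A)
    (hlip : HasLipschitzBoundary A) {F : ℝ → ℝ} (hF : ContDiff ℝ ∞ F)
    (hF1 : ∀ s, |deriv F s| ≤ 1) (hF0 : F 0 = 0) {w : Triple A} (hw : w ∈ H1 A) :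
    ∃ z ∈ H1 A, z.1 =ᵐ[volume.restrict A] (fun x => F (w.1 x)) ∧
      z.2.1 =ᵐ[volume.restrict A] (fun x => deriv F (w.1 x) • w.2.1 x) ∧
      z.2.2 =ᵐ[bdryMeasure A] fun x => F (w.2.2 x) := by
  have hFL : LipschitzWith 1 F :=
    lipschitzWith_of_nnnorm_deriv_le (hF.differentiable (by simp)) fun s => by
      rw [← NNReal.coe_le_coe]; simpa using hF1 s
  have hdF : Continuous (deriv F) := hF.continuous_deriv (by simp)
  have hU : MemLp (fun x => F (w.1 x)) 2 (volume.restrict A) := hFL.comp_memLp hF0 (Lp.memLp w.1)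
  have hT : MemLp (fun x => F (w.2.2 x)) 2 (bdryMeasure A) := hFL.comp_memLp hF0 (Lp.memLp w.2.2)
  have hmU : AEStronglyMeasurable (fun x => deriv F (w.1 x)) (volume.restrict A) :=
    hdF.comp_aestronglyMeasurable (Lp.aestronglyMeasurable _)
  have hG : MemLp (fun x => deriv F (w.1 x) • w.2.1 x) 2 (volume.restrict A) := by
    refine (Lp.memLp w.2.1).mono (hmU.smul (Lp.aestronglyMeasurable _)) (ae_of_all _ fun x => ?_)
    rw [norm_smul]
    exact mul_le_of_le_one_left (norm_nonneg _) (hF1 _)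
  obtain ⟨φ, hφ, h1, h2, h3⟩ := (isTrace_of_mem_H1 hw (ae_eq_refl _)).approx
  -- `deriv F` is merely continuous and bounded, so its values along the approximants are controlled
  -- only pointwise; hence the passage to an almost everywhere convergent subsequence.
  have hmeas : TendstoInMeasure (volume.restrict A) φ atTop w.1 :=
    tendstoInMeasure_of_tendsto_eLpNorm two_ne_zero
      (fun n => (hφ n).continuous.aestronglyMeasurable) (Lp.aestronglyMeasurable _) h1
  obtain ⟨ns, hns, hae⟩ := hmeas.exists_seq_tendsto_ae
  have h1' := h1.comp hns.tendsto_atTop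
  have h2' := h2.comp hns.tendsto_atTop
  have h3' := h3.comp hns.tendsto_atTop
  have tG : Tendsto (fun n => eLpNorm (fun x => gradient (fun y => F (φ (ns n) y)) x -
      deriv F (w.1 x) • w.2.1 x) 2 (volume.restrict A)) atTop (𝓝 0) := by
    have hm : ∀ n, AEStronglyMeasurable (fun x => deriv F (φ (ns n) x)) (volume.restrict A) :=
      fun n => (hdF.comp (hφ _).continuous).aestronglyMeasurable
    have t2 := tendsto_eLpNorm_smul_zero (a := fun n x => deriv F (φ (ns n) x) - deriv F (w.1 x))
      (Lp.memLp w.2.1) (fun n => (hm n).sub hmU)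
      (fun n x => (abs_sub _ _).trans (by linarith [hF1 (φ (ns n) x), hF1 (w.1 x)])) (by
        filter_upwards [hae] with x hx
        have := ((hdF.tendsto _).comp hx).sub_const (deriv F (w.1 x))
        simpa using this)
    have t3 := h2'.add t2
    rw [add_zero] at t3
    refine tendsto_of_tendsto_of_tendsto_of_le_of_le tendsto_const_nhds t3 (fun _ => zero_le)
      fun n => ?_
    -- The first summand is small because the gradients converge, the second by dominated
    -- convergence with the fixed gradient of `w`.
    have hd : (fun x => gradient (fun y => F (φ (ns n) y)) x - deriv F (w.1 x) • w.2.1 x) =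
        (fun x => deriv F (φ (ns n) x) • (gradient (φ (ns n)) x - w.2.1 x)) +
          fun x => (deriv F (φ (ns n) x) - deriv F (w.1 x)) • w.2.1 x := by
      ext1 x
      rw [Pi.add_apply, gradient_comp hF (hφ _)]
      module
    simp only [hd, Function.comp_apply]
    have hmg : AEStronglyMeasurable (fun x => gradient (φ (ns n)) x - w.2.1 x)
      (volume.restrict A) := (continuous_gradient (hφ _)).aestronglyMeasurable.sub
        (Lp.aestronglyMeasurable _)
    refine (eLpNorm_add_le ((hm n).smul hmg)
      (((hm n).sub hmU).smul (Lp.aestronglyMeasurable _)) (by norm_num)).trans ?_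
    refine add_le_add (eLpNorm_mono fun x => ?_) le_rfl
    change ‖deriv F (φ (ns n) x) • (gradient (φ (ns n)) x - w.2.1 x)‖ ≤ _
    rw [norm_smul]
    exact mul_le_of_le_one_left (norm_nonneg _) (hF1 _)
  have htr : IsTrace A (fun x => F (w.1 x)) (fun x => deriv F (w.1 x) • w.2.1 x)
      (fun x => F (w.2.2 x)) :=
    ⟨hT, fun n x => F (φ (ns n) x), fun n => hF.comp (hφ _), tendsto_eLpNorm_comp_sub hFL h1', tG,
      tendsto_eLpNorm_comp_sub hFL h3'⟩
  exact ⟨_, htr.toLp_mem_H1 hA hb hlip hU hG, hU.coeFn_toLp, hG.coeFn_toLp, hT.coeFn_toLp⟩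

/-- A smooth approximation of the absolute value. -/
def smoothAbs (ε s : ℝ) : ℝ := √(s ^ 2 + ε ^ 2) - ε

lemma contDiff_smoothAbs {ε : ℝ} (hε : 0 < ε) : ContDiff ℝ ∞ (smoothAbs ε) :=
  (ContDiff.sqrt (by fun_prop) fun s => by positivity).sub contDiff_const

lemma deriv_smoothAbs {ε : ℝ} (hε : 0 < ε) (s : ℝ) :
    deriv (smoothAbs ε) s = s / √(s ^ 2 + ε ^ 2) := by
  have h : HasDerivAt (fun s : ℝ => s ^ 2 + ε ^ 2) (2 * s) s := by
    simpa using (hasDerivAt_pow 2 s).add_const (ε ^ 2)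
  have h2 := (h.sqrt (by positivity)).sub_const ε
  rw [show deriv (smoothAbs ε) s = _ from h2.deriv, mul_div_mul_left _ _ two_ne_zero]

lemma abs_deriv_smoothAbs_le {ε : ℝ} (hε : 0 < ε) (s : ℝ) : |deriv (smoothAbs ε) s| ≤ 1 := by
  rw [deriv_smoothAbs hε, abs_div, abs_of_nonneg (Real.sqrt_nonneg _)]
  refine div_le_one_of_le₀ (Real.abs_le_sqrt ?_) (Real.sqrt_nonneg _)
  nlinarith [sq_nonneg ε]

lemma smoothAbs_zero {ε : ℝ} (hε : 0 < ε) : smoothAbs ε 0 = 0 := by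
  simp [smoothAbs, Real.sqrt_sq hε.le]

lemma abs_smoothAbs_sub_le {ε : ℝ} (hε : 0 < ε) (s : ℝ) : |smoothAbs ε s - (|s|)| ≤ ε := by
  have h1 : |s| ≤ √(s ^ 2 + ε ^ 2) := Real.abs_le_sqrt (by nlinarith [sq_nonneg ε])
  have h2 : √(s ^ 2 + ε ^ 2) ≤ |s| + ε := by
    rw [Real.sqrt_le_left (by positivity)]
    nlinarith [sq_abs s, abs_nonneg s]
  rw [smoothAbs, abs_le]
  constructor <;> linarith

/-- The limit holds also at `s = 0`, where both sides are zero. So the gradient of `|w|` comes out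
as the sign of `w` times that of `w` with no separate study of the zero set. -/
lemma tendsto_deriv_smoothAbs (s : ℝ) :
    Tendsto (fun n : ℕ => deriv (smoothAbs (1 / ((n : ℝ) + 1))) s) atTop (𝓝 (SignType.sign s)) := by
  have h0 := tendsto_one_div_add_atTop_nhds_zero_nat (𝕜 := ℝ)
  simp only [fun n : ℕ => deriv_smoothAbs (ε := 1 / ((n : ℝ) + 1)) (by positivity) s]
  rcases eq_or_ne s 0 with rfl | hs
  · simp
  have h1 : Tendsto (fun n : ℕ => √(s ^ 2 + (1 / ((n : ℝ) + 1)) ^ 2)) atTop (𝓝 |s|) := by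
    have := ((h0.pow 2).const_add (s ^ 2)).sqrt
    simpa [Real.sqrt_sq_eq_abs] using this
  have h2 := (tendsto_const_nhds (x := s)).div h1 (abs_pos.2 hs).ne'
  have h3 : (SignType.sign s : ℝ) = s / |s| := by
    rw [eq_div_iff (abs_pos.2 hs).ne', sign_mul_abs]
  rwa [h3]

lemma tendsto_eLpNorm_smoothAbs_sub {α : Type*} [MeasurableSpace α] {μ : Measure α}
    [IsFiniteMeasure μ] (u : α → ℝ) :
    Tendsto (fun n : ℕ => eLpNorm (fun x => smoothAbs (1 / ((n : ℝ) + 1)) (u x) - |u x|) 2 μ)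
      atTop (𝓝 0) := by
  have h0 : Tendsto (fun n : ℕ => μ Set.univ ^ ((2 : ℝ≥0∞).toReal)⁻¹ *
      ENNReal.ofReal (1 / ((n : ℝ) + 1))) atTop (𝓝 0) := by
    have := ENNReal.Tendsto.const_mul
      (ENNReal.tendsto_ofReal (tendsto_one_div_add_atTop_nhds_zero_nat (𝕜 := ℝ)))
      (Or.inr (ENNReal.rpow_ne_top_of_nonneg (y := ((2 : ℝ≥0∞).toReal)⁻¹) (by simp)
        (measure_ne_top μ Set.univ)))
    simpa using this
  refine tendsto_of_tendsto_of_tendsto_of_le_of_le tendsto_const_nhds h0 (fun _ => zero_le)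
    fun n => eLpNorm_le_of_ae_bound (ae_of_all _ fun x => ?_)
  exact abs_smoothAbs_sub_le (by positivity) _

lemma abs_sign_le_one (s : ℝ) : |(SignType.sign s : ℝ)| ≤ 1 := by
  rcases lt_trichotomy s 0 with h | rfl | h <;> simp [*]

/-- The absolute value of an element of `V` is in `V`, and its energy is not larger. -/
lemma exists_abs_mem_V {A Γ : Set Plane} (hA : IsOpen A) (hb : Bornology.IsBounded A)
    (hlip : HasLipschitzBoundary A) {w : Triple A} (hw : w ∈ V A Γ) :
    ∃ z ∈ V A Γ, z.1 =ᵐ[volume.restrict A] (fun x => |w.1 x|) ∧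
      z.2.2 =ᵐ[bdryMeasure A] (fun x => |w.2.2 x|) ∧ ‖z.2.1‖ ≤ ‖w.2.1‖ := by
  have := isFiniteMeasure_bdryMeasure hA hb hlip
  have : IsFiniteMeasure (volume.restrict A) :=
    ⟨by rw [Measure.restrict_apply_univ]; exact hb.measure_lt_top⟩
  let ε : ℕ → ℝ := fun n => 1 / ((n : ℝ) + 1)
  have hε : ∀ n, 0 < ε n := fun n => by positivity
  choose y hy y1 y2 y3 using fun n => exists_comp_mem_H1 hA hb hlip (contDiff_smoothAbs (hε n))
    (abs_deriv_smoothAbs_le (hε n)) (smoothAbs_zero (hε n)) hw.1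
  have hU : MemLp (fun x => |w.1 x|) 2 (volume.restrict A) := (Lp.memLp w.1).norm
  have hT : MemLp (fun x => |w.2.2 x|) 2 (bdryMeasure A) := (Lp.memLp w.2.2).norm
  have hms : Measurable fun s : ℝ => (SignType.sign s : ℝ) := by
    have : (fun s : ℝ => (SignType.sign s : ℝ)) = fun s => s / |s| := by
      ext s
      rcases lt_trichotomy s 0 with h | rfl | h
      · simp [h, abs_of_neg h, div_neg, div_self h.ne]
      · simp
      · simp [h, abs_of_pos h, div_self h.ne']
    rw [this]
    exact measurable_id.div measurable_id.abs
  have hmU : AEStronglyMeasurable (fun x => (SignType.sign (w.1 x) : ℝ)) (volume.restrict A) :=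
    (hms.comp_aemeasurable (Lp.aestronglyMeasurable w.1).aemeasurable).aestronglyMeasurable
  have hGle : ∀ x, ‖(SignType.sign (w.1 x) : ℝ) • w.2.1 x‖ ≤ ‖w.2.1 x‖ := fun x => by
    rw [norm_smul]
    exact mul_le_of_le_one_left (norm_nonneg _) (abs_sign_le_one _)
  have hG : MemLp (fun x => (SignType.sign (w.1 x) : ℝ) • w.2.1 x) 2 (volume.restrict A) :=
    (Lp.memLp w.2.1).mono (hmU.smul (Lp.aestronglyMeasurable _)) (ae_of_all _ hGle)
  have hlim : Tendsto y atTop (𝓝 (hU.toLp, hG.toLp, hT.toLp)) := by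
    refine Tendsto.prodMk_nhds ?_ (Tendsto.prodMk_nhds ?_ ?_)
    · rw [Lp.tendsto_Lp_iff_tendsto_eLpNorm']
      refine (tendsto_eLpNorm_smoothAbs_sub w.1).congr fun n => eLpNorm_congr_ae ?_
      filter_upwards [y1 n, hU.coeFn_toLp] with x e1 e2
      rw [Pi.sub_apply, e1, e2]
    · rw [Lp.tendsto_Lp_iff_tendsto_eLpNorm']
      have t := tendsto_eLpNorm_smul_zero (μ := volume.restrict A)
        (a := fun n x => deriv (smoothAbs (ε n)) (w.1 x) - SignType.sign (w.1 x))
        (Lp.memLp w.2.1) (fun n => (((contDiff_smoothAbs (hε n)).continuous_deriv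
          (by simp)).comp_aestronglyMeasurable (Lp.aestronglyMeasurable w.1)).sub hmU)
        (fun n x => (abs_sub _ _).trans (by
          linarith [abs_deriv_smoothAbs_le (hε n) (w.1 x), abs_sign_le_one (w.1 x)]))
        (ae_of_all _ fun x => by
          have := (tendsto_deriv_smoothAbs (w.1 x)).sub_const (SignType.sign (w.1 x) : ℝ)
          rwa [sub_self] at this)
      refine t.congr fun n => eLpNorm_congr_ae ?_
      filter_upwards [y2 n, hG.coeFn_toLp] with x e1 e2
      rw [Pi.sub_apply, e1, e2, sub_smul]
    · rw [Lp.tendsto_Lp_iff_tendsto_eLpNorm']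
      refine (tendsto_eLpNorm_smoothAbs_sub w.2.2).congr fun n => eLpNorm_congr_ae ?_
      filter_upwards [y3 n, hT.coeFn_toLp] with x e1 e2
      rw [Pi.sub_apply, e1, e2]
  refine ⟨(hU.toLp, hG.toLp, hT.toLp),
    ⟨(isClosed_H1 A).mem_of_tendsto hlim (Eventually.of_forall hy), ?_⟩, hU.coeFn_toLp,
    hT.coeFn_toLp, ?_⟩
  · filter_upwards [hw.2, hT.coeFn_toLp] with x h1 h2 hx
    rw [h2, h1 hx, abs_zero]
  · refine Lp.norm_le_norm_of_ae_le ?_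
    filter_upwards [hG.coeFn_toLp] with x hx
    rw [hx]
    exact hGle x

/-! ### Radial functions and mollifiers. -/

/-- The standard basis of the plane. -/
def stdBasis (i : Fin 2) : Plane := EuclideanSpace.single i 1

lemma fderiv_fderiv_apply {φ : Plane → ℝ} (hφ : ContDiff ℝ ∞ φ) (x e : Plane) :
    fderiv ℝ (fun y => fderiv ℝ φ y e) x e = fderiv ℝ (fderiv ℝ φ) x e e := by
  have h : DifferentiableAt ℝ (fderiv ℝ φ) x :=
    (hφ.fderiv_right (m := ∞) (by simp)).differentiable (by simp) x
  rw [fderiv_clm_apply h (differentiableAt_const e)]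
  simp

lemma laplacian_eq {φ : Plane → ℝ} (hφ : ContDiff ℝ ∞ φ) (x : Plane) :
    Laplacian.laplacian φ x =
      ∑ i, fderiv ℝ (fun y => fderiv ℝ φ y (stdBasis i)) x (stdBasis i) := by
  rw [InnerProductSpace.laplacian_eq_iteratedFDeriv_orthonormalBasis φ
    (EuclideanSpace.basisFun (Fin 2) ℝ)]
  refine Finset.sum_congr rfl fun i _ => ?_
  rw [iteratedFDeriv_two_apply, fderiv_fderiv_apply hφ]
  simp [stdBasis]

lemma contDiff_fderiv_apply {φ : Plane → ℝ} (hφ : ContDiff ℝ ∞ φ) (e : Plane) :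
    ContDiff ℝ ∞ fun y => fderiv ℝ φ y e :=
  (hφ.fderiv_right (m := ∞) (by simp)).clm_apply contDiff_const

lemma contDiff_laplacian {φ : Plane → ℝ} (hφ : ContDiff ℝ ∞ φ) :
    ContDiff ℝ ∞ (Laplacian.laplacian φ) := by
  rw [funext (laplacian_eq hφ)]
  exact ContDiff.sum fun i _ => contDiff_fderiv_apply (contDiff_fderiv_apply hφ _) _

lemma contDiff_radial {Θ : ℝ → ℝ} (hΘ : ContDiff ℝ ∞ Θ) (c : Plane) :
    ContDiff ℝ ∞ fun y : Plane => Θ (‖y - c‖ ^ 2) :=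
  hΘ.comp ((contDiff_id.sub contDiff_const).norm_sq ℝ)

lemma hasFDerivAt_normSq_sub (c y : Plane) :
    HasFDerivAt (fun y : Plane => ‖y - c‖ ^ 2) (2 • innerSL ℝ (y - c)) y := by
  simpa using (((hasFDerivAt_id y).sub_const c).norm_sq)

lemma fderiv_radial {Θ : ℝ → ℝ} (hΘ : ContDiff ℝ ∞ Θ) (c y e : Plane) :
    fderiv ℝ (fun y : Plane => Θ (‖y - c‖ ^ 2)) y e =
      deriv Θ (‖y - c‖ ^ 2) * (2 * inner ℝ (y - c) e) := by
  have h1 : HasDerivAt Θ (deriv Θ (‖y - c‖ ^ 2)) (‖y - c‖ ^ 2) :=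
    (hΘ.differentiable (by simp) _).hasDerivAt
  have h2 : HasFDerivAt (fun y : Plane => Θ (‖y - c‖ ^ 2)) _ y :=
    h1.comp_hasFDerivAt y (hasFDerivAt_normSq_sub c y)
  rw [h2.fderiv]
  simp [inner_sub_left]

/-- With `s = ‖y - c‖ ^ 2`, the right side is `4 * (s * Θ')'`. This divergence form, special to
dimension two, lets a prescribed radial Laplacian be solved by integration. -/
lemma laplacian_radial {Θ : ℝ → ℝ} (hΘ : ContDiff ℝ ∞ Θ) (c y : Plane) :
    Laplacian.laplacian (fun y : Plane => Θ (‖y - c‖ ^ 2)) y =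
      4 * (deriv Θ (‖y - c‖ ^ 2) + ‖y - c‖ ^ 2 * deriv (deriv Θ) (‖y - c‖ ^ 2)) := by
  have hΘ' : ContDiff ℝ ∞ (deriv Θ) := by
    have := hΘ.iterate_deriv 1
    simpa using this
  rw [laplacian_eq (contDiff_radial hΘ c)]
  have h : ∀ e : Plane, fderiv ℝ (fun y => fderiv ℝ (fun y : Plane => Θ (‖y - c‖ ^ 2)) y e) y e =
      deriv (deriv Θ) (‖y - c‖ ^ 2) * (2 * inner ℝ (y - c) e) * (2 * inner ℝ (y - c) e) +
        deriv Θ (‖y - c‖ ^ 2) * (2 * ‖e‖ ^ 2) := by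
    intro e
    simp only [fderiv_radial hΘ]
    have h1 : DifferentiableAt ℝ (fun y : Plane => deriv Θ (‖y - c‖ ^ 2)) y :=
      (contDiff_radial hΘ' c).differentiable (by simp) y
    have h2 : HasFDerivAt (fun y : Plane => 2 * inner ℝ (y - c) e)
        ((2 : ℝ) • (innerSL ℝ e)) y := by
      have h3 : HasFDerivAt (fun y : Plane => innerSL ℝ e (y - c)) (innerSL ℝ e) y :=
        (innerSL ℝ e).hasFDerivAt.comp y ((hasFDerivAt_id y).sub_const c)
      have h4 : (fun y : Plane => 2 * inner ℝ (y - c) e) = fun y => 2 * innerSL ℝ e (y - c) := by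
        ext y
        rw [innerSL_apply_apply, real_inner_comm]
      rw [h4]
      exact h3.const_mul 2
    rw [fderiv_fun_mul h1 h2.differentiableAt, h2.fderiv]
    simp [fderiv_radial hΘ']
    ring
  simp only [h, Fin.sum_univ_two]
  have hn : ‖y - c‖ ^ 2 = (y - c) 0 ^ 2 + (y - c) 1 ^ 2 := by
    rw [EuclideanSpace.norm_sq_eq]; simp
  have e0 : inner ℝ (y - c) (stdBasis 0) = (y - c) 0 := by simp [stdBasis, EuclideanSpace.inner_single_right]
  have e1 : inner ℝ (y - c) (stdBasis 1) = (y - c) 1 := by simp [stdBasis, EuclideanSpace.inner_single_right]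
  have n0 : ‖stdBasis 0‖ = 1 := by simp [stdBasis]
  have n1 : ‖stdBasis 1‖ = 1 := by simp [stdBasis]
  rw [e0, e1, n0, n1]
  generalize deriv (deriv Θ) (‖y - c‖ ^ 2) = d2
  generalize deriv Θ (‖y - c‖ ^ 2) = d1
  rw [hn]
  ring

/-- A smooth cutoff, equal to `1` on `(-∞, 1]` and to `0` on `[2, ∞)`. -/
def cutoff (s : ℝ) : ℝ := Real.smoothTransition (2 - s)

lemma contDiff_cutoff : ContDiff ℝ ∞ cutoff :=
  Real.smoothTransition.contDiff.comp (contDiff_const.sub contDiff_id)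

lemma cutoff_of_le {s : ℝ} (h : s ≤ 1) : cutoff s = 1 :=
  Real.smoothTransition.one_of_one_le (by linarith)

lemma cutoff_of_ge {s : ℝ} (h : 2 ≤ s) : cutoff s = 0 :=
  Real.smoothTransition.zero_of_nonpos (by linarith)

lemma cutoff_nonneg (s : ℝ) : 0 ≤ cutoff s := Real.smoothTransition.nonneg _

lemma antitone_cutoff : Antitone cutoff := fun _ _ h =>
  Real.smoothTransition.monotone (by linarith)

lemma hasDerivAt_cutoff (s : ℝ) : HasDerivAt cutoff (deriv cutoff s) s :=
  (contDiff_cutoff.differentiable (by simp) s).hasDerivAt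

/-- The radial profile of the mollifier. -/
def profile (s : ℝ) : ℝ := cutoff s + (s - 2) * deriv cutoff s

/-- The radial potential generating the mollifier. -/
def potential (s : ℝ) : ℝ := cutoff s + 2 * (1 - cutoff s) / s

lemma contDiff_deriv {f : ℝ → ℝ} (hf : ContDiff ℝ ∞ f) : ContDiff ℝ ∞ (deriv f) := by
  have := hf.iterate_deriv 1
  simpa using this

lemma contDiff_profile : ContDiff ℝ ∞ profile :=
  contDiff_cutoff.add ((contDiff_id.sub contDiff_const).mul (contDiff_deriv contDiff_cutoff))

/-- The cutoff decreases, so `(s - 2) * deriv cutoff s` is nonnegative up to `2`, after which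
everything vanishes. -/
lemma profile_nonneg (s : ℝ) : 0 ≤ profile s := by
  have hd : deriv cutoff s ≤ 0 := antitone_cutoff.deriv_nonpos
  rcases le_total s 2 with h | h
  · exact add_nonneg (cutoff_nonneg s) (mul_nonneg_of_nonpos_of_nonpos (by linarith) hd)
  · have h0 : 0 ≤ cutoff s := cutoff_nonneg s
    rcases eq_or_lt_of_le h with rfl | h
    · simpa [profile] using h0
    have : deriv cutoff s = 0 := by
      have he : cutoff =ᶠ[𝓝 s] fun _ => 0 := by
        filter_upwards [lt_mem_nhds h] with t ht using cutoff_of_ge ht.le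
      rw [he.deriv_eq, deriv_const]
    rw [profile, this]
    simpa using h0

lemma profile_of_lt {s : ℝ} (h : s < 1) : profile s = 1 := by
  have he : cutoff =ᶠ[𝓝 s] fun _ => 1 := by
    filter_upwards [gt_mem_nhds h] with t ht using cutoff_of_le ht.le
  rw [profile, he.deriv_eq, deriv_const, cutoff_of_le h.le]
  simp

lemma profile_of_ge {s : ℝ} (h : 2 ≤ s) : profile s = 0 := by
  rcases eq_or_lt_of_le h with rfl | h'
  · simp [profile, cutoff_of_ge]
  have he : cutoff =ᶠ[𝓝 s] fun _ => 0 := by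
    filter_upwards [lt_mem_nhds h'] with t ht using cutoff_of_ge ht.le
  rw [profile, he.deriv_eq, deriv_const, cutoff_of_ge h]
  simp

lemma contDiff_potential : ContDiff ℝ ∞ potential := by
  rw [contDiff_iff_contDiffAt]
  intro s
  rcases lt_or_ge s 1 with h | h
  · have he : potential =ᶠ[𝓝 s] fun _ => 1 := by
      filter_upwards [gt_mem_nhds h] with t ht
      rw [potential, cutoff_of_le ht.le]
      simp
    exact contDiffAt_const.congr_of_eventuallyEq he
  · exact contDiff_cutoff.contDiffAt.add ((contDiffAt_const.mul
      (contDiffAt_const.sub contDiff_cutoff.contDiffAt)).div contDiffAt_id (by simp; linarith))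

/-- This expression equals `s` near zero and the constant `2` beyond `2`. Its derivative is
`profile`, which is why the latter has bounded support on the half-line `s ≥ 0`. -/
lemma mul_potential (s : ℝ) : s * potential s = s * cutoff s + 2 * (1 - cutoff s) := by
  rcases eq_or_ne s 0 with rfl | hs
  · simp [cutoff_of_le]
  · rw [potential]; field_simp

lemma potential_of_ge {s : ℝ} (h : 2 ≤ s) : potential s = 2 / s := by
  rw [potential, cutoff_of_ge h]; simp

lemma profile_eq (s : ℝ) : potential s + s * deriv potential s = profile s := by
  have h1 : HasDerivAt (fun s => s * potential s) (1 * potential s + s * deriv potential s) s :=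
    (hasDerivAt_id s).mul (contDiff_potential.differentiable (by simp) s).hasDerivAt
  have h2 : HasDerivAt (fun s => s * cutoff s + 2 * (1 - cutoff s))
      ((1 * cutoff s + s * deriv cutoff s) + 2 * (0 - deriv cutoff s)) s :=
    ((hasDerivAt_id s).mul (hasDerivAt_cutoff s)).add
      (((hasDerivAt_const s 1).sub (hasDerivAt_cutoff s)).const_mul 2)
  rw [funext mul_potential] at h1
  have := h1.unique h2
  rw [profile]
  linarith

/-- Rescaled radial mollifiers. -/
def kernel (a : ℝ) (y : Plane) : ℝ := a * profile (a * ‖y‖ ^ 2)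

/-- The difference of two mollifiers is the Laplacian of a test function. -/
lemma exists_laplacian_eq_kernel_sub {a b ρ : ℝ} (ha : 0 < a) (hab : a ≤ b) (hρ : 2 / a = ρ ^ 2)
    (hρ0 : 0 < ρ) (c : Plane) : ∃ ψ : Plane → ℝ, ContDiff ℝ ∞ ψ ∧ HasCompactSupport ψ ∧
      tsupport ψ ⊆ Metric.closedBall c ρ ∧
      ∀ y, Laplacian.laplacian ψ y = kernel a (y - c) - kernel b (y - c) := by
  have hb : 0 < b := ha.trans_le hab
  -- `W` is to be the derivative of the radial profile `Θ` of the test function: `4 * (s * W)'` is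
  -- the difference of the two kernels.
  let W : ℝ → ℝ := fun s => (a * potential (a * s) - b * potential (b * s)) / 4
  have hp : ∀ r : ℝ, ContDiff ℝ ∞ fun s => r * potential (r * s) := fun r =>
    contDiff_const.mul (contDiff_potential.comp (contDiff_const.mul contDiff_id))
  have hW : ContDiff ℝ ∞ W := ((hp a).sub (hp b)).div_const 4
  let Θ : ℝ → ℝ := fun s => ∫ t in (ρ ^ 2)..s, W t
  have hΘd : ∀ s, HasDerivAt Θ (W s) s := fun s =>
    intervalIntegral.integral_hasDerivAt_right (hW.continuous.intervalIntegrable _ _)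
      (hW.continuous.stronglyMeasurableAtFilter _ _) hW.continuous.continuousAt
  have hdΘ : deriv Θ = W := funext fun s => (hΘd s).deriv
  have hΘ : ContDiff ℝ ∞ Θ := by
    rw [contDiff_infty_iff_deriv, hdΘ]
    exact ⟨fun s => (hΘd s).differentiableAt, hW⟩
  -- Past `2 / a` both rescaled potentials equal `2 / s` and cancel. As `Θ` is integrated from `ρ ^
  -- 2`, it vanishes there too.
  have hW0 : ∀ s, ρ ^ 2 ≤ s → W s = 0 := by
    intro s hs
    rw [← hρ, div_le_iff₀ ha] at hs
    have hs0 : 0 < s := by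
      by_contra! h
      nlinarith
    have h1 : 2 ≤ a * s := by linarith
    have h2 : 2 ≤ b * s := h1.trans (mul_le_mul_of_nonneg_right hab hs0.le)
    simp only [W]
    rw [potential_of_ge h1, potential_of_ge h2]
    field_simp
    simp
  have hΘ0 : ∀ s, ρ ^ 2 ≤ s → Θ s = 0 := by
    intro s hs
    refine intervalIntegral.integral_zero_ae (ae_of_all _ fun t ht => ?_)
    rw [Set.uIoc_of_le hs] at ht
    exact hW0 t ht.1.le
  have hsupp : tsupport (fun y : Plane => Θ (‖y - c‖ ^ 2)) ⊆ Metric.closedBall c ρ := by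
    refine closure_minimal (fun y hy => ?_) Metric.isClosed_closedBall
    by_contra h
    rw [Metric.mem_closedBall, dist_eq_norm, not_le] at h
    exact hy (hΘ0 _ (pow_le_pow_left₀ hρ0.le h.le 2))
  refine ⟨_, contDiff_radial hΘ c, (isCompact_closedBall c ρ).of_isClosed_subset
    (isClosed_tsupport _) hsupp, hsupp, fun y => ?_⟩
  rw [laplacian_radial hΘ, hdΘ]
  simp only [kernel]
  generalize ‖y - c‖ ^ 2 = s
  have hd : ∀ r : ℝ, HasDerivAt (fun s => r * potential (r * s))
      (r * (deriv potential (r * s) * (r * 1))) s := fun r =>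
    (((contDiff_potential.differentiable (by simp) (r * s)).hasDerivAt).comp s
      ((hasDerivAt_id s).const_mul r)).const_mul r
  have hdW : deriv W s = _ := (((hd a).sub (hd b)).div_const 4).deriv
  rw [hdW, ← profile_eq, ← profile_eq]
  simp only [W]
  ring

lemma contDiff_kernel (a : ℝ) : ContDiff ℝ ∞ (kernel a) :=
  contDiff_const.mul (contDiff_profile.comp (contDiff_const.mul (contDiff_id.norm_sq ℝ)))

lemma kernel_neg (a : ℝ) (y : Plane) : kernel a (-y) = kernel a y := by
  rw [kernel, kernel, norm_neg]

lemma kernel_nonneg {a : ℝ} (ha : 0 ≤ a) (y : Plane) : 0 ≤ kernel a y :=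
  mul_nonneg ha (profile_nonneg _)

lemma kernel_eq_zero {a : ℝ} (ha : 0 < a) {y : Plane} (hy : √(2 / a) ≤ ‖y‖) : kernel a y = 0 := by
  rw [Real.sqrt_le_left (norm_nonneg _), div_le_iff₀ ha, mul_comm] at hy
  rw [kernel, profile_of_ge hy, mul_zero]

lemma kernel_pos {a : ℝ} (ha : 0 < a) {y : Plane} (hy : a * ‖y‖ ^ 2 < 1) : 0 < kernel a y := by
  rw [kernel, profile_of_lt hy, mul_one]
  exact ha

lemma hasCompactSupport_kernel {a : ℝ} (ha : 0 < a) : HasCompactSupport (kernel a) :=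
  HasCompactSupport.intro (isCompact_closedBall 0 (√(2 / a))) fun y hy => by
    rw [mem_closedBall_zero_iff, not_le] at hy
    exact kernel_eq_zero ha hy.le

lemma integral_kernel {a : ℝ} (ha : 0 < a) : ∫ y, kernel a y = ∫ y, kernel 1 y := by
  have h := Measure.integral_comp_smul (volume : Measure Plane) (kernel 1) (√a)
  have e : ∀ y : Plane, a * kernel 1 (√a • y) = kernel a y := by
    intro y
    rw [kernel, kernel, norm_smul, mul_pow, Real.norm_of_nonneg (Real.sqrt_nonneg _),
      Real.sq_sqrt ha.le, one_mul, one_mul]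
  simp only [← e, integral_const_mul]
  rw [h, finrank_euclideanSpace_fin, Real.sq_sqrt ha.le, abs_of_pos (inv_pos.2 ha), smul_eq_mul,
    mul_inv_cancel_left₀ ha.ne']

/-- The total mass of the mollifiers. -/
def kernelMass : ℝ := ∫ y, kernel 1 y

lemma kernelMass_pos : 0 < kernelMass := by
  refine (contDiff_kernel 1).continuous.integral_pos_of_hasCompactSupport_nonneg_nonzero
    (x := 0) (hasCompactSupport_kernel one_pos) (fun y => kernel_nonneg zero_le_one y) ?_
  exact (kernel_pos one_pos (by simp)).ne'

/-- Mollification of `f`. -/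
def mollify (f : Plane → ℝ) (a : ℝ) (c : Plane) : ℝ := ∫ y, f y * kernel a (y - c)

lemma contDiff_mollify {f : Plane → ℝ} (hf : Integrable f) {a : ℝ} (ha : 0 < a) :
    ContDiff ℝ ∞ (mollify f a) := by
  have h := (hasCompactSupport_kernel ha).contDiff_convolution_right
    (ContinuousLinearMap.mul ℝ ℝ) (μ := volume) hf.locallyIntegrable (contDiff_kernel a)
  convert h using 1
  ext c
  rw [mollify, convolution_def]
  refine integral_congr_ae (ae_of_all _ fun y => ?_)
  simp only [ContinuousLinearMap.mul_apply']
  rw [← kernel_neg, neg_sub]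

lemma integrable_mul_kernel {f : Plane → ℝ} (hf : Integrable f) {a : ℝ} (ha : 0 < a) (c : Plane) :
    Integrable fun y => f y * kernel a (y - c) := by
  have hc : Continuous fun y => kernel a (y - c) :=
    (contDiff_kernel a).continuous.comp (continuous_id.sub continuous_const)
  obtain ⟨C, hC⟩ := (hasCompactSupport_kernel ha).exists_bound_of_continuous
    (contDiff_kernel a).continuous
  exact hf.mul_bdd hc.aestronglyMeasurable (ae_of_all _ fun y => hC _)

/-! ### Weyl's lemma and the strong minimum principle. -/

/-- `f` is harmonic in `A` in the sense of distributions. -/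
def WeaklyHarmonic (A : Set Plane) (f : Plane → ℝ) : Prop :=
  ∀ ψ : Plane → ℝ, ContDiff ℝ ∞ ψ → HasCompactSupport ψ → tsupport ψ ⊆ A →
    ∫ y, f y * Laplacian.laplacian ψ y = 0

/-- The mollifier with parameter `a` centred at `c` is supported in `A`. -/
def Admissible (A : Set Plane) (a : ℝ) (c : Plane) : Prop :=
  0 < a ∧ Metric.closedBall c √(2 / a) ⊆ A

/-- A smooth form of the mean value property: the difference of the two kernels is the Laplacian of
a test function supported in `A`. -/
lemma WeaklyHarmonic.mollify_eq {A : Set Plane} {f : Plane → ℝ} (hf : Integrable f)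
    (hw : WeaklyHarmonic A f) {a b : ℝ} {c : Plane} (ha : Admissible A a c)
    (hb : Admissible A b c) : mollify f a c = mollify f b c := by
  wlog hab : a ≤ b generalizing a b
  · exact (this hb ha (le_of_not_ge hab)).symm
  have h2a : 0 < 2 / a := div_pos two_pos ha.1
  obtain ⟨ψ, hψ, hψc, hψs, hΔ⟩ := exists_laplacian_eq_kernel_sub ha.1 hab
    (Real.sq_sqrt h2a.le).symm (Real.sqrt_pos.2 h2a) c
  have h := hw ψ hψ hψc (hψs.trans ha.2)
  simp only [hΔ, mul_sub] at h
  rw [integral_sub (integrable_mul_kernel hf ha.1 c) (integrable_mul_kernel hf hb.1 c),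
    sub_eq_zero] at h
  exact h

lemma exists_profile_bound : ∃ C, 0 ≤ C ∧ ∀ s, 0 ≤ s → profile s ≤ C := by
  obtain ⟨C, hC⟩ := (isCompact_Icc (a := (0 : ℝ)) (b := 2)).exists_bound_of_continuousOn
    contDiff_profile.continuous.continuousOn
  refine ⟨C, (norm_nonneg _).trans (hC 0 (by simp)), fun s hs => ?_⟩
  rcases le_total s 2 with h | h
  · exact (le_abs_self _).trans (hC s ⟨hs, h⟩)
  · rw [profile_of_ge h]
    exact (norm_nonneg _).trans (hC 0 (by simp))

/-- The kernel is at most `a * C` and lives on a disc of area `2 / a` times that of the unit disc;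
the product of these is the constant. -/
lemma abs_mollify_sub_le {f : Plane → ℝ} (hf : Integrable f) {C : ℝ}
    (hC : ∀ s, 0 ≤ s → profile s ≤ C) {a : ℝ} (ha : 0 < a) (x : Plane) :
    |mollify f a x - kernelMass * f x| ≤ 2 * C * volume.real (Metric.ball (0 : Plane) 1) *
      ⨍ y in Metric.closedBall x √(2 / a), ‖f y - f x‖ := by
  set ρ := √(2 / a)
  have hρ : ρ ^ 2 = 2 / a := Real.sq_sqrt (div_pos two_pos ha).le
  have hρ0 : 0 < ρ := Real.sqrt_pos.2 (div_pos two_pos ha)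
  have hmass : ∫ y, kernel a (y - x) = kernelMass := by
    rw [integral_sub_right_eq_self (kernel a) x, integral_kernel ha, kernelMass]
  have hk : Integrable fun y => kernel a (y - x) :=
    ((contDiff_kernel a).continuous.integrable_of_hasCompactSupport
      (hasCompactSupport_kernel ha)).comp_sub_right x
  have e1 : mollify f a x - kernelMass * f x = ∫ y, (f y - f x) * kernel a (y - x) := by
    simp only [sub_mul]
    rw [integral_sub (integrable_mul_kernel hf ha x) (hk.const_mul _), integral_const_mul, hmass,
      mollify, mul_comm kernelMass]
  have hint : IntegrableOn (fun y => a * C * ‖f y - f x‖) (Metric.closedBall x ρ) :=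
    (((hf.integrableOn.sub (integrableOn_const
      (measure_closedBall_lt_top).ne)).norm).const_mul _)
  have e2 : ‖∫ y, (f y - f x) * kernel a (y - x)‖ ≤
      ∫ y, (Metric.closedBall x ρ).indicator (fun y => a * C * ‖f y - f x‖) y := by
    refine norm_integral_le_of_norm_le
      (hint.integrable_indicator Metric.isClosed_closedBall.measurableSet) (ae_of_all _ fun y => ?_)
    by_cases hy : y ∈ Metric.closedBall x ρ
    · rw [Set.indicator_of_mem hy, norm_mul, mul_comm,
        Real.norm_of_nonneg (kernel_nonneg ha.le _)]
      refine mul_le_mul_of_nonneg_right ?_ (norm_nonneg _)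
      exact mul_le_mul_of_nonneg_left (hC _ (by positivity)) ha.le
    · rw [Set.indicator_of_notMem hy, kernel_eq_zero ha, mul_zero, norm_zero]
      rw [Metric.mem_closedBall, dist_eq_norm, not_le] at hy
      exact hy.le
  have hvol : volume.real (Metric.closedBall x ρ) =
      2 / a * volume.real (Metric.ball (0 : Plane) 1) := by
    rw [Measure.real, Measure.addHaar_closedBall _ x hρ0.le, finrank_euclideanSpace_fin, hρ,
      ENNReal.toReal_mul, ENNReal.toReal_ofReal (div_pos two_pos ha).le, Measure.real]
  have hv0 : volume.real (Metric.closedBall x ρ) ≠ 0 :=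
    (ENNReal.toReal_pos (Metric.measure_closedBall_pos _ _ hρ0).ne'
      measure_closedBall_lt_top.ne).ne'
  rw [e1, ← Real.norm_eq_abs]
  refine e2.trans_eq ?_
  rw [integral_indicator Metric.isClosed_closedBall.measurableSet, integral_const_mul,
    setAverage_eq, smul_eq_mul]
  have hv1 : volume.real (Metric.ball (0 : Plane) 1) ≠ 0 := fun h => hv0 (by rw [hvol, h, mul_zero])
  rw [hvol]
  field_simp

lemma tendsto_sqrt_two_div : Tendsto (fun n : ℕ => √(2 / ((n : ℝ) + 1))) atTop (𝓝 0) := by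
  have h1 := ((tendsto_one_div_add_atTop_nhds_zero_nat (𝕜 := ℝ)).const_mul 2).sqrt
  simp only [mul_one_div, mul_zero, Real.sqrt_zero] at h1
  exact h1

lemma ae_tendsto_mollify {f : Plane → ℝ} (hf : Integrable f) :
    ∀ᵐ x, Tendsto (fun n : ℕ => mollify f (n + 1) x) atTop (𝓝 (kernelMass * f x)) := by
  obtain ⟨C, -, hC⟩ := exists_profile_bound
  have hδ : Tendsto (fun n : ℕ => √(2 / ((n : ℝ) + 1))) atTop (𝓝[>] 0) := by
    refine tendsto_nhdsWithin_iff.2 ⟨?_, Eventually.of_forall fun n =>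
      Real.sqrt_pos.2 (by positivity)⟩
    exact tendsto_sqrt_two_div
  filter_upwards [IsUnifLocDoublingMeasure.ae_tendsto_average_norm_sub volume
    hf.locallyIntegrable 1] with x hx
  have h := hx (fun _ => x) (fun n : ℕ => √(2 / ((n : ℝ) + 1))) hδ
    (Eventually.of_forall fun n => Metric.mem_closedBall_self (by positivity))
  rw [tendsto_iff_dist_tendsto_zero]
  have h' := h.const_mul (2 * C * volume.real (Metric.ball (0 : Plane) 1))
  rw [mul_zero] at h'
  exact squeeze_zero (fun _ => dist_nonneg)
    (fun n => abs_mollify_sub_le hf hC (by positivity) x) h'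

/-- The mollification does not depend on the admissible scale, so it equals its limit as the scale
shrinks. A single null set serves all scales. -/
lemma WeaklyHarmonic.ae_mollify_eq {A : Set Plane} (hA : IsOpen A) {f : Plane → ℝ}
    (hf : Integrable f) (hw : WeaklyHarmonic A f) :
    ∀ᵐ x, ∀ a, Admissible A a x → mollify f a x = kernelMass * f x := by
  filter_upwards [ae_tendsto_mollify hf] with x hx a ha
  refine tendsto_nhds_unique (tendsto_const_nhds.congr' ?_) hx
  have hxA : x ∈ A := ha.2 (Metric.mem_closedBall_self (Real.sqrt_nonneg _))
  obtain ⟨r, hr, hrA⟩ := Metric.isOpen_iff.1 hA x hxA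
  filter_upwards [tendsto_sqrt_two_div.eventually_lt_const hr] with n hn
  exact hw.mollify_eq hf ha ⟨by positivity, (Metric.closedBall_subset_ball hn).trans hrA⟩

lemma laplacian_eq_zero_of_notMem_tsupport {ψ : Plane → ℝ} {x : Plane} (hx : x ∉ tsupport ψ) :
    Laplacian.laplacian ψ x = 0 := by
  have h : ψ =ᶠ[𝓝 x] fun _ => 0 := notMem_tsupport_iff_eventuallyEq.1 hx
  rw [(InnerProductSpace.laplacian_congr_nhds h).eq_of_nhds]
  simp

lemma integral_mul_laplacian_comm {φ ψ : Plane → ℝ} (hφ : ContDiff ℝ ∞ φ) (hψ : ContDiff ℝ ∞ ψ)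
    (hψc : HasCompactSupport ψ) :
    ∫ x, φ x * Laplacian.laplacian ψ x = ∫ x, ψ x * Laplacian.laplacian φ x := by
  have h : ∀ e : Plane, ∫ x, φ x * fderiv ℝ (fun y => fderiv ℝ ψ y e) x e =
      ∫ x, ψ x * fderiv ℝ (fun y => fderiv ℝ φ y e) x e := by
    intro e
    have h1 := integral_mul_fderiv_of_support (A := Set.univ) hφ (contDiff_fderiv_apply hψ e)
      (hψc.fderiv_apply ℝ e) (Set.subset_univ _) e
    have h2 := integral_mul_fderiv_of_support (A := Set.univ) (contDiff_fderiv_apply hφ e) hψ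
      hψc (Set.subset_univ _) e
    simp only [Measure.restrict_univ] at h1 h2
    rw [h1, neg_eq_iff_eq_neg, ← h2]
    simp only [mul_comm]
  simp only [laplacian_eq hφ, laplacian_eq hψ, Finset.mul_sum]
  rw [integral_finsetSum, integral_finsetSum]
  · exact Finset.sum_congr rfl fun i _ => h _
  · intro i _
    exact (hψ.continuous.mul (contDiff_fderiv_apply (contDiff_fderiv_apply hφ _)
      _).continuous).integrable_of_hasCompactSupport hψc.mul_right
  · intro i _
    exact (hφ.continuous.mul (contDiff_fderiv_apply (contDiff_fderiv_apply hψ _)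
      _).continuous).integrable_of_hasCompactSupport
        ((hψc.fderiv_apply ℝ _).fderiv_apply ℝ _).mul_left

/-- The parameter `2 / r ^ 2` is the one whose mollifier has support radius `r`. -/
lemma admissible_of_mem_ball {A : Set Plane} {c x : Plane} {r : ℝ} (hr : 0 < r)
    (h : Metric.ball c (2 * r) ⊆ A) (hx : x ∈ Metric.ball c r) : Admissible A (2 / r ^ 2) x := by
  refine ⟨by positivity, ?_⟩
  rw [show 2 / (2 / r ^ 2) = r ^ 2 by field_simp, Real.sqrt_sq hr.le]
  refine Set.Subset.trans (fun y hy => ?_) h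
  rw [Metric.mem_ball] at hx ⊢
  rw [Metric.mem_closedBall] at hy
  linarith [dist_triangle y x c]

/-- Weyl's lemma, together with a form of the strong minimum principle. -/
lemma weyl {A : Set Plane} (hA : IsOpen A) {f : Plane → ℝ} (hf : Integrable f)
    (hw : WeaklyHarmonic A f) : ∃ h : Plane → ℝ, InnerProductSpace.HarmonicOnNhd h A ∧
      (∀ᵐ x, x ∈ A → h x = f x) ∧ ((∀ᵐ x, 0 ≤ f x) → ∀ c ∈ A, 0 ≤ h c ∧
        (h c = 0 → ∃ r > 0, ∀ᵐ x, x ∈ Metric.ball c r → f x = 0)) := by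
  have hrad : ∀ c, ∃ r, c ∈ A → 0 < r ∧ Metric.ball c (2 * r) ⊆ A := by
    intro c
    by_cases hc : c ∈ A
    · obtain ⟨r, hr, hrA⟩ := Metric.isOpen_iff.1 hA c hc
      exact ⟨r / 2, fun _ => ⟨half_pos hr, by rwa [mul_div_cancel₀ _ two_ne_zero]⟩⟩
    · exact ⟨0, fun h => absurd h hc⟩
  choose r hr using hrad
  have hadm : ∀ c ∈ A, ∀ x ∈ Metric.ball c (r c), Admissible A (2 / r c ^ 2) x := fun c hc x hx =>
    admissible_of_mem_ball (hr c hc).1 (hr c hc).2 hx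
  have hadm' : ∀ c ∈ A, Admissible A (2 / r c ^ 2) c := fun c hc =>
    hadm c hc c (Metric.mem_ball_self (hr c hc).1)
  have hI := kernelMass_pos
  have hae : ∀ᵐ x, ∀ a, Admissible A a x → kernelMass⁻¹ * mollify f a x = f x := by
    filter_upwards [hw.ae_mollify_eq hA hf] with x hx a ha
    rw [hx a ha, inv_mul_cancel_left₀ hI.ne']
  -- The scale varies with the point, possibly irregularly. By independence of the scale, this
  -- function agrees near each point with one mollification at a fixed scale, which is smooth.
  refine ⟨fun c => kernelMass⁻¹ * mollify f (2 / r c ^ 2) c, fun c hc => ?_, ?_, ?_⟩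
  · set a := 2 / r c ^ 2
    have ha : 0 < a := (hadm' c hc).1
    set G : Plane → ℝ := fun x => kernelMass⁻¹ * mollify f a x
    have hG : ContDiff ℝ ∞ G := contDiff_const.mul (contDiff_mollify hf ha)
    have hball : Metric.ball c (r c) ∈ 𝓝 c := Metric.ball_mem_nhds c (hr c hc).1
    have hsub : Metric.ball c (r c) ⊆ A := fun x hx =>
      (hadm c hc x hx).2 (Metric.mem_closedBall_self (Real.sqrt_nonneg _))
    have heq : (fun c => kernelMass⁻¹ * mollify f (2 / r c ^ 2) c) =ᶠ[𝓝 c] G := by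
      filter_upwards [hball] with x hx
      simp only [G]
      rw [hw.mollify_eq hf (hadm' x (hsub hx)) (hadm c hc x hx)]
    rw [InnerProductSpace.harmonicAt_congr_nhds heq]
    refine ⟨hG.contDiffAt.of_le (by norm_cast), ?_⟩
    -- `G` equals `f` almost everywhere on the ball, so its Laplacian vanishes against every test
    -- function there. Being continuous, it vanishes identically on the ball.
    have hΔ : ∀ᵐ x, x ∈ Metric.ball c (r c) → Laplacian.laplacian G x = 0 := by
      refine Metric.isOpen_ball.ae_eq_zero_of_integral_contDiff_smul_eq_zero
        ((contDiff_laplacian hG).continuous.locallyIntegrable.locallyIntegrableOn _)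
        fun ψ hψ hψc hψs => ?_
      simp only [smul_eq_mul]
      rw [← integral_mul_laplacian_comm hG hψ hψc, ← hw ψ hψ hψc (hψs.trans hsub)]
      refine integral_congr_ae ?_
      filter_upwards [hae] with x hx
      by_cases hxs : x ∈ tsupport ψ
      · rw [← hx a (hadm c hc x (hψs hxs))]
      · rw [laplacian_eq_zero_of_notMem_tsupport hxs, mul_zero, mul_zero]
    have hΔ' : Set.EqOn (Laplacian.laplacian G) (fun _ => 0) (Metric.ball c (r c)) :=
      Measure.eqOn_open_of_ae_eq ((ae_restrict_iff' Metric.isOpen_ball.measurableSet).2 hΔ)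
        Metric.isOpen_ball (contDiff_laplacian hG).continuous.continuousOn continuousOn_const
    filter_upwards [hball] with x hx using hΔ' hx
  · filter_upwards [hae] with x hx hxA using hx _ (hadm' x hxA)
  · intro hf0 c hc
    have ha : 0 < 2 / r c ^ 2 := (hadm' c hc).1
    have hnn : 0 ≤ᵐ[volume] fun y => f y * kernel (2 / r c ^ 2) (y - c) := by
      filter_upwards [hf0] with y hy using mul_nonneg hy (kernel_nonneg ha.le _)
    refine ⟨mul_nonneg (inv_nonneg.2 hI.le) (integral_nonneg_of_ae hnn), fun h0 => ?_⟩
    have h1 : ∫ y, f y * kernel (2 / r c ^ 2) (y - c) = 0 :=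
      (mul_eq_zero.1 h0).resolve_left (inv_pos.2 hI).ne'
    rw [integral_eq_zero_iff_of_nonneg_ae hnn (integrable_mul_kernel hf ha c)] at h1
    -- On this smaller ball the kernel is positive, since `2 / r ^ 2 * ‖y - c‖ ^ 2 < 1 / 2`. A
    -- vanishing mean of a nonnegative `f` thus forces `f = 0` almost everywhere on it.
    refine ⟨r c / 2, half_pos (hr c hc).1, ?_⟩
    filter_upwards [h1] with y hy hyb
    refine (mul_eq_zero.1 hy).resolve_right (kernel_pos ha ?_).ne'
    rw [Metric.mem_ball, dist_eq_norm] at hyb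
    have hrc := (hr c hc).1
    rw [div_mul_eq_mul_div, div_lt_one (by positivity)]
    nlinarith [norm_nonneg (y - c)]

/-! ### From weak solutions to eigenfunctions. -/

lemma exists_smooth_mem_V {A Γ : Set Plane} (hA : IsOpen A) (hb : Bornology.IsBounded A)
    (hlip : HasLipschitzBoundary A) {ψ : Plane → ℝ} (hψ : ContDiff ℝ ∞ ψ)
    (h0 : ∀ x ∈ frontier A, x ∉ Γ → ψ x = 0) :
    ∃ z ∈ V A Γ, z.2.1 =ᵐ[volume.restrict A] gradient ψ ∧ z.2.2 =ᵐ[bdryMeasure A] ψ := by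
  have h1 := memLp_of_continuous hA hb hψ.continuous
  have h2 := memLp_of_continuous hA hb (continuous_gradient hψ)
  have h3 := memLp_bdry_of_continuous hA hb hlip hψ.continuous
  refine ⟨(h1.toLp, h2.toLp, h3.toLp), ⟨Submodule.le_topologicalClosure _
    (toLp_mem_smoothTriples hψ h1 h2 h3), ?_⟩, h2.coeFn_toLp, h3.coeFn_toLp⟩
  filter_upwards [h3.coeFn_toLp, ae_restrict_mem (s := frontier A)
    isClosed_frontier.measurableSet] with x hx hxA hxΓ
  rw [hx, h0 x hxA hxΓ]

/-- `w` satisfies the weak form of the eigenvalue problem. -/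
def IsWeakSolution {A : Set Plane} (Γ : Set Plane) (lam : ℝ) (w : Triple A) : Prop :=
  ∀ z ∈ V A Γ, inner ℝ w.2.1 z.2.1 = lam * inner ℝ w.2.2 z.2.2

/-- A test function supported in `A` has zero trace, so the eigenvalue drops out of the weak
equation. Applying the weak gradient identity to each partial derivative of `ψ` then moves the
gradient off `w`. -/
lemma IsWeakSolution.weaklyHarmonic {A Γ : Set Plane} (hA : IsOpen A)
    (hb : Bornology.IsBounded A) (hlip : HasLipschitzBoundary A) {lam : ℝ} {w : Triple A}
    (hw : w ∈ V A Γ) (hel : IsWeakSolution Γ lam w) : WeaklyHarmonic A (A.indicator w.1) := by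
  intro ψ hψ hψc hψA
  have h0 : ∀ x ∈ frontier A, ψ x = 0 := fun x hx =>
    image_eq_zero_of_notMem_tsupport fun h => (hA.frontier_eq ▸ hx).2 (hψA h)
  obtain ⟨z, hz, hzg, hzt⟩ := exists_smooth_mem_V (Γ := Γ) hA hb hlip hψ fun x hx _ => h0 x hx
  have hz0 : z.2.2 = 0 := by
    refine Lp.eq_zero_iff_ae_eq_zero.2 ?_
    filter_upwards [hzt, ae_restrict_mem (s := frontier A)
      isClosed_frontier.measurableSet] with x hx hxA
    rw [hx, h0 x hxA, Pi.zero_apply]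
  have key : ∫ x in A, inner ℝ (w.2.1 x) (gradient ψ x) = 0 := by
    have := hel z hz
    rw [hz0, inner_zero_right, mul_zero, L2.inner_def] at this
    rw [← this]
    refine integral_congr_ae ?_
    filter_upwards [hzg] with x hx
    rw [hx]
  have hsum : ∀ x, ∑ i, fderiv ℝ ψ x (stdBasis i) * inner ℝ (w.2.1 x) (stdBasis i) =
      inner ℝ (w.2.1 x) (gradient ψ x) := by
    intro x
    rw [real_inner_comm, inner_gradient]
    have : w.2.1 x = ∑ i, inner ℝ (w.2.1 x) (stdBasis i) • stdBasis i := by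
      ext j
      simp [stdBasis, Fin.sum_univ_two, EuclideanSpace.inner_single_right]
      fin_cases j <;> simp
    conv_rhs => rw [this]
    rw [map_sum]
    refine Finset.sum_congr rfl fun i _ => ?_
    rw [map_smul, smul_eq_mul, mul_comm]
  have hd : ∀ i, ContDiff ℝ ∞ fun y => fderiv ℝ ψ y (stdBasis i) := fun i =>
    contDiff_fderiv_apply hψ _
  have hdd : ∀ i, MemLp (fun x => fderiv ℝ (fun y => fderiv ℝ ψ y (stdBasis i)) x (stdBasis i)) 2
      (volume.restrict A) := fun i =>
    memLp_of_continuous hA hb (contDiff_fderiv_apply (hd i) _).continuous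
  have hts : ∀ i, tsupport (fun y => fderiv ℝ ψ y (stdBasis i)) ⊆ tsupport ψ := fun i =>
    closure_minimal (fun x hx => tsupport_fderiv_subset ℝ (subset_tsupport _ fun h => hx (by
      simp only [h, zero_apply]))) (isClosed_tsupport _)
  have hint : ∀ i, ∫ x in A, w.1 x * fderiv ℝ (fun y => fderiv ℝ ψ y (stdBasis i)) x (stdBasis i) =
      -∫ x in A, fderiv ℝ ψ x (stdBasis i) * inner ℝ (w.2.1 x) (stdBasis i) := fun i =>
    integral_mul_fderiv_of_mem_H1 hA hb hw.1 (hd i) (hψc.of_isClosed_subset (isClosed_tsupport _)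
      (hts i)) ((hts i).trans hψA) _
  have e1 : ∀ y, A.indicator w.1 y * Laplacian.laplacian ψ y =
      A.indicator (fun y => w.1 y * Laplacian.laplacian ψ y) y := fun y => by
    by_cases hy : y ∈ A <;> simp [hy]
  simp_rw [e1]
  rw [integral_indicator hA.measurableSet]
  simp_rw [laplacian_eq hψ, Finset.mul_sum]
  rw [integral_finsetSum]
  · simp_rw [hint]
    rw [Finset.sum_neg_distrib, ← integral_finsetSum]
    · simp_rw [hsum]
      rw [key, neg_zero]
    · intro i _
      exact (memLp_of_continuous hA hb (hd i).continuous).integrable_mul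
        ((Lp.memLp w.2.1).inner_const _)
  · exact fun i _ => (Lp.memLp w.1).integrable_mul (hdd i)

lemma integrable_indicator_of_Lp {A : Set Plane} (hA : IsOpen A) (hb : Bornology.IsBounded A)
    (f : Lp ℝ 2 (volume.restrict A)) : Integrable (A.indicator f) := by
  have : IsFiniteMeasure (volume.restrict A) :=
    ⟨by rw [Measure.restrict_apply_univ]; exact hb.measure_lt_top⟩
  rw [integrable_indicator_iff hA.measurableSet]
  exact (Lp.memLp f).integrable (by norm_num)

lemma grad_eq_zero {A : Set Plane} (hA : IsOpen A) (hb : Bornology.IsBounded A) {w : Triple A}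
    (hw : w ∈ H1 A) (h1 : w.1 = 0) : w.2.1 = 0 := by
  have hloc : LocallyIntegrableOn w.2.1 A volume := by
    have : IsFiniteMeasure (volume.restrict A) :=
      ⟨by rw [Measure.restrict_apply_univ]; exact hb.measure_lt_top⟩
    have : IntegrableOn w.2.1 A volume := (Lp.memLp w.2.1).integrable (by norm_num)
    exact this.locallyIntegrableOn
  have := hA.ae_eq_zero_of_integral_contDiff_smul_eq_zero hloc fun ψ hψ hψc hψA => by
    have := (memH1_of_mem_H1 hA hb hw (Filter.EventuallyEq.refl _ _)).weak_grad ψ hψ hψc hψA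
    have e : ∫ x in A, w.1 x • gradient ψ x = 0 := by
      rw [← integral_zero Plane Plane (μ := volume.restrict A)]
      refine integral_congr_ae ?_
      filter_upwards [Lp.eq_zero_iff_ae_eq_zero.1 h1] with x hx
      rw [hx, Pi.zero_apply, zero_smul]
    rw [e, eq_comm, neg_eq_zero] at this
    rw [← this]
    refine (setIntegral_eq_integral_of_forall_compl_eq_zero fun x hx => ?_).symm
    rw [image_eq_zero_of_notMem_tsupport fun h => hx (hψA h), zero_smul]
  exact Lp.eq_zero_iff_ae_eq_zero.2 ((ae_restrict_iff' hA.measurableSet).2 this)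

/-- Uniqueness of the weak gradient and of the trace: the function determines the triple, so a
nonzero triple yields a nontrivial eigenfunction. -/
lemma eq_zero_of_fst_eq_zero {A : Set Plane} (hA : IsOpen A) (hb : Bornology.IsBounded A)
    (hlip : HasLipschitzBoundary A) {w : Triple A} (hw : w ∈ H1 A) (h1 : w.1 = 0) : w = 0 :=
  Prod.ext h1 <| Prod.ext (grad_eq_zero hA hb hw h1)
    (trace_eq_zero hA hb hlip hw h1 (grad_eq_zero hA hb hw h1))

lemma eq_zero_of_grad_trace_eq_zero {A : Set Plane} (hA : IsOpen A) (hb : Bornology.IsBounded A)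
    (hlip : HasLipschitzBoundary A) {w : Triple A} (hw : w ∈ H1 A) (h2 : w.2.1 = 0)
    (h3 : w.2.2 = 0) : w.1 = 0 := by
  obtain ⟨C, hC⟩ := exists_friedrichs_const hA hb hlip
  have := hC w hw
  rw [h2, h3] at this
  simpa using this

lemma isEigenfunction_of_weak {A Γ : Set Plane} (hA : IsOpen A) (hb : Bornology.IsBounded A)
    (hlip : HasLipschitzBoundary A) (hΓ : Γ ⊆ frontier A)
    (hΓm : NullMeasurableSet Γ (Measure.hausdorffMeasure 1)) {lam : ℝ} {w : Triple A}
    (hw : w ∈ V A Γ) (hw0 : w ≠ 0) (hel : IsWeakSolution Γ lam w) :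
    ∃ u, IsEigenfunction A Γ lam u ∧ w.1 =ᵐ[volume.restrict A] u ∧
      ((0 ≤ᵐ[volume.restrict A] w.1) → ∀ c ∈ A, 0 ≤ u c ∧
        (u c = 0 → ∃ r > 0, ∀ᵐ x, x ∈ Metric.ball c r → A.indicator w.1 x = 0)) := by
  obtain ⟨h, hh, hae, hmin⟩ := weyl hA (integrable_indicator_of_Lp hA hb w.1)
    (hel.weaklyHarmonic hA hb hlip hw)
  have hwh : w.1 =ᵐ[volume.restrict A] h := by
    refine (ae_restrict_iff' hA.measurableSet).2 ?_
    filter_upwards [hae] with x hx hxA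
    rw [hx hxA, Set.indicator_of_mem hxA]
  refine ⟨h, (isEigenfunction_iff hA hb hlip hΓ hΓm).2 ⟨?_, hh, w, hw, hwh, hel⟩, hwh,
    fun h0 => hmin ?_⟩
  · by_contra! hc
    refine hw0 (eq_zero_of_fst_eq_zero hA hb hlip hw.1 (Lp.eq_zero_iff_ae_eq_zero.2 ?_))
    filter_upwards [hwh, ae_restrict_mem hA.measurableSet] with x hx hxA
    rw [hx, hc x hxA, Pi.zero_apply]
  · filter_upwards [(ae_restrict_iff' hA.measurableSet).1 h0] with x hx
    exact Set.indicator_apply_nonneg hx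

lemma continuousOn_of_harmonicOnNhd {A : Set Plane} {u : Plane → ℝ}
    (hu : InnerProductSpace.HarmonicOnNhd u A) : ContinuousOn u A := fun x hx =>
  (hu x hx).1.continuousAt.continuousWithinAt

lemma eq_zero_of_ae_eq_zero {A : Set Plane} (hA : IsOpen A) {u : Plane → ℝ}
    (hu : ContinuousOn u A) (h : u =ᵐ[volume.restrict A] 0) : ∀ x ∈ A, u x = 0 :=
  Measure.eqOn_open_of_ae_eq h hA hu continuousOn_const

/-- The zero set is open by the strong minimum principle and its complement in `A` by continuity. By
connectedness, a zero would make the eigenfunction trivial. -/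
lemma exists_pos_eigenfunction {A Γ : Set Plane} (hA : IsOpen A) (hb : Bornology.IsBounded A)
    (hlip : HasLipschitzBoundary A) (hΓ : Γ ⊆ frontier A)
    (hΓm : NullMeasurableSet Γ (Measure.hausdorffMeasure 1)) (hAc : IsPreconnected A) {lam : ℝ}
    {w : Triple A} (hw : w ∈ V A Γ) (hw0 : w ≠ 0) (hel : IsWeakSolution Γ lam w)
    (hpos : 0 ≤ᵐ[volume.restrict A] w.1) :
    ∃ u, IsEigenfunction A Γ lam u ∧ w.1 =ᵐ[volume.restrict A] u ∧ ∀ x ∈ A, 0 < u x := by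
  obtain ⟨u, hu, hwu, hmin⟩ := isEigenfunction_of_weak hA hb hlip hΓ hΓm hw hw0 hel
  refine ⟨u, hu, hwu, fun x hx => (hmin hpos x hx).1.lt_of_ne fun hx0 => ?_⟩
  have hcont := continuousOn_of_harmonicOnNhd hu.2.1
  obtain ⟨y, hy, hy0⟩ := hu.1
  have ho1 : IsOpen {c | c ∈ A ∧ u c = 0} := by
    rw [Metric.isOpen_iff]
    rintro c ⟨hc, hc0⟩
    obtain ⟨r, hr, hball⟩ := (hmin hpos c hc).2 hc0
    obtain ⟨s, hs, hsA⟩ := Metric.isOpen_iff.1 hA c hc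
    refine ⟨min r s, lt_min hr hs, fun z hz => ?_⟩
    have hzs : Metric.ball c (min r s) ⊆ A := (Metric.ball_subset_ball (min_le_right _ _)).trans hsA
    refine ⟨hzs hz, eq_zero_of_ae_eq_zero Metric.isOpen_ball (hcont.mono hzs) ?_ z hz⟩
    refine (ae_restrict_iff' Metric.isOpen_ball.measurableSet).2 ?_
    filter_upwards [hball, (ae_restrict_iff' hA.measurableSet).1 hwu] with t h1 h2 ht
    have := h1 (Metric.ball_subset_ball (min_le_left _ _) ht)
    rwa [Set.indicator_of_mem (hzs ht), h2 (hzs ht)] at this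
  have ho2 : IsOpen {c | c ∈ A ∧ u c ≠ 0} := hcont.isOpen_inter_preimage hA isOpen_compl_singleton
  obtain ⟨t, -, ⟨-, ht1⟩, -, ht2⟩ := hAc _ _ ho1 ho2
    (fun c hc => (em (u c = 0)).imp (fun h => ⟨hc, h⟩) fun h => ⟨hc, h⟩)
    ⟨x, hx, hx, hx0.symm⟩ ⟨y, hy, hy, hy0⟩
  exact ht2 ht1

/-! ### The infimum as the smallest eigenvalue. -/

/-- A bump function at an interior point of `Γ`, normalized. Its trace is nonzero because the
boundary measure charges every open set that meets the boundary. -/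
lemma exists_mem_V_norm_trace_eq_one {A Γ : Set Plane} (hA : IsOpen A)
    (hb : Bornology.IsBounded A) (hlip : HasLipschitzBoundary A)
    (hΓ : ∃ U : Set Plane, IsOpen U ∧ (U ∩ frontier A).Nonempty ∧ U ∩ frontier A ⊆ Γ) :
    ∃ w ∈ V A Γ, ‖w.2.2‖ = 1 := by
  obtain ⟨U, hU, ⟨x, hxU, hxA⟩, hUΓ⟩ := hΓ
  obtain ⟨ψ, hψU, -, hψ, -, hψx⟩ := exists_contDiff_tsupport_subset (n := ⊤) (hU.mem_nhds hxU)
  obtain ⟨z, hz, -, hzt⟩ := exists_smooth_mem_V (Γ := Γ) hA hb hlip hψ fun y hy hyΓ =>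
    image_eq_zero_of_notMem_tsupport fun h => hyΓ (hUΓ ⟨hψU h, hy⟩)
  have hne : ‖z.2.2‖ ≠ 0 := by
    rw [norm_ne_zero_iff]
    intro h0
    have hpos := bdryMeasure_pos hA hlip (isOpen_compl_singleton.preimage hψ.continuous)
      (U := ψ ⁻¹' {0}ᶜ) ⟨x, by simp [hψx], hxA⟩
    refine hpos.ne' ?_
    have h1 : ψ =ᵐ[bdryMeasure A] 0 := hzt.symm.trans (Lp.eq_zero_iff_ae_eq_zero.1 h0)
    exact ae_iff.1 h1
  exact ⟨‖z.2.2‖⁻¹ • z, Submodule.smul_mem _ _ hz, by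
    rw [Prod.smul_snd, Prod.smul_snd, norm_smul, norm_inv, norm_norm, inv_mul_cancel₀ hne]⟩

lemma exists_ground_state {A Γ : Set Plane} (hA : IsOpen A) (hb : Bornology.IsBounded A)
    (hlip : HasLipschitzBoundary A) (hΓ : Γ ⊆ frontier A)
    (hΓm : NullMeasurableSet Γ (Measure.hausdorffMeasure 1)) (hne : (energies Γ A).Nonempty) :
    (∀ w ∈ V A Γ, ‖w.2.2‖ = 1 → K Γ A ≤ ‖w.2.1‖ ^ 2) ∧
      ∃ w ∈ V A Γ, ‖w.2.2‖ = 1 ∧ ‖w.2.1‖ ^ 2 = K Γ A := by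
  have heq := energies_eq hA hb hlip hΓ hΓm
  have hbdd : BddBelow (energies Γ A) := ⟨0, by
    rw [heq]
    rintro c ⟨w, -, -, rfl⟩
    positivity⟩
  have hk : ∀ w ∈ V A Γ, ‖w.2.2‖ = 1 → K Γ A ≤ ‖w.2.1‖ ^ 2 := fun w hw h1 =>
    csInf_le hbdd (heq ▸ ⟨w, hw, h1, rfl⟩)
  obtain ⟨c, -, hc, hcE⟩ := exists_seq_tendsto_sInf hne hbdd
  rw [heq] at hcE
  choose x hxV hx1 hxc using hcE
  refine ⟨hk, exists_minimizer hA hb hlip hk hxV hx1 ?_⟩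
  rw [← funext hxc]
  exact hc

/-- Testing the equation with the eigenfunction itself makes `lam` its Rayleigh quotient. The trace
is nonzero, for otherwise gradient and trace would both vanish and Friedrichs' inequality would kill
the function. -/
lemma K_le_of_isEigenvalue {A Γ : Set Plane} (hA : IsOpen A) (hb : Bornology.IsBounded A)
    (hlip : HasLipschitzBoundary A) (hΓ : Γ ⊆ frontier A)
    (hΓm : NullMeasurableSet Γ (Measure.hausdorffMeasure 1)) (hne : (energies Γ A).Nonempty)
    {lam : ℝ} (h : IsEigenvalue A Γ lam) : K Γ A ≤ lam := by
  obtain ⟨u, hu⟩ := h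
  obtain ⟨⟨x, hx, hx0⟩, hharm, w, hw, hwu, hel⟩ := (isEigenfunction_iff hA hb hlip hΓ hΓm).1 hu
  have hself := hel w hw
  rw [real_inner_self_eq_norm_sq, real_inner_self_eq_norm_sq] at hself
  have hT : w.2.2 ≠ 0 := fun h0 => hx0 <| eq_zero_of_ae_eq_zero hA
    (continuousOn_of_harmonicOnNhd hharm) (hwu.symm.trans (Lp.eq_zero_iff_ae_eq_zero.1
      (eq_zero_of_grad_trace_eq_zero hA hb hlip hw.1 (by simpa [h0] using hself) h0))) x hx
  have hray := rayleigh (exists_ground_state hA hb hlip hΓ hΓm hne).1 hw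
  rw [hself] at hray
  have : 0 < ‖w.2.2‖ ^ 2 := pow_pos (norm_pos_iff.2 hT) 2
  exact le_of_mul_le_mul_right hray this

/-! ### Only one eigenvalue has a positive eigenfunction. -/

/-- The triple built for `|w|` has the same function as `w`, hence is the same triple, and its trace
is an absolute value. -/
lemma trace_nonneg {A Γ : Set Plane} (hA : IsOpen A) (hb : Bornology.IsBounded A)
    (hlip : HasLipschitzBoundary A) {w : Triple A} (hw : w ∈ V A Γ)
    (h : 0 ≤ᵐ[volume.restrict A] w.1) : 0 ≤ᵐ[bdryMeasure A] w.2.2 := by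
  obtain ⟨z, hz, hz1, hz3, -⟩ := exists_abs_mem_V hA hb hlip hw
  have hzw : z = w := by
    rw [← sub_eq_zero]
    refine eq_zero_of_fst_eq_zero hA hb hlip (sub_mem hz.1 hw.1) ?_
    rw [Prod.fst_sub, sub_eq_zero]
    refine Lp.ext ?_
    filter_upwards [hz1, h] with x hx h0
    rw [hx, abs_of_nonneg h0]
  rw [hzw] at hz3
  filter_upwards [hz3] with x hx
  rw [hx]
  exact abs_nonneg _

lemma mul_ae_eq_zero_of_inner_eq_zero {α : Type*} [MeasurableSpace α] {μ : Measure α}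
    {f g : Lp ℝ 2 μ} (hf : 0 ≤ᵐ[μ] f) (hg : 0 ≤ᵐ[μ] g) (h : inner ℝ f g = 0) :
    ∀ᵐ x ∂μ, f x * g x = 0 := by
  have e : inner ℝ f g = ∫ x, f x * g x ∂μ := by
    rw [L2.inner_def]
    exact integral_congr_ae (Eventually.of_forall fun x => mul_comm _ _)
  rw [e, integral_eq_zero_iff_of_nonneg_ae] at h
  · exact h
  · filter_upwards [hf, hg] with x h1 h2 using mul_nonneg h1 h2
  · exact (Lp.memLp f).integrable_mul (Lp.memLp g)

/-- Two positive weak solutions belong to the same eigenvalue. -/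
lemma IsWeakSolution.eq_of_pos {A Γ : Set Plane} (hA : IsOpen A) (hAne : A.Nonempty)
    (hb : Bornology.IsBounded A) (hlip : HasLipschitzBoundary A) {l₁ l₂ : ℝ} {w₁ w₂ : Triple A}
    (hw₁ : w₁ ∈ V A Γ) (hw₂ : w₂ ∈ V A Γ) (hel₁ : IsWeakSolution Γ l₁ w₁)
    (hel₂ : IsWeakSolution Γ l₂ w₂) (hp₁ : ∀ᵐ x ∂volume.restrict A, 0 < w₁.1 x)
    (hp₂ : ∀ᵐ x ∂volume.restrict A, 0 < w₂.1 x) : l₁ = l₂ := by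
  by_contra hne
  -- Each solution is tested with the other, and the symmetric gradient terms are compared.
  have hT : inner ℝ w₁.2.2 w₂.2.2 = 0 := by
    have h1 := hel₁ w₂ hw₂
    have h2 := hel₂ w₁ hw₁
    rw [real_inner_comm, h1, real_inner_comm] at h2
    have : (l₁ - l₂) * inner ℝ w₁.2.2 w₂.2.2 = 0 := by
      rw [real_inner_comm] at h2
      linarith
    exact (mul_eq_zero.1 this).resolve_left (sub_ne_zero.2 hne)
  have hG : inner ℝ w₁.2.1 w₂.2.1 = 0 := by rw [hel₁ w₂ hw₂, hT, mul_zero]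
  have hT₁ := trace_nonneg hA hb hlip hw₁ (hp₁.mono fun _ h => h.le)
  have hT₂ := trace_nonneg hA hb hlip hw₂ (hp₂.mono fun _ h => h.le)
  obtain ⟨z, hz, hz1, hz3, hz2⟩ := exists_abs_mem_V hA hb hlip (sub_mem hw₂ hw₁)
  obtain ⟨d, hd⟩ : ∃ d, d = z - (w₁ + w₂) := ⟨_, rfl⟩
  have hdV : d ∈ V A Γ := hd ▸ sub_mem hz (add_mem hw₁ hw₂)
  -- Nonnegative traces with zero inner product are nowhere both nonzero, so `|T₂ - T₁| = T₁ + T₂`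
  -- almost everywhere.
  have hd3 : d.2.2 = 0 := by
    rw [hd, Prod.snd_sub, Prod.snd_sub, sub_eq_zero]
    refine Lp.ext ?_
    filter_upwards [hz3, Lp.coeFn_sub w₂.2.2 w₁.2.2, Lp.coeFn_add w₁.2.2 w₂.2.2, hT₁, hT₂,
      mul_ae_eq_zero_of_inner_eq_zero hT₁ hT₂ hT] with x h1 h2 h3 h4 h5 h6
    simp only [Prod.snd_sub, Prod.snd_add, Pi.zero_apply] at h1 h2 h3 h4 h5 ⊢
    rw [h1, h2, h3, Pi.sub_apply, Pi.add_apply]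
    rcases mul_eq_zero.1 h6 with h | h
    · rw [h, sub_zero, zero_add, abs_of_nonneg h5]
    · rw [h, zero_sub, add_zero, abs_neg, abs_of_nonneg h4]
  -- As `d` has zero trace, the weak equations make its gradient orthogonal to those of `w₁` and
  -- `w₂`. So `z` has the energy of `w₁ + w₂` plus that of `d`, yet at most the energy of `w₂ - w₁`,
  -- which equals that of `w₁ + w₂` by `hG`.
  have hd2 : d.2.1 = 0 := by
    have o1 : inner ℝ w₁.2.1 d.2.1 = 0 := by rw [hel₁ d hdV, hd3, inner_zero_right, mul_zero]
    have o2 : inner ℝ w₂.2.1 d.2.1 = 0 := by rw [hel₂ d hdV, hd3, inner_zero_right, mul_zero]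
    have hsum : z.2.1 = (w₁.2.1 + w₂.2.1) + d.2.1 := by
      rw [hd, Prod.snd_sub, Prod.fst_sub, Prod.snd_add, Prod.fst_add, add_sub_cancel]
    have h := pow_le_pow_left₀ (norm_nonneg _) hz2 2
    rw [hsum, Prod.snd_sub, Prod.fst_sub, norm_add_sq_real (w₁.2.1 + w₂.2.1), norm_add_sq_real w₁.2.1,
      norm_sub_sq_real, inner_add_left, o1, o2, hG, real_inner_comm w₁.2.1, hG] at h
    have : ‖d.2.1‖ ^ 2 ≤ 0 := by linarith
    exact norm_eq_zero.1 (pow_eq_zero_iff two_ne_zero |>.1 (this.antisymm (sq_nonneg _)))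
  have hd1 := eq_zero_of_grad_trace_eq_zero hA hb hlip hdV.1 hd2 hd3
  rw [hd, Prod.fst_sub, sub_eq_zero] at hd1
  -- Now `|w₂ - w₁| = w₁ + w₂` almost everywhere, whereas the left side is strictly smaller for
  -- positive values.
  have hF : ∀ᵐ x ∂volume.restrict A, False := by
    rw [hd1] at hz1
    filter_upwards [hz1, Lp.coeFn_sub w₂.1 w₁.1, Lp.coeFn_add w₁.1 w₂.1, hp₁, hp₂]
      with x h1 h2 h3 h4 h5
    simp only [Prod.fst_sub, Prod.fst_add] at h1
    rw [h2, h3, Pi.sub_apply, Pi.add_apply] at h1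
    rcases abs_cases (w₂.1 x - w₁.1 x) with h | h <;> linarith
  rw [ae_iff] at hF
  simp only [not_false_eq_true, Set.ofPred_true, Measure.restrict_apply_univ] at hF
  exact (hA.measure_pos volume hAne).ne' hF

end Steklov
end

theorem mainTheorem4 (A Γ : Set Steklov.Plane)
    (hA_open : IsOpen A) (hA_bdd : Bornology.IsBounded A)
    (hA_lip : Steklov.HasLipschitzBoundary A)
    (hΓ_sub : Γ ⊆ frontier A)
    (hΓ_meas : NullMeasurableSet Γ (Measure.hausdorffMeasure 1))
    (hΓ_int : ∃ U : Set Steklov.Plane, IsOpen U ∧ (U ∩ frontier A).Nonempty ∧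
      U ∩ frontier A ⊆ Γ) :
    (Steklov.energies Γ A).Nonempty ∧
    IsLeast {lam : ℝ | Steklov.IsEigenvalue A Γ lam} (Steklov.K Γ A) ∧
    (IsConnected A → ∀ lam : ℝ,
      (∃ u : Steklov.Plane → ℝ, Steklov.IsEigenfunction A Γ lam u ∧ ∀ x ∈ A, 0 < u x) ↔
        lam = Steklov.K Γ A) := by
  have hne : (Steklov.energies Γ A).Nonempty := by
    obtain ⟨w, hw, h1⟩ := Steklov.exists_mem_V_norm_trace_eq_one hA_open hA_bdd hA_lip hΓ_int
    rw [Steklov.energies_eq hA_open hA_bdd hA_lip hΓ_sub hΓ_meas]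
    exact ⟨_, w, hw, h1, rfl⟩
  obtain ⟨hk, w, hw, hw1, hwK⟩ :=
    Steklov.exists_ground_state hA_open hA_bdd hA_lip hΓ_sub hΓ_meas hne
  have hel : ∀ z ∈ Steklov.V A Γ, ‖z.2.2‖ = 1 → ‖z.2.1‖ ^ 2 = Steklov.K Γ A →
      Steklov.IsWeakSolution Γ (Steklov.K Γ A) z := fun z hz h1 h2 _ hy =>
    Steklov.euler_lagrange hk hz (by rw [h1, h2, one_pow, mul_one]) hy
  have hnz : ∀ z : Steklov.Triple A, ‖z.2.2‖ = 1 → z ≠ 0 := by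
    rintro z h1 rfl
    simp at h1
  refine ⟨hne, ⟨?_, fun lam h =>
    Steklov.K_le_of_isEigenvalue hA_open hA_bdd hA_lip hΓ_sub hΓ_meas hne h⟩, fun hconn lam => ?_⟩
  · obtain ⟨u, hu, -⟩ := Steklov.isEigenfunction_of_weak hA_open hA_bdd hA_lip hΓ_sub hΓ_meas hw
      (hnz w hw1) (hel w hw hw1 hwK)
    exact ⟨u, hu⟩
  -- The absolute value of the minimizer has the same trace norm and no more energy, so it is a
  -- minimizer too, now nonnegative.
  obtain ⟨z, hz, hz1, hz3, hz2⟩ := Steklov.exists_abs_mem_V hA_open hA_bdd hA_lip hw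
  have hzT : ‖z.2.2‖ = 1 := by
    rw [← hw1]
    refine le_antisymm (Lp.norm_le_norm_of_ae_le ?_) (Lp.norm_le_norm_of_ae_le ?_) <;>
      filter_upwards [hz3] with x hx <;> simp [hx]
  have hzK : ‖z.2.1‖ ^ 2 = Steklov.K Γ A :=
    (hwK ▸ pow_le_pow_left₀ (norm_nonneg _) hz2 2).antisymm (hk z hz hzT)
  obtain ⟨u, hu, hzu, hpos⟩ := Steklov.exists_pos_eigenfunction hA_open hA_bdd hA_lip hΓ_sub
    hΓ_meas hconn.isPreconnected hz (hnz z hzT) (hel z hz hzT hzK) (hz1.mono fun x hx => by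
      rw [hx]
      exact abs_nonneg _)
  refine ⟨?_, fun h => ⟨u, h ▸ hu, hpos⟩⟩
  rintro ⟨v, hv, hvpos⟩
  obtain ⟨-, -, y, hy, hyv, hyel⟩ :=
    (Steklov.isEigenfunction_iff hA_open hA_bdd hA_lip hΓ_sub hΓ_meas).1 hv
  refine Steklov.IsWeakSolution.eq_of_pos hA_open hconn.nonempty hA_bdd hA_lip hy hz hyel
    (hel z hz hzT hzK) ?_ ?_
  · filter_upwards [hyv, ae_restrict_mem hA_open.measurableSet] with x hx hxA
    rw [hx]
    exact hvpos x hxA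
  · filter_upwards [hzu, ae_restrict_mem hA_open.measurableSet] with x hx hxA
    rw [hx]
    exact hpos x hxA
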